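/- Let $g \ge 0$, $n \ge 1$ be integers with $2g-2+n>0$ and $(g,n)\neq(0,3)$, and let $L=(L_1,\dots,L_n)\in\mathbb{R}_{>0}^n$ be non-resonant, i.e. $\sum_{i=1}^n \epsilon_i L_i\neq 0$ for every non-zero map $\epsilon\colon\{1,\dots,n\}\to\{-1,0,1\}$. For a connected trivalent ribbon graph $G$ of type $(g,n)$ (genus $g$, with $n$ faces labelled $\partial_1G,\dots,\partial_nG$) and edge set $E_G$, let $$\mathfrak{Z}_G(L)=\{\ell\in\mathbb{R}_{>0}^{E_G}\;:\;\ell(\partial_iG)=L_i \text{ for all } i\},$$ where $\ell(\partial_i G)$ is the sum of the lengths, counted with multiplicity, of the edges around $\partial_iG$. Let $\Lambda_G(L)$ be the set of vertices of the closure of this polytope and, for $\lambda\in\Lambda_G(L)$, let $E[\lambda]=\{e\in E_G:\lambda_e=0\}$. For $E'\subseteq E_G$, let $G|_{E'}$ be the ribbon graph with edge set $E'$, whose vertices are those incident to $E'$, with the induced cyclic orders. For a (possibly disconnected) ribbon graph $\Gamma$ with edge set $E_\Gamma\neq\emptyset$ and underlying surface $\Sigma_\Gamma$ (the oriented surface with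 boundary onto which $\Gamma$ embeds as a spine), put $$\hat{s}(\Gamma)=\frac{\#E_\Gamma}{\dim \mathrm{MF}^\bullet_{\Sigma_\Gamma}}\in(0,+\infty],$$ with value $+\infty$ if the denominator is $0$. Here $\mathrm{MF}^\bullet_{\Sigma}$ is the piecewise linear space of measured foliations on $\Sigma$ (up to isotopy and Whitehead moves, empty foliation included) for which the boundary of $\Sigma$ is allowed to be a union of smooth and singular leaves. For a connected surface of genus $h$ with $k$ boundary components and $2h-2+k>0$ it has dimension $6h-6+3k$; for a cylinder it is $\mathbb{R}_{\ge0}$ (the non-negative multiples of the core curve), of dimension $1$; for a disk it is $\{0\}$; and for a disjoint union of surfaces it is the product over the components. Then, as $G$ ranges over connected trivalent ribbon graphs of type $(g,n)$, $\lambda$ over $\Lambda_G(L)$, and $E'$ over the non-empty subsets of $E[\lambda]$, the minimum of $\hat{s}(G|_{E'})$ exists and is equal to $$s^*_{g,n}=\begin{cases} 2 & \text{if } g=0 \text{ and } n\in\{4,5\},\\ \frac43+\frac23\,\frac{1}{\lfloor n/2\rfloor-2} & \text{if } g=0 \text{ and } n\ge 6,\\ 2 & \text{if } (g,n)=(1,1),\\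 \frac43 & \text{if } g=1 \text{ and } n\ge2,\\ 1+\frac{1}{3(2g-3)} & \text{if } g\ge2 \text{ and } n=1,\\ 1+\frac{1}{3(2g-1)} & \text{if } g\ge2 \text{ and } n\ge2. \end{cases}$$ -/

import Mathlib

open scoped ENNReal Topology

/-- A ribbon graph, described by its half-edges: `inv` exchanges the two half-edges of an edge,
`rot` sends a half-edge to the next one in the cyclic order around the vertex it is attached to. -/
structure RibbonGraph (H : Type*) where
  inv : Equiv.Perm H
  rot : Equiv.Perm H
  inv_inv : ∀ h, inv (inv h) = h
  inv_ne : ∀ h, inv h ≠ h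

namespace RibbonGraph

variable {H : Type*}

/-- The edges: pairs of exchanged half-edges. -/
def Edge (G : RibbonGraph H) : Type _ := Quotient (Equiv.Perm.SameCycle.setoid G.inv)

/-- The vertices: cycles of the rotation. -/
def Vertex (G : RibbonGraph H) : Type _ := Quotient (Equiv.Perm.SameCycle.setoid G.rot)

/-- The faces (boundary components of the geometric realisation): travel along a half-edge to the
other end of the edge, then turn to the next half-edge of the vertex reached. -/
def Face (G : RibbonGraph H) : Type _ := Quotient (Equiv.Perm.SameCycle.setoid (G.rot * G.inv))

/-- The edge containing a half-edge. -/
def edge (G : RibbonGraph H) (h : H) : G.Edge := Quotient.mk _ h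

/-- The vertex to which a half-edge is attached. -/
def vertex (G : RibbonGraph H) (h : H) : G.Vertex := Quotient.mk _ h

/-- The face running along a half-edge. Every edge has two sides, one for each half-edge. -/
def face (G : RibbonGraph H) (h : H) : G.Face := Quotient.mk _ h

/-- Connectedness (the empty graph is not connected). -/
def Connected (G : RibbonGraph H) : Prop :=
  Nonempty H ∧ ∀ h k : H, ∃ p ∈ Subgroup.closure ({G.inv, G.rot} : Set (Equiv.Perm H)), p h = k

/-- Every vertex has valency three. -/
def Trivalent (G : RibbonGraph H) : Prop :=
  ∀ v : G.Vertex, Nat.card {h : H // G.vertex h = v} = 3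

/-- The genus of the geometric realisation is `g`, through the Euler relation
`#V - #E + #F = 2 - 2g` (for connected graphs). -/
def HasGenus (G : RibbonGraph H) (g : ℕ) : Prop :=
  (Nat.card G.Vertex : ℤ) - Nat.card G.Edge + Nat.card G.Face = 2 - 2 * g

theorem edge_inv (G : RibbonGraph H) (h : H) : G.edge (G.inv h) = G.edge h :=
  Quotient.sound ⟨-1, by simp⟩

/-! ### The ribbon graph spanned by a set of edges -/

section Restrict

variable [Finite H]

theorem exists_return (G : RibbonGraph H) (E' : Set G.Edge) (h : {h : H // G.edge h ∈ E'}) :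
    ∃ k : ℕ, 0 < k ∧ G.edge ((G.rot ^ k) h.1) ∈ E' :=
  ⟨orderOf G.rot, (isOfFinOrder_of_finite G.rot).orderOf_pos, by
    rw [pow_orderOf_eq_one]; exact h.2⟩

open Classical in
/-- The number of turns needed to meet again a half-edge belonging to `E'`. -/
noncomputable def returnTime (G : RibbonGraph H) (E' : Set G.Edge)
    (h : {h : H // G.edge h ∈ E'}) : ℕ :=
  Nat.find (G.exists_return E' h)

/-- The next half-edge belonging to `E'` around the same vertex. -/
noncomputable def nextIn (G : RibbonGraph H) (E' : Set G.Edge)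
    (h : {h : H // G.edge h ∈ E'}) : {h : H // G.edge h ∈ E'} :=
  ⟨(G.rot ^ G.returnTime E' h) h.1, by
    classical exact (Nat.find_spec (G.exists_return E' h)).2⟩

theorem nextIn_injective (G : RibbonGraph H) (E' : Set G.Edge) :
    Function.Injective (G.nextIn E') := by
  classical
  have key : ∀ a b, G.nextIn E' a = G.nextIn E' b →
      G.returnTime E' a ≤ G.returnTime E' b → a = b := by
    intro a b hab hle
    have h1 : (G.rot ^ G.returnTime E' a) a.1 = (G.rot ^ G.returnTime E' b) b.1 :=
      congrArg Subtype.val hab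
    obtain ⟨d, hd⟩ := Nat.exists_eq_add_of_le hle
    rw [hd, pow_add, Equiv.Perm.mul_apply] at h1
    have h2 : a.1 = (G.rot ^ d) b.1 := (G.rot ^ G.returnTime E' a).injective h1
    rcases Nat.eq_zero_or_pos d with h0 | hpos
    · subst h0
      exact Subtype.ext (by simpa using h2)
    · exfalso
      have ha : 0 < G.returnTime E' a := (Nat.find_spec (G.exists_return E' a)).1
      have : G.returnTime E' b ≤ d :=
        Nat.find_min' (G.exists_return E' b) ⟨hpos, h2 ▸ a.2⟩
      omega
  intro a b hab
  rcases le_total (G.returnTime E' a) (G.returnTime E' b) with h | h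
  · exact key a b hab h
  · exact (key b a hab.symm h).symm

/-- The ribbon graph `G|_{E'}` with set of edges `E'`, the vertices being those incident to `E'`,
each with the induced cyclic order. -/
noncomputable def restrict (G : RibbonGraph H) (E' : Set G.Edge) :
    RibbonGraph {h : H // G.edge h ∈ E'} where
  inv := G.inv.subtypePerm fun h => by rw [edge_inv]
  rot := Equiv.ofBijective (G.nextIn E') (Finite.injective_iff_bijective.1 (G.nextIn_injective E'))
  inv_inv h := Subtype.ext (G.inv_inv h.1)
  inv_ne h e := G.inv_ne h.1 (congrArg Subtype.val e)

end Restrict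

/-! ### Measured foliations on the surface of a ribbon graph -/

/-- `c` and `d` separate `a` from `b`: the half-edges `a, c, b, d` are met in this order
when turning once around a vertex. -/
def Linked (G : RibbonGraph H) (a b c d : H) : Prop :=
  ∃ i j k : ℕ, 0 < i ∧ i < j ∧ j < k ∧ k < Function.minimalPeriod G.rot a ∧
    c = (G.rot ^ i) a ∧ b = (G.rot ^ j) a ∧ d = (G.rot ^ k) a

/-- The space `MF^•` of (classes of) measured foliations on the oriented surface with boundary onto
which the ribbon graph `G` embeds as a spine, the boundary being allowed to be a union of leaves,
and the empty foliation being included.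

The arcs dual to the edges cut the surface into one polygon for each vertex `v` of `G`; the
half-edges attached to `v` are the arcs bounding this polygon. Up to isotopy and Whitehead moves, a
measured foliation is in normal position with respect to the arcs: in each polygon it consists of
bands of parallel leaves joining distinct arcs, which do not cross. `w a b` is the
transverse measure of the band joining `a` and `b`. The total measures computed on the two sides of
an arc agree; their common value is the intersection number of the foliation with this arc.
The points with integral coordinates are the multicurves, components homotopic to the boundary
being allowed.

The dimension is `6g - 6 + 3n` for a connected surface with `2g - 2 + n > 0`. A disk carries only the
empty foliation, a cylinder only the multiples of its core curve (dimension `1`), and a disjoint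
union of surfaces gives the product. -/
def MFBullet [Fintype H] (G : RibbonGraph H) : Set (H → H → ℝ) :=
  {w | (∀ a b, 0 ≤ w a b) ∧
    (∀ a b, w a b = w b a) ∧
    (∀ a, w a a = 0) ∧
    (∀ a b, G.vertex a ≠ G.vertex b → w a b = 0) ∧
    (∀ a b c d, G.Linked a b c d → w a b = 0 ∨ w c d = 0) ∧
    (∀ a, ∑ b, w a b = ∑ b, w (G.inv a) b)}

end RibbonGraph

/-- The dimension of a finite union of convex polyhedra: the largest dimension of the affine hull
of a convex subset. -/
noncomputable def polyhedralDim {V : Type*} [AddCommGroup V] [Module ℝ V] (S : Set V) : ℕ :=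
  sSup {d : ℕ | ∃ C : Set V, Convex ℝ C ∧ C ⊆ S ∧ Module.finrank ℝ (vectorSpan ℝ C) = d}

namespace RibbonGraph

/-- `ŝ(Γ) = #E_Γ / dim MF^•`, equal to `+∞` if `Γ` has an edge and the denominator is zero. -/
noncomputable def sHat {H : Type*} [Fintype H] (Γ : RibbonGraph H) : ℝ≥0∞ :=
  (Nat.card Γ.Edge : ℝ≥0∞) / (polyhedralDim Γ.MFBullet : ℝ≥0∞)

/-! ### Cells -/

open Classical in
/-- The length of a face: the sum of the lengths of the edges around it, with multiplicity. -/
noncomputable def perimeter {H : Type*} [Fintype H] (G : RibbonGraph H) (l : G.Edge → ℝ)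
    (f : G.Face) : ℝ :=
  ∑ h : H with G.face h = f, l (G.edge h)

/-- The cell of metrics on `G` with perimeters `L`, the faces being labelled by `lab`. -/
def cell {H : Type*} [Fintype H] (G : RibbonGraph H) {n : ℕ} (lab : Fin n ≃ G.Face)
    (L : Fin n → ℝ) : Set (G.Edge → ℝ) :=
  {l | (∀ e, 0 < l e) ∧ ∀ i, G.perimeter l (lab i) = L i}

/-- The set `Λ_G(L)` of vertices of the closure of the cell. -/
def cellVertices {H : Type*} [Fintype H] (G : RibbonGraph H) {n : ℕ} (lab : Fin n ≃ G.Face)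
    (L : Fin n → ℝ) : Set (G.Edge → ℝ) :=
  (closure (G.cell lab L)).extremePoints ℝ

open Classical in
/-- The set of all values `ŝ(G|_{E'})`, for `G` a connected trivalent ribbon graph of genus `g` with
`n` labelled faces, `lam` a vertex of the closure of its cell, and `E'` a non-empty set of edges of
length zero at `lam`. -/
noncomputable def sHatValues (g n : ℕ) (L : Fin n → ℝ) : Set ℝ≥0∞ :=
  {s | ∃ (H : Type) (_ : Fintype H) (G : RibbonGraph H) (lab : Fin n ≃ G.Face),
    G.Connected ∧ G.Trivalent ∧ G.HasGenus g ∧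
    ∃ lam ∈ G.cellVertices lab L, ∃ E' : Set G.Edge,
      E'.Nonempty ∧ E' ⊆ {e | lam e = 0} ∧ s = (G.restrict E').sHat}

end RibbonGraph

/-- No non-trivial combination of the `L i` with coefficients in `{-1, 0, 1}` vanishes. -/
def NonResonant {n : ℕ} (L : Fin n → ℝ) : Prop :=
  ∀ ε : Fin n → SignType, ε ≠ 0 → ∑ i, (ε i : ℝ) * L i ≠ 0

/-- The explicit value of the minimum. -/
noncomputable def sStar (g n : ℕ) : ℝ :=
  if g = 0 then
    if n ≤ 5 then 2 else 4 / 3 + 2 / 3 * (1 / (((n / 2 : ℕ) : ℝ) - 2))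
  else if g = 1 then
    if n = 1 then 2 else 4 / 3
  else
    if n = 1 then 1 + 1 / (3 * (2 * (g : ℝ) - 3)) else 1 + 1 / (3 * (2 * (g : ℝ) - 1))

/-! Lower bound. Let `A` be the set of half-edges of `E'`. Every `L i` is positive, so each face of
`G` has a half-edge outside `A`; nothing else about the vertex `lam` is needed. At a trivalent
vertex the bands of a foliation are determined by its intersection numbers with the arcs. Hence the
foliations of the subgraph form, up to a linear change of coordinates, the cone of edge weights
supported on `A` satisfying the triangle inequalities (`weightCone`), and the dimension is the rank
of the span of this cone.

Pruning an edge at a univalent vertex does not lower the dimension, and the dimension is subadditive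
on disjoint unions. So it suffices to treat an indecomposable subgraph without univalent vertices
(`mul_foliationDim_le`). A circle has dimension at most `1` and at least two edges, since a loop
would bound a face: ratio at least `2`. Otherwise the equations at the `d` bivalent vertices are
independent (`range_cornerMap_eq_top`), so the dimension is `#E - d`. This equals `3χ`, where `-χ`
is the Euler characteristic, and the ratio is `1 + d/(3χ)`.

If the subgraph has `k` faces, three constraints hold (`subgraph_constraints`). First, `k ≤ d`: a
face with no edge attached would be a face of `G`. Second, `χ = 2(g - j) - 2 + k` with `j ≥ 0`.
Third, `2χ + 4 ≤ 4g + n`, that is `n ≤ 2(2g - 2 + n - χ)`: a complementary piece of Euler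
characteristic `-c` carries at most `2c` faces of `G`. The last two are obtained by adding edges one
at a time until `G` is reached, each edge multiplying the face permutation by a transposition.
Optimising under these constraints gives `sStar` (`sStar_mul_le`).

Attainment. Trivalent pieces are glued along legs. In positive genus the contracted subgraph is a
one-faced graph of genus `g` (of genus `g - 1` if `n = 1`) joined to the rest by a single edge; in
genus `0` it is a tower of circles with `χ + 2` faces; for `(1, 1)` it is a cycle in the theta
graph. Metrics giving length `t` to the contracted edges lie in the cell for `t > 0` and in its
closure for `t = 0`, and an extreme point of the compact set where these edges vanish is the
required `lam` (`exists_cellVertex`). The nested faces need decreasing perimeters: non-resonance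
makes the `L i` distinct, and the labels may be permuted. -/

set_option linter.unusedSectionVars false

/-! ### Cycles of a permutation and multiplication by a transposition -/

namespace Equiv.Perm

section Cycles

variable {α : Type*} [Fintype α]

open Classical in
/-- The cycle (orbit) of a point, as a finite set. -/
noncomputable def cyc (f : Perm α) (x : α) : Finset α := {y | f.SameCycle x y}

open Classical in
/-- The cycles of a permutation, fixed points included. -/
noncomputable def cycles (f : Perm α) : Finset (Finset α) := Finset.univ.image f.cyc

theorem mem_cyc {f : Perm α} {x y : α} : y ∈ f.cyc x ↔ f.SameCycle x y := by
  simp [cyc]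

theorem self_mem_cyc (f : Perm α) (x : α) : x ∈ f.cyc x := mem_cyc.2 (SameCycle.refl f x)

theorem cyc_eq_iff {f : Perm α} {x y : α} : f.cyc x = f.cyc y ↔ f.SameCycle x y := by
  refine ⟨fun h => ?_, fun h => ?_⟩
  · rw [← mem_cyc, h]; exact self_mem_cyc f y
  · ext z
    rw [mem_cyc, mem_cyc]
    exact ⟨fun hz => h.symm.trans hz, fun hz => h.trans hz⟩

theorem mem_cycles {f : Perm α} {C : Finset α} : C ∈ f.cycles ↔ ∃ x, f.cyc x = C := by
  simp [cycles]

theorem cyc_mem_cycles (f : Perm α) (x : α) : f.cyc x ∈ f.cycles := mem_cycles.2 ⟨x, rfl⟩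

theorem eq_cyc_of_mem {f : Perm α} {C : Finset α} {x : α} (hC : C ∈ f.cycles) (hx : x ∈ C) :
    C = f.cyc x := by
  obtain ⟨y, rfl⟩ := mem_cycles.1 hC
  exact cyc_eq_iff.2 (mem_cyc.1 hx)

theorem apply_mem_of_mem_cycles {f : Perm α} {C : Finset α} {x : α} (hC : C ∈ f.cycles)
    (hx : x ∈ C) : f x ∈ C := by
  rw [eq_cyc_of_mem hC hx, mem_cyc]
  exact ⟨1, by simp⟩

theorem SameCycle.exists_nat_pow {f : Perm α} {x y : α} (h : f.SameCycle x y) :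
    ∃ n : ℕ, (f ^ n) x = y := by
  obtain ⟨n, -, hn⟩ := h.exists_pow_eq'
  exact ⟨n, hn⟩

/-- Forward invariance suffices: on a finite type, non-negative powers exhaust a cycle. -/
theorem SameCycle.mem_of_invariant {f : Perm α} {x y : α} (h : f.SameCycle x y) {S : Set α}
    (hS : ∀ z ∈ S, f z ∈ S) (hx : x ∈ S) : y ∈ S := by
  obtain ⟨n, rfl⟩ := h.exists_nat_pow
  induction n with
  | zero => simpa using hx
  | succ n ih =>
    rw [pow_succ', mul_apply]
    exact hS _ (ih ⟨n, by simp⟩)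

variable [DecidableEq α]

theorem sameCycle_mul_swap_of_not {f : Perm α} {a b x y : α} (ha : ¬ f.SameCycle x a)
    (hb : ¬ f.SameCycle x b) : (f * swap a b).SameCycle x y ↔ f.SameCycle x y := by
  have key : ∀ n : ℕ, ((f * swap a b) ^ n) x = (f ^ n) x := by
    intro n
    induction n with
    | zero => rfl
    | succ n ih =>
      have h1 : (f ^ n) x ≠ a := fun h => ha ⟨n, by simpa using h⟩
      have h2 : (f ^ n) x ≠ b := fun h => hb ⟨n, by simpa using h⟩
      rw [pow_succ', mul_apply, ih, mul_apply, swap_apply_of_ne_of_ne h1 h2, pow_succ', mul_apply]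
  constructor
  · intro h
    obtain ⟨n, hn⟩ := h.exists_nat_pow
    exact ⟨n, by rw [zpow_natCast, ← key, hn]⟩
  · intro h
    obtain ⟨n, hn⟩ := h.exists_nat_pow
    exact ⟨n, by rw [zpow_natCast, key, hn]⟩

theorem cyc_mul_swap_of_not {f : Perm α} {a b x : α} (ha : ¬ f.SameCycle x a)
    (hb : ¬ f.SameCycle x b) : (f * swap a b).cyc x = f.cyc x := by
  ext y
  rw [mem_cyc, mem_cyc, sameCycle_mul_swap_of_not ha hb]

/-- The new permutation sends `b` to `f a` and then follows the `f`-cycle of `a`, which does not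
meet `b`, until it returns to `a`. -/
theorem sameCycle_mul_swap_of_left {f : Perm α} {a b x : α} (hab : ¬ f.SameCycle a b)
    (h : f.SameCycle a x) : (f * swap a b).SameCycle b x := by
  have h1 : (f * swap a b).SameCycle b (f a) := ⟨1, by simp⟩
  have key : ∀ n : ℕ, (f * swap a b).SameCycle b ((f ^ (n + 1)) a) := by
    intro n
    induction n with
    | zero => simpa using h1
    | succ n ih =>
      rw [pow_succ', mul_apply]
      by_cases hy : (f ^ (n + 1)) a = a
      · rw [hy]; exact h1
      · have hb : (f ^ (n + 1)) a ≠ b := fun e => hab ⟨(n + 1 : ℕ), by rw [zpow_natCast, e]⟩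
        refine ih.trans ⟨1, ?_⟩
        rw [zpow_one, mul_apply, swap_apply_of_ne_of_ne hy hb]
  obtain ⟨n, hn⟩ := ((f.sameCycle_apply_left).2 h).exists_nat_pow
  have := key n
  rwa [pow_succ, mul_apply, hn] at this

theorem sameCycle_mul_swap_of_right {f : Perm α} {a b x : α} (hab : ¬ f.SameCycle a b)
    (h : f.SameCycle b x) : (f * swap a b).SameCycle a x := by
  rw [swap_comm]
  exact sameCycle_mul_swap_of_left (fun h => hab h.symm) h

theorem sameCycle_mul_swap_self {f : Perm α} {a b : α} (hab : ¬ f.SameCycle a b) :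
    (f * swap a b).SameCycle a b :=
  sameCycle_mul_swap_of_right hab (SameCycle.refl f b)

theorem not_sameCycle_mul_swap {f : Perm α} {a b : α} (hab : f.SameCycle a b) (hne : a ≠ b) :
    ¬ (f * swap a b).SameCycle a b := by
  classical
  have hex : ∃ j : ℕ, 0 < j ∧ (f ^ j) a = b := by
    obtain ⟨n, hn⟩ := hab.exists_nat_pow
    refine ⟨n, Nat.pos_of_ne_zero ?_, hn⟩
    rintro rfl
    exact hne (by simpa using hn)
  obtain ⟨hj, hjb⟩ := Nat.find_spec hex
  set j := Nat.find hex with hjdef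
  have hmin : ∀ i, 0 < i → i < j → (f ^ i) a ≠ b := fun i hi hij e =>
    Nat.find_min hex hij ⟨hi, e⟩
  have hmina : ∀ i, 0 < i → i < j → (f ^ i) a ≠ a := by
    intro i hi hij e
    refine hmin (j - i) (by omega) (by omega) ?_
    rw [← hjb]
    conv_rhs => rw [show j = (j - i) + i by omega, pow_add, mul_apply, e]
  -- The arc from `f a` to the first occurrence of `b` closes up under `f * swap a b`, since `b` is
  -- now sent to `f a`, and it misses `a`.
  let S : Set α := {x | ∃ i, 0 < i ∧ i ≤ j ∧ (f ^ i) a = x}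
  intro h
  have : a ∈ S := by
    refine h.symm.mem_of_invariant (S := S) ?_ ⟨j, hj, le_rfl, hjb⟩
    rintro x ⟨i, hi, hij, rfl⟩
    rcases hij.eq_or_lt with rfl | hlt
    · exact ⟨1, one_pos, hj, by simp [hjb]⟩
    · refine ⟨i + 1, by omega, hlt, ?_⟩
      rw [mul_apply, swap_apply_of_ne_of_ne (hmina i hi hlt) (hmin i hi hlt), pow_succ', mul_apply]
  obtain ⟨i, hi, hij, e⟩ := this
  rcases hij.eq_or_lt with rfl | hlt
  · exact hne (e.symm.trans hjb)
  · exact hmina i hi hlt e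

theorem cyc_mul_swap {f : Perm α} {a b : α} (hab : ¬ f.SameCycle a b) :
    (f * swap a b).cyc a = f.cyc a ∪ f.cyc b := by
  ext x
  rw [Finset.mem_union, mem_cyc, mem_cyc, mem_cyc]
  constructor
  · intro h
    by_contra! hx
    have := (sameCycle_mul_swap_of_not (a := a) (b := b) (fun e => hx.1 e.symm)
      (fun e => hx.2 e.symm) (y := a)).1 h.symm
    exact hx.1 this.symm
  · rintro (h | h)
    · exact (sameCycle_mul_swap_self hab).trans (sameCycle_mul_swap_of_left hab h)
    · exact sameCycle_mul_swap_of_right hab h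

/-- The cycles avoiding two given points. -/
noncomputable def cyclesAvoiding (f : Perm α) (a b : α) : Finset (Finset α) :=
  f.cycles.filter fun C => a ∉ C ∧ b ∉ C

theorem mem_cyclesAvoiding {f : Perm α} {a b : α} {C : Finset α} :
    C ∈ f.cyclesAvoiding a b ↔ C ∈ f.cycles ∧ a ∉ C ∧ b ∉ C := by
  simp [cyclesAvoiding]

theorem cyclesAvoiding_subset_mul_swap (f : Perm α) (a b : α) :
    f.cyclesAvoiding a b ⊆ (f * swap a b).cyclesAvoiding a b := by
  intro C hC
  rw [mem_cyclesAvoiding] at hC ⊢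
  refine ⟨?_, hC.2⟩
  obtain ⟨x, rfl⟩ := mem_cycles.1 hC.1
  rw [mem_cyc, mem_cyc] at hC
  exact mem_cycles.2 ⟨x, cyc_mul_swap_of_not hC.2.1 hC.2.2⟩

/-- The transposition is an involution, so one inclusion yields the other. Comparing cycle counts
then reduces to the one or two cycles through `a` and `b`: adding an edge changes the number of
faces by exactly one. -/
theorem cyclesAvoiding_mul_swap (f : Perm α) (a b : α) :
    (f * swap a b).cyclesAvoiding a b = f.cyclesAvoiding a b := by
  refine le_antisymm ?_ (cyclesAvoiding_subset_mul_swap f a b)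
  simpa [mul_assoc] using cyclesAvoiding_subset_mul_swap (f * swap a b) a b

theorem cycles_eq_of_sameCycle {f : Perm α} {a b : α} (hab : f.SameCycle a b) :
    f.cycles = insert (f.cyc a) (f.cyclesAvoiding a b) := by
  ext C
  rw [Finset.mem_insert, mem_cyclesAvoiding]
  constructor
  · intro hC
    by_cases ha : a ∈ C
    · exact Or.inl (eq_cyc_of_mem hC ha)
    by_cases hb : b ∈ C
    · exact Or.inl ((eq_cyc_of_mem hC hb).trans (cyc_eq_iff.2 hab.symm))
    exact Or.inr ⟨hC, ha, hb⟩
  · rintro (rfl | h)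
    · exact cyc_mem_cycles f a
    · exact h.1

theorem cycles_eq_of_not_sameCycle (f : Perm α) (a b : α) :
    f.cycles = insert (f.cyc a) (insert (f.cyc b) (f.cyclesAvoiding a b)) := by
  ext C
  rw [Finset.mem_insert, Finset.mem_insert, mem_cyclesAvoiding]
  constructor
  · intro hC
    by_cases ha : a ∈ C
    · exact Or.inl (eq_cyc_of_mem hC ha)
    by_cases hb : b ∈ C
    · exact Or.inr (Or.inl (eq_cyc_of_mem hC hb))
    exact Or.inr (Or.inr ⟨hC, ha, hb⟩)
  · rintro (rfl | rfl | h)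
    · exact cyc_mem_cycles f a
    · exact cyc_mem_cycles f b
    · exact h.1

theorem cyc_notMem_cyclesAvoiding_left (f : Perm α) (a b : α) :
    f.cyc a ∉ f.cyclesAvoiding a b := fun h =>
  (mem_cyclesAvoiding.1 h).2.1 (self_mem_cyc f a)

theorem cyc_notMem_cyclesAvoiding_right (f : Perm α) (a b : α) :
    f.cyc b ∉ f.cyclesAvoiding a b := fun h =>
  (mem_cyclesAvoiding.1 h).2.2 (self_mem_cyc f b)

theorem card_cycles_of_sameCycle {f : Perm α} {a b : α} (hab : f.SameCycle a b) :
    f.cycles.card = (f.cyclesAvoiding a b).card + 1 := by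
  rw [cycles_eq_of_sameCycle hab,
    Finset.card_insert_of_notMem (cyc_notMem_cyclesAvoiding_left f a b)]

theorem card_cycles_of_not_sameCycle {f : Perm α} {a b : α} (hab : ¬ f.SameCycle a b) :
    f.cycles.card = (f.cyclesAvoiding a b).card + 2 := by
  rw [cycles_eq_of_not_sameCycle f a b, Finset.card_insert_of_notMem,
    Finset.card_insert_of_notMem (cyc_notMem_cyclesAvoiding_right f a b)]
  rw [Finset.mem_insert, not_or]
  exact ⟨fun h => hab (cyc_eq_iff.1 h), cyc_notMem_cyclesAvoiding_left f a b⟩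

end Cycles

end Equiv.Perm

/-! ### Trivalent ribbon graphs -/

namespace RibbonGraph

variable {H : Type*}

/-- Every rotation cycle has exactly three elements. -/
structure IsCubic (G : RibbonGraph H) : Prop where
  rot_rot_rot : ∀ h, G.rot (G.rot (G.rot h)) = h
  rot_ne : ∀ h, G.rot h ≠ h

theorem IsCubic.rot_rot_ne {G : RibbonGraph H} (hG : G.IsCubic) (h : H) :
    G.rot (G.rot h) ≠ h := by
  intro e
  have := hG.rot_rot_rot h
  rw [e] at this
  exact hG.rot_ne h this

theorem IsCubic.rot_rot_ne_rot {G : RibbonGraph H} (hG : G.IsCubic) (h : H) :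
    G.rot (G.rot h) ≠ G.rot h := hG.rot_ne _

theorem edge_eq_edge_iff {G : RibbonGraph H} {a b : H} :
    G.edge a = G.edge b ↔ b = a ∨ b = G.inv a := by
  constructor
  · intro h
    have h' : G.inv.SameCycle a b := Quotient.exact h
    obtain ⟨n, rfl⟩ := h'
    have h2 : G.inv ^ (2 : ℤ) = 1 := by
      ext x; simp [sq, G.inv_inv]
    rcases Int.even_or_odd' n with ⟨m, rfl | rfl⟩
    · left; rw [zpow_mul, h2, one_zpow]; rfl
    · right; rw [zpow_add, zpow_mul, h2, one_zpow]; simp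
  · rintro (rfl | rfl)
    · rfl
    · exact (edge_inv G a).symm

theorem vertex_eq_vertex_iff {G : RibbonGraph H} {a b : H} :
    G.vertex a = G.vertex b ↔ G.rot.SameCycle a b :=
  ⟨fun h => Quotient.exact h, fun h => Quotient.sound h⟩

theorem face_eq_face_iff {G : RibbonGraph H} {a b : H} :
    G.face a = G.face b ↔ (G.rot * G.inv).SameCycle a b :=
  ⟨fun h => Quotient.exact h, fun h => Quotient.sound h⟩

theorem IsCubic.sameCycle_rot_iff {G : RibbonGraph H} (hG : G.IsCubic) {a b : H} :
    G.rot.SameCycle a b ↔ b = a ∨ b = G.rot a ∨ b = G.rot (G.rot a) := by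
  constructor
  · rintro ⟨n, rfl⟩
    have h3 : G.rot ^ (3 : ℤ) = 1 := by
      ext x
      have := hG.rot_rot_rot x
      rw [show (3 : ℤ) = ((3 : ℕ) : ℤ) by rfl, zpow_natCast]
      simpa [pow_succ] using this
    obtain ⟨q, hq⟩ : ∃ q, n = 3 * q + n % 3 := ⟨n / 3, (Int.mul_ediv_add_emod n 3).symm⟩
    have hr : n % 3 = 0 ∨ n % 3 = 1 ∨ n % 3 = 2 := by omega
    rw [hq, zpow_add, zpow_mul, h3, one_zpow, one_mul]
    rcases hr with h | h | h <;> rw [h]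
    · left; simp
    · right; left; simp
    · right; right; simp [sq]
  · rintro (rfl | rfl | rfl)
    · exact Equiv.Perm.SameCycle.refl _ _
    · exact ⟨1, by simp⟩
    · exact ⟨2, by simp [sq]⟩

theorem IsCubic.card_vertex_fiber {G : RibbonGraph H} (hG : G.IsCubic) (v : G.Vertex) :
    Nat.card {h : H // G.vertex h = v} = 3 := by
  classical
  obtain ⟨a, rfl⟩ := Quotient.exists_rep v
  change Nat.card {h : H // G.vertex h = G.vertex a} = 3
  have : ∀ h, G.vertex h = G.vertex a ↔ h ∈ ({a, G.rot a, G.rot (G.rot a)} : Finset H) := by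
    intro h
    rw [eq_comm, vertex_eq_vertex_iff, hG.sameCycle_rot_iff]
    simp
  rw [Nat.card_congr (Equiv.subtypeEquivRight this), Nat.card_eq_fintype_card, Fintype.card_coe]
  rw [Finset.card_eq_three]
  exact ⟨a, _, _, (hG.rot_ne a).symm, (hG.rot_rot_ne a).symm, (hG.rot_ne _).symm, rfl⟩

theorem IsCubic.trivalent {G : RibbonGraph H} (hG : G.IsCubic) : G.Trivalent :=
  hG.card_vertex_fiber

/-- A set containing a rotation cycle has at least three elements, which excludes `rot h = h` and
`rot (rot h) = h`; if the third iterate were not `h`, four distinct half-edges would share a vertex.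
-/
theorem Trivalent.isCubic {G : RibbonGraph H} (hG : G.Trivalent) : G.IsCubic := by
  classical
  have key : ∀ h : H, ∀ s : Finset H, (∀ b, G.rot.SameCycle h b → b ∈ s) → 3 ≤ s.card := by
    intro h s hs
    rw [← hG (G.vertex h)]
    have hinj : Function.Injective
        (fun b : {b : H // G.vertex b = G.vertex h} =>
          (⟨b.1, hs _ (vertex_eq_vertex_iff.1 b.2.symm)⟩ : {b // b ∈ s})) := by
      intro b c e
      exact Subtype.ext (congrArg (fun x : {b // b ∈ s} => x.1) e)
    have := Nat.card_le_card_of_injective _ hinj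
    simpa using this
  have hne : ∀ h, G.rot h ≠ h := by
    intro h e
    have := key h {h} (by
      rintro b ⟨n, rfl⟩
      simpa using Equiv.Perm.zpow_apply_eq_self_of_apply_eq_self e n)
    simp at this
  have hne2 : ∀ h, G.rot (G.rot h) ≠ h := by
    intro h e
    have := key h {h, G.rot h} (by
      rintro b ⟨n, rfl⟩
      rcases Equiv.Perm.zpow_apply_eq_of_apply_apply_eq_self e n with h | h <;> simp [h])
    have h2 := Finset.card_le_two (a := h) (b := G.rot h)
    omega
  refine ⟨fun h => ?_, hne⟩
  by_contra hc
  let t : Finset H := {h, G.rot h, G.rot (G.rot h), G.rot (G.rot (G.rot h))}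
  have ht : t.card = 4 := by
    have h1 := hne h
    have h2 := hne2 h
    have h3 := hne (G.rot h)
    have h4 := hne2 (G.rot h)
    have h5 := hne (G.rot (G.rot h))
    simp only [t]
    rw [Finset.card_insert_of_notMem (by simp [h1.symm, h2.symm, Ne.symm hc]),
      Finset.card_insert_of_notMem (by
        simp only [Finset.mem_insert, Finset.mem_singleton]
        exact not_or.2 ⟨h3.symm, h4.symm⟩),
      Finset.card_pair h5.symm]
  have hfin : Finite {b : H // G.vertex b = G.vertex h} :=
    Nat.finite_of_card_ne_zero (by rw [hG]; norm_num)
  have hinj : Function.Injective (fun b : t => (⟨b.1, by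
      have hb := b.2
      rw [eq_comm, vertex_eq_vertex_iff]
      simp only [t, Finset.mem_insert, Finset.mem_singleton] at hb
      rcases hb with hb | hb | hb | hb <;> rw [hb]
      · exact ⟨1, by simp⟩
      · exact ⟨2, by simp [sq]⟩
      · exact ⟨3, by
          rw [show (3 : ℤ) = ((3 : ℕ) : ℤ) by rfl, zpow_natCast]
          simp [pow_succ]⟩⟩ : {b : H // G.vertex b = G.vertex h})) := by
    intro b c e
    exact Subtype.ext (congrArg (fun x : {b : H // G.vertex b = G.vertex h} => x.1) e)
  have := Nat.card_le_card_of_injective _ hinj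
  rw [hG] at this
  simp [ht] at this

theorem card_edge_fiber (G : RibbonGraph H) (e : G.Edge) :
    Nat.card {h : H // G.edge h = e} = 2 := by
  classical
  obtain ⟨a, rfl⟩ := Quotient.exists_rep e
  change Nat.card {h : H // G.edge h = G.edge a} = 2
  have : ∀ h, G.edge h = G.edge a ↔ h ∈ ({a, G.inv a} : Finset H) := by
    intro h
    rw [eq_comm, edge_eq_edge_iff]
    simp
  rw [Nat.card_congr (Equiv.subtypeEquivRight this), Nat.card_eq_fintype_card, Fintype.card_coe]
  exact Finset.card_pair (G.inv_ne a).symm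

section Counting

variable [Fintype H]

noncomputable instance (G : RibbonGraph H) : Fintype G.Edge :=
  @Quotient.fintype _ _ _ (Classical.decRel _)

noncomputable instance (G : RibbonGraph H) : Fintype G.Vertex :=
  @Quotient.fintype _ _ _ (Classical.decRel _)

noncomputable instance (G : RibbonGraph H) : Fintype G.Face :=
  @Quotient.fintype _ _ _ (Classical.decRel _)

theorem two_mul_card_edge (G : RibbonGraph H) : 2 * Nat.card G.Edge = Fintype.card H := by
  rw [← Nat.card_eq_fintype_card, Nat.card_congr (Equiv.sigmaFiberEquiv G.edge).symm,
    Nat.card_sigma, Finset.sum_congr rfl fun e _ => G.card_edge_fiber e]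
  simp [mul_comm]

theorem IsCubic.three_mul_card_vertex {G : RibbonGraph H} (hG : G.IsCubic) :
    3 * Nat.card G.Vertex = Fintype.card H := by
  rw [← Nat.card_eq_fintype_card, Nat.card_congr (Equiv.sigmaFiberEquiv G.vertex).symm,
    Nat.card_sigma, Finset.sum_congr rfl fun v _ => hG.card_vertex_fiber v]
  simp [mul_comm]

/-- The Euler relation multiplied by `6`, with `2 #E = 3 #V = #H`. -/
theorem IsCubic.hasGenus_iff {G : RibbonGraph H} (hG : G.IsCubic) (g : ℕ) :
    G.HasGenus g ↔ (Fintype.card H : ℤ) + 12 = 12 * g + 6 * Nat.card G.Face := by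
  have h1 := G.two_mul_card_edge
  have h2 := hG.three_mul_card_vertex
  unfold HasGenus
  omega

theorem card_cycles_eq_card_face (G : RibbonGraph H) :
    (G.rot * G.inv).cycles.card = Nat.card G.Face := by
  classical
  rw [← Fintype.card_coe, ← Nat.card_eq_fintype_card]
  refine (Nat.card_congr (Equiv.ofBijective (fun f : G.Face =>
    (⟨Quotient.lift (fun h => (G.rot * G.inv).cyc h)
      (fun a b hab => Equiv.Perm.cyc_eq_iff.2 hab) f, ?_⟩ : {C // C ∈ (G.rot * G.inv).cycles}))
      ⟨?_, ?_⟩)).symm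
  · obtain ⟨h, rfl⟩ := Quotient.exists_rep f
    exact Equiv.Perm.cyc_mem_cycles _ h
  · intro f f' e
    obtain ⟨h, rfl⟩ := Quotient.exists_rep f
    obtain ⟨h', rfl⟩ := Quotient.exists_rep f'
    exact Quotient.sound (Equiv.Perm.cyc_eq_iff.1 (congrArg Subtype.val e))
  · rintro ⟨C, hC⟩
    obtain ⟨x, rfl⟩ := Equiv.Perm.mem_cycles.1 hC
    exact ⟨G.face x, rfl⟩

end Counting

end RibbonGraph

/-! ### Measured foliations as edge weights satisfying triangle inequalities -/

/-- For a convex set the largest convex subset is the set itself; as it contains `0`, its affine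
hull is its span. -/
theorem polyhedralDim_eq_finrank_span {V : Type*} [AddCommGroup V] [Module ℝ V]
    [FiniteDimensional ℝ V] {S : Set V} (hS : Convex ℝ S) (h0 : (0 : V) ∈ S) :
    polyhedralDim S = Module.finrank ℝ (Submodule.span ℝ S) := by
  have hspan : vectorSpan ℝ S = Submodule.span ℝ S := by
    rw [vectorSpan_eq_span_vsub_set_right ℝ h0]
    simp
  unfold polyhedralDim
  rw [← hspan]
  apply le_antisymm
  · refine csSup_le' ?_
    rintro d ⟨C, -, hC, rfl⟩
    exact Submodule.finrank_mono (vectorSpan_mono ℝ hC)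
  · refine le_csSup ⟨Module.finrank ℝ V, ?_⟩ ⟨S, hS, subset_rfl, rfl⟩
    rintro d ⟨C, -, hC, rfl⟩
    exact Submodule.finrank_le _

theorem finrank_span_image_le {V W : Type*} [AddCommGroup V] [Module ℝ V] [AddCommGroup W]
    [Module ℝ W] [FiniteDimensional ℝ V] (f : V →ₗ[ℝ] W) (S : Set V) :
    Module.finrank ℝ (Submodule.span ℝ (f '' S)) ≤ Module.finrank ℝ (Submodule.span ℝ S) := by
  rw [Submodule.span_image]
  exact Submodule.finrank_map_le f _

namespace RibbonGraph

variable {H : Type*}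

/-- The weights on edges, supported on `A`, that satisfy the triangle inequality at every vertex of
a trivalent ribbon graph. -/
def weightCone (G : RibbonGraph H) (A : Finset H) : Set (H → ℝ) :=
  {x | (∀ h, x (G.inv h) = x h) ∧ (∀ h, h ∉ A → x h = 0) ∧
    ∀ h, x h ≤ x (G.rot h) + x (G.rot (G.rot h))}

theorem IsCubic.nonneg_of_mem_weightCone {G : RibbonGraph H} (hG : G.IsCubic) {A : Finset H}
    {x : H → ℝ} (hx : x ∈ G.weightCone A) (h : H) : 0 ≤ x h := by
  have h1 := hx.2.2 (G.rot h)
  have h2 := hx.2.2 (G.rot (G.rot h))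
  rw [hG.rot_rot_rot] at h1 h2
  linarith

theorem convex_weightCone (G : RibbonGraph H) (A : Finset H) : Convex ℝ (G.weightCone A) := by
  intro x hx y hy a b ha hb _
  refine ⟨fun h => ?_, fun h hh => ?_, fun h => ?_⟩
  · simp [hx.1 h, hy.1 h]
  · simp [hx.2.1 h hh, hy.2.1 h hh]
  · have h1 := mul_le_mul_of_nonneg_left (hx.2.2 h) ha
    have h2 := mul_le_mul_of_nonneg_left (hy.2.2 h) hb
    simp only [Pi.add_apply, Pi.smul_apply, smul_eq_mul]
    linarith

theorem zero_mem_weightCone (G : RibbonGraph H) (A : Finset H) : 0 ∈ G.weightCone A := by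
  refine ⟨fun h => rfl, fun h _ => rfl, fun h => by simp⟩

/-! ### Foliations of a subgraph and their intersection numbers. -/

section Restrict

variable [Fintype H] {G : RibbonGraph H} {E' : Set G.Edge}

theorem restrict_rot_coe (a : {h : H // G.edge h ∈ E'}) :
    ((G.restrict E').rot a).1 = (G.rot ^ G.returnTime E' a) a.1 := rfl

theorem restrict_inv_coe (a : {h : H // G.edge h ∈ E'}) :
    ((G.restrict E').inv a).1 = G.inv a.1 := rfl

theorem restrict_rot_of_rot_mem (a : {h : H // G.edge h ∈ E'}) (ha : G.edge (G.rot a.1) ∈ E') :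
    (G.restrict E').rot a = ⟨G.rot a.1, ha⟩ := by
  classical
  apply Subtype.ext
  rw [restrict_rot_coe]
  have : G.returnTime E' a = 1 := by
    unfold returnTime
    rw [Nat.find_eq_iff]
    refine ⟨⟨one_pos, by simpa using ha⟩, fun n hn h => ?_⟩
    omega
  rw [this, pow_one]

theorem sameCycle_of_sameCycle_restrict {a b : {h : H // G.edge h ∈ E'}}
    (h : (G.restrict E').rot.SameCycle a b) : G.rot.SameCycle a.1 b.1 := by
  have : Fintype {h : H // G.edge h ∈ E'} := Fintype.ofFinite _
  refine h.mem_of_invariant (S := {c | G.rot.SameCycle a.1 c.1}) ?_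
    (Equiv.Perm.SameCycle.refl _ _)
  intro c hc
  refine Equiv.Perm.SameCycle.trans hc ⟨(G.returnTime E' c : ℕ), ?_⟩
  rw [zpow_natCast, restrict_rot_coe]

variable [Fintype {h : H // G.edge h ∈ E'}]

/-- The intersection numbers of a foliation with the arcs dual to the edges. -/
noncomputable def totalWeight (G : RibbonGraph H) (E' : Set G.Edge)
    [Fintype {h : H // G.edge h ∈ E'}] :
    ({h : H // G.edge h ∈ E'} → {h : H // G.edge h ∈ E'} → ℝ) →ₗ[ℝ] (H → ℝ) where
  toFun w h := by
    classical exact if hh : G.edge h ∈ E' then ∑ b, w ⟨h, hh⟩ b else 0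
  map_add' w w' := by
    classical
    ext h
    by_cases hh : G.edge h ∈ E' <;> simp [hh, Finset.sum_add_distrib]
  map_smul' c w := by
    classical
    ext h
    by_cases hh : G.edge h ∈ E' <;> simp [hh, Finset.mul_sum]

/-- The measures of the bands of a foliation with prescribed intersection numbers. -/
noncomputable def bandWeight (G : RibbonGraph H) (E' : Set G.Edge) :
    (H → ℝ) →ₗ[ℝ] ({h : H // G.edge h ∈ E'} → {h : H // G.edge h ∈ E'} → ℝ) where
  toFun x a b := by
    classical exact if b.1 = G.rot a.1 then (x a.1 + x (G.rot a.1) - x (G.rot (G.rot a.1))) / 2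
      else if b.1 = G.rot (G.rot a.1) then (x a.1 + x (G.rot (G.rot a.1)) - x (G.rot a.1)) / 2
      else 0
  map_add' x y := by
    classical
    ext a b
    simp only [Pi.add_apply]
    split_ifs <;> ring
  map_smul' c x := by
    classical
    ext a b
    simp only [Pi.smul_apply, smul_eq_mul, RingHom.id_apply]
    split_ifs <;> ring

theorem totalWeight_apply_of_mem
    (w : {h : H // G.edge h ∈ E'} → {h : H // G.edge h ∈ E'} → ℝ)
    (a : {h : H // G.edge h ∈ E'}) : G.totalWeight E' w a.1 = ∑ b, w a b := by
  classical
  simp [totalWeight, a.2]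

theorem totalWeight_apply_of_notMem
    (w : {h : H // G.edge h ∈ E'} → {h : H // G.edge h ∈ E'} → ℝ) {h : H}
    (hh : G.edge h ∉ E') : G.totalWeight E' w h = 0 := by
  classical
  simp [totalWeight, hh]

theorem bandWeight_apply_rot (x : H → ℝ) (a b : {h : H // G.edge h ∈ E'})
    (hb : b.1 = G.rot a.1) :
    G.bandWeight E' x a b = (x a.1 + x (G.rot a.1) - x (G.rot (G.rot a.1))) / 2 := by
  classical
  simp [bandWeight, hb]

theorem IsCubic.bandWeight_apply_rot_rot (hG : G.IsCubic) (x : H → ℝ)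
    (a b : {h : H // G.edge h ∈ E'}) (hb : b.1 = G.rot (G.rot a.1)) :
    G.bandWeight E' x a b = (x a.1 + x (G.rot (G.rot a.1)) - x (G.rot a.1)) / 2 := by
  classical
  simp [bandWeight, hb, hG.rot_ne]

theorem bandWeight_apply_of_ne (x : H → ℝ) (a b : {h : H // G.edge h ∈ E'})
    (h1 : b.1 ≠ G.rot a.1) (h2 : b.1 ≠ G.rot (G.rot a.1)) : G.bandWeight E' x a b = 0 := by
  classical
  simp [bandWeight, h1, h2]

/-- At a vertex of a trivalent graph, at most two bands leave a given half-edge. -/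
theorem IsCubic.sum_bands (hG : G.IsCubic) (f : {h : H // G.edge h ∈ E'} → ℝ)
    (a : {h : H // G.edge h ∈ E'})
    (hf : ∀ b, b.1 ≠ G.rot a.1 → b.1 ≠ G.rot (G.rot a.1) → f b = 0) (F : H → ℝ)
    (hF : ∀ b : {h : H // G.edge h ∈ E'}, F b.1 = f b) (hF0 : ∀ b, G.edge b ∉ E' → F b = 0) :
    ∑ b, f b = F (G.rot a.1) + F (G.rot (G.rot a.1)) := by
  classical
  obtain rfl : ‹Fintype {h : H // G.edge h ∈ E'}› = Subtype.fintype _ := Subsingleton.elim _ _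
  have h1 : ∑ b, f b = ∑ b : H, F b := by
    rw [← Fintype.sum_subtype_add_sum_subtype (fun h => G.edge h ∈ E') F]
    rw [Finset.sum_congr rfl fun (b : {h : H // ¬ G.edge h ∈ E'}) _ => hF0 b.1 b.2]
    rw [Finset.sum_const_zero, add_zero]
    refine Fintype.sum_equiv (Equiv.refl _) _ _ fun b => (hF b).symm
  rw [h1, ← Finset.sum_pair (hG.rot_rot_ne_rot a.1).symm]
  symm
  apply Finset.sum_subset (Finset.subset_univ _)
  intro b _ hb
  simp only [Finset.mem_insert, Finset.mem_singleton, not_or] at hb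
  by_cases hbE : G.edge b ∈ E'
  · rw [hF ⟨b, hbE⟩, hf ⟨b, hbE⟩ hb.1 hb.2]
  · exact hF0 b hbE

variable {A : Finset H}

theorem IsCubic.eq_zero_of_mem_MFBullet (hG : G.IsCubic)
    {w : {h : H // G.edge h ∈ E'} → {h : H // G.edge h ∈ E'} → ℝ}
    (hw : w ∈ (G.restrict E').MFBullet) (a b : {h : H // G.edge h ∈ E'})
    (h1 : b.1 ≠ G.rot a.1) (h2 : b.1 ≠ G.rot (G.rot a.1)) : w a b = 0 := by
  by_cases hab : b = a
  · rw [hab]; exact hw.2.2.1 a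
  · refine hw.2.2.2.1 a b fun h => ?_
    have := sameCycle_of_sameCycle_restrict (vertex_eq_vertex_iff.1 h)
    rw [hG.sameCycle_rot_iff] at this
    rcases this with h | h | h
    · exact hab (Subtype.ext h)
    · exact h1 h
    · exact h2 h

/-- The band measures, extended by zero. -/
noncomputable def extendBand (w : {h : H // G.edge h ∈ E'} → {h : H // G.edge h ∈ E'} → ℝ)
    (a b : H) : ℝ := by
  classical exact if hh : G.edge a ∈ E' ∧ G.edge b ∈ E' then w ⟨a, hh.1⟩ ⟨b, hh.2⟩ else 0

theorem extendBand_coe (w : {h : H // G.edge h ∈ E'} → {h : H // G.edge h ∈ E'} → ℝ)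
    (a b : {h : H // G.edge h ∈ E'}) : extendBand w a.1 b.1 = w a b := by
  simp [extendBand, a.2, b.2]

theorem IsCubic.totalWeight_eq (hG : G.IsCubic)
    {w : {h : H // G.edge h ∈ E'} → {h : H // G.edge h ∈ E'} → ℝ}
    (hw : w ∈ (G.restrict E').MFBullet) (h : H) :
    G.totalWeight E' w h = extendBand w h (G.rot h) + extendBand w h (G.rot (G.rot h)) := by
  by_cases hh : G.edge h ∈ E'
  · rw [totalWeight_apply_of_mem w ⟨h, hh⟩]
    exact hG.sum_bands (w ⟨h, hh⟩) ⟨h, hh⟩ (hG.eq_zero_of_mem_MFBullet hw ⟨h, hh⟩) (extendBand w h)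
      (extendBand_coe w ⟨h, hh⟩) (fun b hb => by simp [extendBand, hb])
  · rw [totalWeight_apply_of_notMem w hh]
    simp [extendBand, hh]

theorem extendBand_nonneg {w : {h : H // G.edge h ∈ E'} → {h : H // G.edge h ∈ E'} → ℝ}
    (hw : w ∈ (G.restrict E').MFBullet) (a b : H) : 0 ≤ extendBand w a b := by
  unfold extendBand
  split_ifs
  · exact hw.1 _ _
  · exact le_rfl

theorem extendBand_symm {w : {h : H // G.edge h ∈ E'} → {h : H // G.edge h ∈ E'} → ℝ}
    (hw : w ∈ (G.restrict E').MFBullet) (a b : H) : extendBand w a b = extendBand w b a := by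
  by_cases hh : G.edge a ∈ E' ∧ G.edge b ∈ E'
  · simp [extendBand, hh, hw.2.1 ⟨a, hh.1⟩ ⟨b, hh.2⟩]
  · have hh' : ¬ (G.edge b ∈ E' ∧ G.edge a ∈ E') := fun h => hh ⟨h.2, h.1⟩
    simp [extendBand, hh, hh']

/-- The defect in the triangle inequality for `h` is twice the band joining the two other half-edges
of the vertex, hence non-negative. -/
theorem IsCubic.totalWeight_mem (hG : G.IsCubic) (hA : ∀ h, h ∈ A ↔ G.edge h ∈ E')
    {w : {h : H // G.edge h ∈ E'} → {h : H // G.edge h ∈ E'} → ℝ}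
    (hw : w ∈ (G.restrict E').MFBullet) : G.totalWeight E' w ∈ G.weightCone A := by
  refine ⟨fun h => ?_, fun h hh => ?_, fun h => ?_⟩
  · by_cases hh : G.edge h ∈ E'
    · have hh' : G.edge (G.inv h) ∈ E' := by rwa [edge_inv]
      rw [totalWeight_apply_of_mem w ⟨h, hh⟩, totalWeight_apply_of_mem w ⟨_, hh'⟩]
      exact (hw.2.2.2.2.2 ⟨h, hh⟩).symm
    · have hh' : G.edge (G.inv h) ∉ E' := by rwa [edge_inv]
      rw [totalWeight_apply_of_notMem w hh, totalWeight_apply_of_notMem w hh']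
  · rw [hA] at hh
    exact totalWeight_apply_of_notMem w hh
  · simp only [hG.totalWeight_eq hw, hG.rot_rot_rot]
    rw [extendBand_symm hw h (G.rot h), extendBand_symm hw h (G.rot (G.rot h))]
    have h1 := extendBand_nonneg hw (G.rot h) (G.rot (G.rot h))
    have h2 := extendBand_nonneg hw (G.rot (G.rot h)) (G.rot h)
    linarith

/-- Three half-edges carry three bands: twice a band is the sum of the totals at its ends minus the
third total. -/
theorem IsCubic.bandWeight_totalWeight (hG : G.IsCubic)
    {w : {h : H // G.edge h ∈ E'} → {h : H // G.edge h ∈ E'} → ℝ}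
    (hw : w ∈ (G.restrict E').MFBullet) : G.bandWeight E' (G.totalWeight E' w) = w := by
  funext a b
  have e := hG.totalWeight_eq hw
  have s := extendBand_symm hw
  by_cases h1 : b.1 = G.rot a.1
  · rw [bandWeight_apply_rot _ a b h1, e, e, e]
    simp only [hG.rot_rot_rot]
    rw [← extendBand_coe w a b, h1, s (G.rot a.1) a.1, s (G.rot (G.rot a.1)) a.1,
      s (G.rot (G.rot a.1)) (G.rot a.1)]
    ring
  by_cases h2 : b.1 = G.rot (G.rot a.1)
  · rw [hG.bandWeight_apply_rot_rot _ a b h2, e, e, e]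
    simp only [hG.rot_rot_rot]
    rw [← extendBand_coe w a b, h2, s (G.rot a.1) a.1, s (G.rot (G.rot a.1)) a.1,
      s (G.rot (G.rot a.1)) (G.rot a.1)]
    ring
  rw [bandWeight_apply_of_ne _ a b h1 h2, hG.eq_zero_of_mem_MFBullet hw a b h1 h2]

theorem IsCubic.totalWeight_bandWeight (hG : G.IsCubic) (hA : ∀ h, h ∈ A ↔ G.edge h ∈ E')
    {x : H → ℝ} (hx : x ∈ G.weightCone A) : G.totalWeight E' (G.bandWeight E' x) = x := by
  classical
  funext h
  by_cases hh : G.edge h ∈ E'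
  · rw [totalWeight_apply_of_mem _ ⟨h, hh⟩]
    have hz : ∀ b, G.edge b ∉ E' → x b = 0 := fun b hb => hx.2.1 b (by rwa [hA])
    have t1 := hx.2.2 h
    have t2 := hx.2.2 (G.rot h)
    have t3 := hx.2.2 (G.rot (G.rot h))
    simp only [hG.rot_rot_rot] at t2 t3
    rw [hG.sum_bands _ ⟨h, hh⟩ (bandWeight_apply_of_ne x ⟨h, hh⟩) (fun b =>
      if b = G.rot h then (x h + x (G.rot h) - x (G.rot (G.rot h))) / 2
      else if b = G.rot (G.rot h) then (x h + x (G.rot (G.rot h)) - x (G.rot h)) / 2 else 0)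
      (fun b => rfl)]
    · simp only [if_true, hG.rot_rot_ne_rot h, if_false]
      ring
    -- If `b` lies outside the subgraph then `x b = 0`, and the triangle inequalities make the two
    -- other weights at the vertex equal, so the formula for the band towards `b` vanishes.
    · intro b hb
      have hb0 := hz b hb
      split_ifs with h1 h2
      · rw [h1] at hb0; linarith
      · rw [h2] at hb0; linarith
      · rfl
  · rw [totalWeight_apply_of_notMem _ hh, hx.2.1 h (by rwa [hA])]

/-- Crossing bands need four distinct half-edges at one vertex, and only three are available. -/
theorem IsCubic.not_linked_restrict (hG : G.IsCubic) (a b c d : {h : H // G.edge h ∈ E'}) :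
    ¬ (G.restrict E').Linked a b c d := by
  classical
  rintro ⟨i, j, k, hi, hij, hjk, hk, -⟩
  set f := (G.restrict E').rot
  have hinj : Set.InjOn (fun m : ℕ => ((f ^ m) a).1) (Finset.range 4 : Set ℕ) := by
    intro m hm m' hm' e
    have hm4 := Finset.mem_range.1 hm
    have hm4' := Finset.mem_range.1 hm'
    have e' : (f ^ m) a = (f ^ m') a := Subtype.ext e
    rw [← Equiv.Perm.iterate_eq_pow, ← Equiv.Perm.iterate_eq_pow] at e'
    exact Function.iterate_injOn_Iio_minimalPeriod (f := f) (x := a)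
      (Set.mem_Iio.2 (by omega)) (Set.mem_Iio.2 (by omega)) e'
  have hsub : (Finset.range 4).image (fun m : ℕ => ((f ^ m) a).1) ⊆
      {a.1, G.rot a.1, G.rot (G.rot a.1)} := by
    intro x hx
    obtain ⟨m, -, rfl⟩ := Finset.mem_image.1 hx
    have := hG.sameCycle_rot_iff.1 (sameCycle_of_sameCycle_restrict
      (show f.SameCycle a ((f ^ m) a) from ⟨m, by simp⟩))
    simpa using this
  have h4 := Finset.card_le_card hsub
  rw [Finset.card_image_of_injOn hinj, Finset.card_range] at h4
  have := Finset.card_le_three (a := a.1) (b := G.rot a.1) (c := G.rot (G.rot a.1))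
  omega

theorem IsCubic.bandWeight_mem (hG : G.IsCubic) (hA : ∀ h, h ∈ A ↔ G.edge h ∈ E')
    {x : H → ℝ} (hx : x ∈ G.weightCone A) : G.bandWeight E' x ∈ (G.restrict E').MFBullet := by
  have key : ∀ a : {h : H // G.edge h ∈ E'}, ∑ b, G.bandWeight E' x a b = x a.1 := fun a => by
    rw [← totalWeight_apply_of_mem, hG.totalWeight_bandWeight hA hx]
  refine ⟨fun a b => ?_, fun a b => ?_, fun a => ?_, fun a b hab => ?_,
    fun a b c d h => absurd h (hG.not_linked_restrict a b c d), fun a => ?_⟩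
  · have t2 := hx.2.2 (G.rot a.1)
    have t3 := hx.2.2 (G.rot (G.rot a.1))
    simp only [hG.rot_rot_rot] at t2 t3
    by_cases h1 : b.1 = G.rot a.1
    · rw [bandWeight_apply_rot x a b h1]; linarith
    by_cases h2 : b.1 = G.rot (G.rot a.1)
    · rw [hG.bandWeight_apply_rot_rot x a b h2]; linarith
    rw [bandWeight_apply_of_ne x a b h1 h2]
  · by_cases h1 : b.1 = G.rot a.1
    · have h1' : a.1 = G.rot (G.rot b.1) := by rw [h1, hG.rot_rot_rot]
      rw [bandWeight_apply_rot x a b h1, hG.bandWeight_apply_rot_rot x b a h1', ← h1', h1]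
      ring
    by_cases h2 : b.1 = G.rot (G.rot a.1)
    · have h2' : a.1 = G.rot b.1 := by rw [h2, hG.rot_rot_rot]
      rw [hG.bandWeight_apply_rot_rot x a b h2, bandWeight_apply_rot x b a h2', ← h2', h2,
        ← h2, h2']
      ring
    rw [bandWeight_apply_of_ne x a b h1 h2, bandWeight_apply_of_ne x b a]
    · intro e; exact h2 (by rw [e, hG.rot_rot_rot])
    · intro e; exact h1 (by rw [e, hG.rot_rot_rot])
  · exact bandWeight_apply_of_ne x a a (hG.rot_ne _).symm (hG.rot_rot_ne _).symm
  · refine bandWeight_apply_of_ne x a b (fun e => hab ?_) (fun e => hab ?_)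
    · have ha : G.edge (G.rot a.1) ∈ E' := e ▸ b.2
      rw [vertex_eq_vertex_iff]
      refine ⟨1, ?_⟩
      rw [zpow_one, restrict_rot_of_rot_mem a ha]
      exact Subtype.ext e.symm
    · have e' : a.1 = G.rot b.1 := by rw [e, hG.rot_rot_rot]
      have hb : G.edge (G.rot b.1) ∈ E' := e' ▸ a.2
      symm
      rw [vertex_eq_vertex_iff]
      refine ⟨1, ?_⟩
      rw [zpow_one, restrict_rot_of_rot_mem b hb]
      exact Subtype.ext e'.symm
  · rw [key, key, restrict_inv_coe, hx.1]

/-- The dimension of the space of foliations of a subgraph of a trivalent graph. -/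
theorem IsCubic.polyhedralDim_MFBullet_restrict (hG : G.IsCubic)
    (hA : ∀ h, h ∈ A ↔ G.edge h ∈ E') :
    polyhedralDim (G.restrict E').MFBullet =
      Module.finrank ℝ (Submodule.span ℝ (G.weightCone A)) := by
  have himg : (G.restrict E').MFBullet = G.bandWeight E' '' G.weightCone A := by
    ext w
    constructor
    · intro hw
      exact ⟨_, hG.totalWeight_mem hA hw, hG.bandWeight_totalWeight hw⟩
    · rintro ⟨x, hx, rfl⟩
      exact hG.bandWeight_mem hA hx
  have himg' : G.weightCone A = G.totalWeight E' '' (G.restrict E').MFBullet := by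
    ext x
    constructor
    · intro hx
      exact ⟨_, hG.bandWeight_mem hA hx, hG.totalWeight_bandWeight hA hx⟩
    · rintro ⟨w, hw, rfl⟩
      exact hG.totalWeight_mem hA hw
  -- The two linear maps are inverse to each other only between these two sets, so each gives one
  -- inequality between the ranks. The non-crossing condition is not convex in general; here
  -- convexity is inherited from `weightCone`.
  rw [polyhedralDim_eq_finrank_span]
  · apply le_antisymm
    · conv_lhs => rw [himg]
      exact finrank_span_image_le _ _
    · conv_lhs => rw [himg']
      exact finrank_span_image_le _ _
  · rw [himg]
    exact (G.convex_weightCone A).linear_image _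
  · rw [himg]
    exact ⟨0, G.zero_mem_weightCone A, map_zero _⟩

end Restrict

end RibbonGraph

/-! ### Faces of subgraphs of a trivalent ribbon graph -/

namespace RibbonGraph

open Equiv.Perm

variable {H : Type*}

/-- A set of half-edges which is a union of edges. -/
def InvClosed (G : RibbonGraph H) (A : Finset H) : Prop := ∀ h ∈ A, G.inv h ∈ A

theorem InvClosed.inv_mem_iff {G : RibbonGraph H} {A : Finset H} (hA : G.InvClosed A) {h : H} :
    G.inv h ∈ A ↔ h ∈ A :=
  ⟨fun hh => by simpa [G.inv_inv] using hA _ hh, hA h⟩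

variable [DecidableEq H]

/-- The permutation exchanging the half-edges of the edges in `A`, and fixing the others. -/
def partialInv (G : RibbonGraph H) (A : Finset H) (hA : G.InvClosed A) : Equiv.Perm H :=
  Function.Involutive.toPerm (fun h => if h ∈ A then G.inv h else h) fun h => by
    by_cases hh : h ∈ A
    · simp [hh, hA h hh, G.inv_inv]
    · simp [hh]

/-- The permutation whose cycles are the faces of the subgraph spanned by `A` and the vertices not
incident to `A`. -/
def boundaryPerm (G : RibbonGraph H) (A : Finset H) (hA : G.InvClosed A) : Equiv.Perm H :=
  G.rot * G.partialInv A hA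

section

variable {G : RibbonGraph H} {A : Finset H} {hA : G.InvClosed A}

theorem boundaryPerm_of_mem {h : H} (hh : h ∈ A) : G.boundaryPerm A hA h = G.rot (G.inv h) := by
  change G.rot (if h ∈ A then G.inv h else h) = _
  simp [hh]

theorem boundaryPerm_of_notMem {h : H} (hh : h ∉ A) : G.boundaryPerm A hA h = G.rot h := by
  change G.rot (if h ∈ A then G.inv h else h) = _
  simp [hh]

theorem InvClosed.insert (hA : G.InvClosed A) (h : H) :
    G.InvClosed (insert h (insert (G.inv h) A)) := by
  intro x hx
  simp only [Finset.mem_insert] at hx ⊢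
  rcases hx with rfl | rfl | hx
  · exact Or.inr (Or.inl rfl)
  · exact Or.inl (G.inv_inv h)
  · exact Or.inr (Or.inr (hA x hx))

theorem boundaryPerm_insert (hA : G.InvClosed A) {h : H} (hh : h ∉ A) :
    G.boundaryPerm _ (hA.insert h) = G.boundaryPerm A hA * Equiv.swap h (G.inv h) := by
  have hh' : G.inv h ∉ A := fun e => hh (hA.inv_mem_iff.1 e)
  ext x
  rw [Equiv.Perm.mul_apply]
  by_cases h1 : x = h
  · subst h1
    rw [Equiv.swap_apply_left, boundaryPerm_of_notMem hh', boundaryPerm_of_mem (by simp)]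
  by_cases h2 : x = G.inv h
  · subst h2
    rw [Equiv.swap_apply_right, boundaryPerm_of_notMem hh, boundaryPerm_of_mem (by simp),
      G.inv_inv]
  rw [Equiv.swap_apply_of_ne_of_ne h1 h2]
  by_cases hx : x ∈ A
  · rw [boundaryPerm_of_mem hx, boundaryPerm_of_mem (by simp [hx])]
  · rw [boundaryPerm_of_notMem hx, boundaryPerm_of_notMem (by simp [hx, h1, h2])]

end

theorem card_insert_edge {G : RibbonGraph H} {A : Finset H} {h : H} (hA : G.InvClosed A) (hh : h ∉ A) :
    (insert h (insert (G.inv h) A)).card = A.card + 2 := by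
  have hh' : G.inv h ∉ A := fun e => hh (hA.inv_mem_iff.1 e)
  rw [Finset.card_insert_of_notMem (by simp [hh, (G.inv_ne h).symm]),
    Finset.card_insert_of_notMem hh']

variable [Fintype H]

theorem boundaryPerm_univ (G : RibbonGraph H) (h : G.InvClosed Finset.univ) :
    G.boundaryPerm Finset.univ h = G.rot * G.inv := by
  ext x
  rw [boundaryPerm_of_mem (Finset.mem_univ x), Equiv.Perm.mul_apply]

/-- The half-edges at vertices not incident to `A`. -/
def isolated (G : RibbonGraph H) (A : Finset H) : Finset H :=
  {h | h ∉ A ∧ G.rot h ∉ A ∧ G.rot (G.rot h) ∉ A}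

/-- The half-edges outside `A` at vertices which are bivalent in the subgraph spanned by `A`. -/
def corners (G : RibbonGraph H) (A : Finset H) : Finset H :=
  {h | h ∉ A ∧ G.rot h ∈ A ∧ G.rot (G.rot h) ∈ A}

theorem mem_isolated {G : RibbonGraph H} {A : Finset H} {h : H} :
    h ∈ G.isolated A ↔ h ∉ A ∧ G.rot h ∉ A ∧ G.rot (G.rot h) ∉ A := by
  simp [isolated]

theorem mem_corners {G : RibbonGraph H} {A : Finset H} {h : H} :
    h ∈ G.corners A ↔ h ∉ A ∧ G.rot h ∈ A ∧ G.rot (G.rot h) ∈ A := by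
  simp [corners]

theorem isolated_univ (G : RibbonGraph H) : G.isolated Finset.univ = ∅ := by
  ext h; simp [isolated]

/-- A cycle is unsettled if it is a face of the subgraph spanned by `A₀` on which no edge of `A` has
been attached, or if it goes around a univalent vertex of the subgraph spanned by `A`. -/
def Unsettled (G : RibbonGraph H) (A₀ A C : Finset H) : Prop :=
  ((∃ x ∈ C, x ∈ A) ∧ ∀ x ∈ C, x ∈ A → x ∈ A₀) ∨
    ∃ x ∈ C, x ∈ A ∧ G.rot x ∉ A ∧ G.rot (G.rot x) ∉ A

open Classical in
/-- The unsettled cycles. -/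
noncomputable def unsettledCycles (G : RibbonGraph H) (A₀ A : Finset H) (hA : G.InvClosed A) :
    Finset (Finset H) :=
  (G.boundaryPerm A hA).cycles.filter (G.Unsettled A₀ A)

theorem mem_unsettledCycles {G : RibbonGraph H} {A₀ A C : Finset H} {hA : G.InvClosed A} :
    C ∈ G.unsettledCycles A₀ A hA ↔ C ∈ (G.boundaryPerm A hA).cycles ∧ G.Unsettled A₀ A C := by
  classical
  simp [unsettledCycles]

namespace IsCubic

variable {G : RibbonGraph H} {A : Finset H}

theorem rot_mem_isolated (hG : G.IsCubic) {h : H} (hh : h ∈ G.isolated A) : G.rot h ∈ G.isolated A := by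
  rw [mem_isolated] at hh ⊢
  rw [hG.rot_rot_rot]
  tauto

theorem cyc_of_mem_isolated (hG : G.IsCubic) (hA : G.InvClosed A) {h : H} (hh : h ∈ G.isolated A) :
    (G.boundaryPerm A hA).cyc h = {h, G.rot h, G.rot (G.rot h)} := by
  have h1 := mem_isolated.1 hh
  ext x
  rw [mem_cyc]
  simp only [Finset.mem_insert, Finset.mem_singleton]
  constructor
  · intro hx
    refine hx.mem_of_invariant (S := {x | x = h ∨ x = G.rot h ∨ x = G.rot (G.rot h)}) ?_
      (Or.inl rfl)
    rintro z (rfl | rfl | rfl)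
    · rw [boundaryPerm_of_notMem h1.1]; simp
    · rw [boundaryPerm_of_notMem h1.2.1]; simp
    · rw [boundaryPerm_of_notMem h1.2.2, hG.rot_rot_rot]; simp
  · have s1 : (G.boundaryPerm A hA).SameCycle h (G.rot h) :=
      ⟨1, by rw [zpow_one, boundaryPerm_of_notMem h1.1]⟩
    have s2 : (G.boundaryPerm A hA).SameCycle (G.rot h) (G.rot (G.rot h)) :=
      ⟨1, by rw [zpow_one, boundaryPerm_of_notMem h1.2.1]⟩
    rintro (rfl | rfl | rfl)
    · exact SameCycle.refl _ _
    · exact s1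
    · exact s1.trans s2

/-- A cycle avoiding `A` follows the rotation alone, so it is the triple of half-edges at one
isolated vertex. -/
theorem card_isolated (hG : G.IsCubic) (hA : G.InvClosed A) :
    (G.isolated A).card =
      3 * ((G.boundaryPerm A hA).cycles.filter fun C => ¬ ∃ x ∈ C, x ∈ A).card := by
  classical
  rw [Finset.card_eq_sum_card_fiberwise (f := (G.boundaryPerm A hA).cyc)
    (t := (G.boundaryPerm A hA).cycles.filter fun C => ¬ ∃ x ∈ C, x ∈ A)]
  · rw [Finset.sum_const_nat (m := 3), mul_comm]
    intro C hC
    rw [Finset.mem_filter] at hC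
    obtain ⟨x, rfl⟩ := mem_cycles.1 hC.1
    have hno : ∀ y, (G.boundaryPerm A hA).SameCycle x y → y ∉ A := fun y hy hyA =>
      hC.2 ⟨y, mem_cyc.2 hy, hyA⟩
    have step : ∀ y, (G.boundaryPerm A hA).SameCycle x y →
        (G.boundaryPerm A hA).SameCycle x (G.rot y) := fun y hy => by
      refine hy.trans ⟨1, ?_⟩
      rw [zpow_one, boundaryPerm_of_notMem (hno y hy)]
    have hiso : ∀ y, (G.boundaryPerm A hA).SameCycle x y → y ∈ G.isolated A := fun y hy =>
      mem_isolated.2 ⟨hno _ hy, hno _ (step _ hy), hno _ (step _ (step _ hy))⟩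
    have hfib : {a ∈ G.isolated A | (G.boundaryPerm A hA).cyc a = (G.boundaryPerm A hA).cyc x} =
        (G.boundaryPerm A hA).cyc x := by
      ext y
      rw [Finset.mem_filter, cyc_eq_iff, mem_cyc]
      exact ⟨fun h => h.2.symm, fun h => ⟨hiso y h, h.symm⟩⟩
    rw [hfib, hG.cyc_of_mem_isolated hA (hiso x (SameCycle.refl _ _)), Finset.card_eq_three]
    exact ⟨x, _, _, (hG.rot_ne x).symm, (hG.rot_rot_ne x).symm, (hG.rot_ne _).symm, rfl⟩
  · intro x hx
    have hx' : x ∈ G.isolated A := hx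
    rw [Finset.mem_coe, Finset.mem_filter]
    refine ⟨cyc_mem_cycles _ _, ?_⟩
    rw [hG.cyc_of_mem_isolated hA hx']
    have := mem_isolated.1 hx'
    rintro ⟨y, hy, hyA⟩
    simp only [Finset.mem_insert, Finset.mem_singleton] at hy
    rcases hy with rfl | rfl | rfl <;> tauto

theorem mem_isolated_insert (hG : G.IsCubic) {h x : H} :
    x ∈ G.isolated (insert h (insert (G.inv h) A)) ↔ x ∈ G.isolated A ∧
      x ∉ ({h, G.rot h, G.rot (G.rot h)} : Finset H) ∧
      x ∉ ({G.inv h, G.rot (G.inv h), G.rot (G.rot (G.inv h))} : Finset H) := by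
  have key : ∀ a b : H, G.rot a = b ↔ a = G.rot (G.rot b) := fun a b =>
    ⟨fun e => by rw [← e, hG.rot_rot_rot], fun e => by rw [e, hG.rot_rot_rot]⟩
  simp only [mem_isolated, Finset.mem_insert, Finset.mem_singleton, not_or]
  simp only [key, hG.rot_rot_rot]
  tauto

theorem notMem_isolated_of_adj (hG : G.IsCubic) {h : H}
    (hadj : G.rot h ∈ A ∨ G.rot (G.rot h) ∈ A) {x : H} (hx : x ∈ G.isolated A) :
    x ∉ ({h, G.rot h, G.rot (G.rot h)} : Finset H) := by
  rw [mem_isolated] at hx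
  simp only [Finset.mem_insert, Finset.mem_singleton]
  rintro (rfl | rfl | rfl)
  · tauto
  · tauto
  · simp only [hG.rot_rot_rot] at hx; tauto

theorem isolated_insert_of_notMem (hG : G.IsCubic) {h : H}
    (hadj : G.rot h ∈ A ∨ G.rot (G.rot h) ∈ A)
    (h' : G.inv h ∉ G.isolated A) :
    G.isolated (insert h (insert (G.inv h) A)) = G.isolated A := by
  ext x
  rw [hG.mem_isolated_insert]
  refine ⟨fun hx => hx.1, fun hx => ⟨hx, hG.notMem_isolated_of_adj hadj hx, fun hx' => h' ?_⟩⟩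
  simp only [Finset.mem_insert, Finset.mem_singleton] at hx'
  rcases hx' with rfl | rfl | rfl
  · exact hx
  · have := hG.rot_mem_isolated (hG.rot_mem_isolated hx)
    rwa [hG.rot_rot_rot] at this
  · have := hG.rot_mem_isolated hx
    rwa [hG.rot_rot_rot] at this

theorem card_isolated_insert_of_mem (hG : G.IsCubic) {h : H}
    (hadj : G.rot h ∈ A ∨ G.rot (G.rot h) ∈ A)
    (h' : G.inv h ∈ G.isolated A) :
    (G.isolated (insert h (insert (G.inv h) A))).card + 3 = (G.isolated A).card := by
  have h3 : ({G.inv h, G.rot (G.inv h), G.rot (G.rot (G.inv h))} : Finset H).card = 3 := by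
    rw [Finset.card_eq_three]
    exact ⟨G.inv h, _, _, (hG.rot_ne _).symm, (hG.rot_rot_ne _).symm, (hG.rot_ne _).symm, rfl⟩
  have hsub : ({G.inv h, G.rot (G.inv h), G.rot (G.rot (G.inv h))} : Finset H) ⊆ G.isolated A := by
    intro x hx
    simp only [Finset.mem_insert, Finset.mem_singleton] at hx
    rcases hx with rfl | rfl | rfl
    · exact h'
    · exact hG.rot_mem_isolated h'
    · exact hG.rot_mem_isolated (hG.rot_mem_isolated h')
  have : G.isolated (insert h (insert (G.inv h) A)) =
      G.isolated A \ {G.inv h, G.rot (G.inv h), G.rot (G.rot (G.inv h))} := by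
    ext x
    rw [hG.mem_isolated_insert, Finset.mem_sdiff]
    exact ⟨fun hx => ⟨hx.1, hx.2.2⟩, fun hx => ⟨hx.1, hG.notMem_isolated_of_adj hadj hx.1, hx.2⟩⟩
  have hle := Finset.card_le_card hsub
  rw [this, Finset.card_sdiff_of_subset hsub]
  omega

/-- The cycle of `G.inv h` stays at its isolated vertex, whereas `h` sits at a vertex meeting `A`.
-/
theorem not_sameCycle_of_isolated (hG : G.IsCubic) (hA : G.InvClosed A) {h : H}
    (hadj : G.rot h ∈ A ∨ G.rot (G.rot h) ∈ A)
    (h' : G.inv h ∈ G.isolated A) :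
    ¬ (G.boundaryPerm A hA).SameCycle h (G.inv h) := by
  intro hs
  have : h ∈ (G.boundaryPerm A hA).cyc (G.inv h) := mem_cyc.2 hs.symm
  rw [hG.cyc_of_mem_isolated hA h'] at this
  have hiso : h ∈ G.isolated A := by
    simp only [Finset.mem_insert, Finset.mem_singleton] at this
    rcases this with e | e | e
    · rw [e]; exact h'
    · rw [e]; exact hG.rot_mem_isolated h'
    · rw [e]; exact hG.rot_mem_isolated (hG.rot_mem_isolated h')
  rw [mem_isolated] at hiso
  tauto

end IsCubic

end RibbonGraph

/-! ### Adding one edge to a subgraph, and comparison with the whole graph. -/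

namespace RibbonGraph

open Equiv.Perm

variable {H : Type*} [DecidableEq H] [Fintype H]

namespace IsCubic

variable {G : RibbonGraph H} {A : Finset H}

theorem sameCycle_of_univalent (hG : G.IsCubic) (hA : G.InvClosed A) {x : H}
    (h1 : G.rot x ∉ A) (h2 : G.rot (G.rot x) ∉ A) :
    (G.boundaryPerm A hA).SameCycle x (G.rot x) ∧
      (G.boundaryPerm A hA).SameCycle x (G.rot (G.rot x)) := by
  have s1 : (G.boundaryPerm A hA).SameCycle (G.rot x) (G.rot (G.rot x)) :=
    ⟨1, by rw [zpow_one, boundaryPerm_of_notMem h1]⟩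
  have s2 : (G.boundaryPerm A hA).SameCycle (G.rot (G.rot x)) x :=
    ⟨1, by rw [zpow_one, boundaryPerm_of_notMem h2, hG.rot_rot_rot]⟩
  exact ⟨(s1.trans s2).symm, s2.symm⟩

/-- At a univalent vertex all three half-edges lie on one cycle. An edge attached there would
therefore meet `C`, so a cycle disjoint from the new edge keeps its univalent vertex. -/
theorem Unsettled.insert (hG : G.IsCubic) (hA : G.InvClosed A) {A₀ C : Finset H} {h : H}
    (hC : C ∈ (G.boundaryPerm A hA).cycles) (h1 : h ∉ C) (h2 : G.inv h ∉ C)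
    (hu : G.Unsettled A₀ A C) :
    G.Unsettled A₀ (insert h (insert (G.inv h) A)) C := by
  have hne : ∀ x ∈ C, x ≠ h ∧ x ≠ G.inv h := fun x hx =>
    ⟨fun e => h1 (e ▸ hx), fun e => h2 (e ▸ hx)⟩
  rcases hu with ⟨⟨x, hx, hxA⟩, hall⟩ | ⟨x, hx, hxA, hx1, hx2⟩
  · refine Or.inl ⟨⟨x, hx, by simp [hxA]⟩, fun y hy hyA => ?_⟩
    simp only [Finset.mem_insert, hne y hy, false_or] at hyA
    exact hall y hy hyA
  · have hs := hG.sameCycle_of_univalent hA hx1 hx2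
    rw [eq_cyc_of_mem hC hx] at hne
    have n1 := hne _ (mem_cyc.2 hs.1)
    have n2 := hne _ (mem_cyc.2 hs.2)
    exact Or.inr ⟨x, hx, by simp [hxA], by simp [hx1, n1], by simp [hx2, n2]⟩

variable {h : H}

theorem cyclesAvoiding_unsettled_subset (hG : G.IsCubic) (A₀ : Finset H) (hA : G.InvClosed A)
    (hh : h ∉ A) [DecidablePred (G.Unsettled A₀ A)] :
    ((G.boundaryPerm A hA).cyclesAvoiding h (G.inv h)).filter (G.Unsettled A₀ A) ⊆
      G.unsettledCycles A₀ _ (hA.insert h) := by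
  intro C hC
  rw [Finset.mem_filter] at hC
  have h1 := mem_cyclesAvoiding.1 hC.1
  rw [mem_unsettledCycles]
  refine ⟨?_, Unsettled.insert hG hA h1.1 h1.2.1 h1.2.2 hC.2⟩
  rw [boundaryPerm_insert hA hh]
  have := hC.1
  rw [← cyclesAvoiding_mul_swap] at this
  exact (mem_cyclesAvoiding.1 this).1

/-- Up to a constant depending on `H`, the quantity is `12` times the sum of (genus - 1) over the
components of the subgraph. It is unchanged when a face is split or a new vertex is reached, and
grows by `12` when two faces carrying edges are merged: a new handle, or the junction of two
components. -/
theorem exists_card_insert (hG : G.IsCubic) (hA : G.InvClosed A) (hh : h ∉ A)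
    (hadj : G.rot h ∈ A ∨ G.rot (G.rot h) ∈ A) :
    ∃ j : ℕ, 3 * ((insert h (insert (G.inv h) A)).card : ℤ) +
      4 * (G.isolated (insert h (insert (G.inv h) A))).card -
      6 * (G.boundaryPerm _ (hA.insert h)).cycles.card =
      3 * A.card + 4 * (G.isolated A).card - 6 * (G.boundaryPerm A hA).cycles.card + 12 * j := by
  have hcard := card_insert_edge hA hh
  have hav := cyclesAvoiding_mul_swap (G.boundaryPerm A hA) h (G.inv h)
  have hne : h ≠ G.inv h := (G.inv_ne h).symm
  rw [boundaryPerm_insert hA hh]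
  by_cases hs : (G.boundaryPerm A hA).SameCycle h (G.inv h)
  · have h' : G.inv h ∉ G.isolated A := fun h' => hG.not_sameCycle_of_isolated hA hadj h' hs
    rw [hG.isolated_insert_of_notMem hadj h', hcard, card_cycles_of_sameCycle hs,
      card_cycles_of_not_sameCycle (not_sameCycle_mul_swap hs hne), hav]
    exact ⟨0, by push_cast; ring⟩
  · rw [hcard, card_cycles_of_not_sameCycle hs,
      card_cycles_of_sameCycle (sameCycle_mul_swap_self hs), hav]
    by_cases h' : G.inv h ∈ G.isolated A
    · have := hG.card_isolated_insert_of_mem hadj h'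
      exact ⟨0, by push_cast; omega⟩
    · rw [hG.isolated_insert_of_notMem hadj h']
      exact ⟨1, by push_cast; ring⟩

/-- Three cases. Splitting a face gains one cycle and settles at most one. Reaching an isolated
vertex loses one cycle and three isolated half-edges, but the new univalent end leaves the merged
cycle unsettled. Merging two faces with edges loses one cycle and settles at most two. Each is paid
for by the two half-edges added to `A`. -/
theorem card_unsettledCycles_insert (hG : G.IsCubic) (A₀ : Finset H) (hA : G.InvClosed A)
    (hh : h ∉ A) (hadj : G.rot h ∈ A ∨ G.rot (G.rot h) ∈ A) :
    (G.boundaryPerm _ (hA.insert h)).cycles.card + (G.isolated A).card +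
      (G.unsettledCycles A₀ A hA).card + A.card ≤
    (G.boundaryPerm A hA).cycles.card + (G.isolated (insert h (insert (G.inv h) A))).card +
      (G.unsettledCycles A₀ _ (hA.insert h)).card + (insert h (insert (G.inv h) A)).card := by
  classical
  have hcard := card_insert_edge hA hh
  have hav := cyclesAvoiding_mul_swap (G.boundaryPerm A hA) h (G.inv h)
  have hne : h ≠ G.inv h := (G.inv_ne h).symm
  have hsub := hG.cyclesAvoiding_unsettled_subset A₀ hA hh
  have hle := Finset.card_le_card hsub
  have hins : ∀ (C : Finset H) (s : Finset (Finset H)),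
      ((insert C s).filter (G.Unsettled A₀ A)).card ≤
        (s.filter (G.Unsettled A₀ A)).card + 1 := fun C s => by
    rw [Finset.filter_insert]
    split_ifs
    · exact Finset.card_insert_le _ _
    · omega
  have hB : (G.unsettledCycles A₀ A hA).card =
      ((G.boundaryPerm A hA).cycles.filter (G.Unsettled A₀ A)).card := by
    unfold unsettledCycles
    congr!
  rw [hB]
  by_cases hs : (G.boundaryPerm A hA).SameCycle h (G.inv h)
  · have h' : G.inv h ∉ G.isolated A := fun h' => hG.not_sameCycle_of_isolated hA hadj h' hs
    have hc1 := card_cycles_of_sameCycle hs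
    have hc2 := card_cycles_of_not_sameCycle (not_sameCycle_mul_swap hs hne)
    have hi := hins ((G.boundaryPerm A hA).cyc h) ((G.boundaryPerm A hA).cyclesAvoiding h (G.inv h))
    rw [← cycles_eq_of_sameCycle hs] at hi
    rw [← boundaryPerm_insert hA hh] at hc2 hav
    rw [hav] at hc2
    rw [hG.isolated_insert_of_notMem hadj h']
    omega
  · have hc1 := card_cycles_of_not_sameCycle hs
    have hc2 := card_cycles_of_sameCycle (sameCycle_mul_swap_self hs)
    have hcyc := cyc_mul_swap hs
    rw [← boundaryPerm_insert hA hh] at hc2 hav hcyc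
    rw [hav] at hc2
    have hi := hins ((G.boundaryPerm A hA).cyc h)
      (insert ((G.boundaryPerm A hA).cyc (G.inv h))
        ((G.boundaryPerm A hA).cyclesAvoiding h (G.inv h)))
    rw [← cycles_eq_of_not_sameCycle] at hi
    by_cases h' : G.inv h ∈ G.isolated A
    · have h3 := hG.card_isolated_insert_of_mem hadj h'
      have hnot : ¬ G.Unsettled A₀ A ((G.boundaryPerm A hA).cyc (G.inv h)) := by
        have hcy := hG.cyc_of_mem_isolated hA h'
        have : ∀ x ∈ (G.boundaryPerm A hA).cyc (G.inv h), x ∉ A := by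
          rw [hcy]
          have := mem_isolated.1 h'
          intro x hx
          simp only [Finset.mem_insert, Finset.mem_singleton] at hx
          rcases hx with rfl | rfl | rfl <;> tauto
        rintro (⟨⟨x, hx, hxA⟩, -⟩ | ⟨x, hx, hxA, -⟩) <;> exact this x hx hxA
      rw [Finset.filter_insert _ ((G.boundaryPerm A hA).cyc (G.inv h)), if_neg hnot] at hi
      have hn0 : h ∉ G.isolated A := fun e => hG.notMem_isolated_of_adj hadj e (by simp)
      have hn1 : G.rot (G.inv h) ≠ h := fun e => hn0 (e ▸ hG.rot_mem_isolated h')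
      have hn2 : G.rot (G.rot (G.inv h)) ≠ h := fun e =>
        hn0 (e ▸ hG.rot_mem_isolated (hG.rot_mem_isolated h'))
      have hmem : (G.boundaryPerm _ (hA.insert h)).cyc h ∈ G.unsettledCycles A₀ _ (hA.insert h) := by
        rw [mem_unsettledCycles]
        refine ⟨cyc_mem_cycles _ _, Or.inr ⟨G.inv h, ?_, by simp, ?_, ?_⟩⟩
        · rw [hcyc]
          exact Finset.mem_union_right _ (self_mem_cyc _ _)
        · simp [hG.rot_ne, (mem_isolated.1 h').2.1, hn1]
        · simp [hG.rot_rot_ne, (mem_isolated.1 h').2.2, hn2]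
      have hnm : (G.boundaryPerm _ (hA.insert h)).cyc h ∉
          ((G.boundaryPerm A hA).cyclesAvoiding h (G.inv h)).filter (G.Unsettled A₀ A) := by
        intro hm
        exact (mem_cyclesAvoiding.1 (Finset.mem_filter.1 hm).1).2.1 (self_mem_cyc _ _)
      have := Finset.card_le_card (Finset.insert_subset hmem hsub)
      rw [Finset.card_insert_of_notMem hnm] at this
      omega
    · have hi2 := hins ((G.boundaryPerm A hA).cyc (G.inv h))
        ((G.boundaryPerm A hA).cyclesAvoiding h (G.inv h))
      rw [hG.isolated_insert_of_notMem hadj h']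
      omega

end IsCubic

/-- Otherwise the complement of `A` would be invariant under `inv` and `rot`, hence under the group
they generate, which acts transitively. -/
theorem Connected.exists_adjacent {G : RibbonGraph H} (hconn : G.Connected) {A : Finset H}
    (hG : G.IsCubic) (hA : G.InvClosed A) (hne : A.Nonempty) (huniv : A ≠ Finset.univ) :
    ∃ h, h ∉ A ∧ (G.rot h ∈ A ∨ G.rot (G.rot h) ∈ A) := by
  by_contra! hcon
  obtain ⟨a, ha⟩ := hne
  obtain ⟨b, hb⟩ : ∃ b, b ∉ A := by
    by_contra! h
    exact huniv (Finset.eq_univ_iff_forall.2 h)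
  obtain ⟨p, hp, hpab⟩ := hconn.2 b a
  have key : ∀ q ∈ Subgroup.closure ({G.inv, G.rot} : Set (Equiv.Perm H)),
      ∀ x, x ∉ A ↔ q x ∉ A := by
    intro q hq
    induction hq using Subgroup.closure_induction with
    | mem q hq =>
      rcases hq with rfl | hq
      · intro x; rw [hA.inv_mem_iff]
      · rw [Set.mem_singleton_iff] at hq
        subst hq
        intro x
        refine ⟨fun hx => (hcon x hx).1, fun hx => ?_⟩
        have := (hcon _ hx).2
        rwa [hG.rot_rot_rot] at this
    | one => intro x; rfl
    | mul q r _ _ hq hr => intro x; rw [Equiv.Perm.mul_apply, ← hq, ← hr]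
    | inv q _ hq => intro x; rw [hq (q⁻¹ x)]; simp
  exact ((key p hp b).1 hb) (hpab ▸ ha)

namespace IsCubic

variable {G : RibbonGraph H}

/-- Comparison of a subgraph with the whole graph: the genus does not decrease, and settling the
faces of the subgraph costs Euler characteristic. -/
theorem compare_univ (hG : G.IsCubic) (hconn : G.Connected) (A₀ : Finset H)
    (hface : ∀ C ∈ (G.rot * G.inv).cycles, ∃ x ∈ C, x ∉ A₀) {A : Finset H}
    (hA : G.InvClosed A) (hne : A.Nonempty) :
    (∃ j : ℕ, 3 * (Fintype.card H : ℤ) - 6 * Nat.card G.Face =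
      3 * A.card + 4 * (G.isolated A).card - 6 * (G.boundaryPerm A hA).cycles.card + 12 * j) ∧
    Nat.card G.Face + (G.isolated A).card + (G.unsettledCycles A₀ A hA).card + A.card ≤
      (G.boundaryPerm A hA).cycles.card + Fintype.card H := by
  induction hn : (Fintype.card H - A.card) using Nat.strong_induction_on generalizing A with
  | _ n ih =>
  by_cases huniv : A = Finset.univ
  · subst huniv
    -- In the whole graph nothing is unsettled: every face has a half-edge outside `A₀`, and no
    -- vertex is univalent.
    have h0 : G.unsettledCycles A₀ Finset.univ hA = ∅ := by
      rw [Finset.eq_empty_iff_forall_notMem]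
      intro C hC
      rw [mem_unsettledCycles, boundaryPerm_univ] at hC
      rcases hC.2 with h | ⟨x, -, -, h, -⟩
      · obtain ⟨x, hx, hx'⟩ := hface C hC.1
        exact hx' (h.2 x hx (Finset.mem_univ x))
      · exact h (Finset.mem_univ _)
    rw [h0, isolated_univ, boundaryPerm_univ, card_cycles_eq_card_face, Finset.card_univ]
    exact ⟨⟨0, by simp⟩, by simp⟩
  · obtain ⟨h, hh, hadj⟩ := hconn.exists_adjacent hG hA hne huniv
    have hcard := card_insert_edge hA hh
    have hle : (insert h (insert (G.inv h) A)).card ≤ Fintype.card H := Finset.card_le_univ _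
    obtain ⟨⟨j, hj⟩, hB⟩ := ih _ (by omega) (hA.insert h) ⟨h, by simp⟩ rfl
    obtain ⟨i, hi⟩ := hG.exists_card_insert hA hh hadj
    have hs := hG.card_unsettledCycles_insert A₀ hA hh hadj
    refine ⟨⟨i + j, ?_⟩, by omega⟩
    rw [hj, hi]
    push_cast
    ring

/-- The numerical constraints on a subgraph without univalent vertices, no face of which is a face
of the whole graph. -/
theorem subgraph_constraints (hG : G.IsCubic) (hconn : G.Connected) {A : Finset H}
    (hface : ∀ C ∈ (G.rot * G.inv).cycles, ∃ x ∈ C, x ∉ A)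
    (hA : G.InvClosed A) (hne : A.Nonempty)
    (huni : ∀ h ∈ A, G.rot h ∈ A ∨ G.rot (G.rot h) ∈ A) :
    ∃ k j : ℕ, 1 ≤ k ∧ k ≤ (G.corners A).card ∧
      (Fintype.card H : ℤ) - 6 * Nat.card G.Face =
        A.card - 2 * (G.corners A).card - 6 * k + 12 * j ∧
      A.card + 3 * Nat.card G.Face ≤ Fintype.card H + 2 * (G.corners A).card := by
  classical
  obtain ⟨⟨j, hj⟩, hB⟩ := hG.compare_univ hconn A hface hA hne
  set f := G.boundaryPerm A hA with hf
  set K := f.cycles.filter fun C => ∃ x ∈ C, x ∈ A with hK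
  have hsplit : K.card + (f.cycles.filter fun C => ¬ ∃ x ∈ C, x ∈ A).card = f.cycles.card :=
    Finset.card_filter_add_card_filter_not _
  have hiso := hG.card_isolated hA
  rw [← hf] at hiso
  -- With `A₀ = A`, no edge has been attached yet and every face of the subgraph is unsettled.
  have hUns : K.card ≤ (G.unsettledCycles A A hA).card := by
    refine Finset.card_le_card fun C hC => ?_
    rw [hK, Finset.mem_filter] at hC
    rw [mem_unsettledCycles]
    exact ⟨hC.1, Or.inl ⟨hC.2, fun x _ hx => hx⟩⟩
  have htot : A.card + (G.corners A).card + (G.isolated A).card = Fintype.card H := by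
    rw [← Finset.card_union_of_disjoint, ← Finset.card_union_of_disjoint, ← Finset.card_univ]
    · congr 1
      rw [Finset.eq_univ_iff_forall]
      intro x
      simp only [Finset.mem_union, mem_corners, mem_isolated]
      by_cases hx : x ∈ A
      · exact Or.inl (Or.inl hx)
      by_cases h1 : G.rot x ∈ A
      · rcases huni _ h1 with h | h
        · tauto
        · rw [hG.rot_rot_rot] at h; exact absurd h hx
      · by_cases h2 : G.rot (G.rot x) ∈ A
        · have := huni _ h2
          rw [hG.rot_rot_rot] at this
          tauto
        · tauto
    · rw [Finset.disjoint_left]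
      intro x hx hx'
      rw [Finset.mem_union, mem_corners] at hx
      rw [mem_isolated] at hx'
      tauto
    · rw [Finset.disjoint_left]
      intro x hx hx'
      rw [mem_corners] at hx'
      tauto
  -- Each face of the subgraph passes through a corner, and a corner lies on a single face.
  have hkc : K.card ≤ (G.corners A).card := by
    refine (Finset.card_le_card ?_).trans (Finset.card_image_le (f := f.cyc))
    intro C hC
    rw [hK, Finset.mem_filter] at hC
    obtain ⟨hC, x, hx, hxA⟩ := hC
    rw [Finset.mem_image]
    -- otherwise the cycle stays in `A` and is a face of the whole graph
    by_contra! hcon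
    have hmem : ∀ y ∈ C, y ∈ A := by
      intro y hy
      rw [eq_cyc_of_mem hC hx, mem_cyc] at hy
      refine (hy.mem_of_invariant (S := {z | z ∈ C ∧ z ∈ A}) ?_ ⟨hx, hxA⟩).2
      rintro z ⟨hz, hzA⟩
      have hzC := apply_mem_of_mem_cycles hC hz
      refine ⟨hzC, ?_⟩
      by_contra hn
      have hn' := hn
      rw [hf, boundaryPerm_of_mem hzA] at hn'
      refine hcon _ ?_ (eq_cyc_of_mem hC hzC).symm
      rw [hf, boundaryPerm_of_mem hzA, mem_corners]
      have := huni _ (hA _ hzA)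
      have h2 : G.rot (G.rot (G.inv z)) ∈ A := this.resolve_left hn'
      refine ⟨hn', h2, ?_⟩
      rw [hG.rot_rot_rot]
      exact hA _ hzA
    have hCc : C ∈ (G.rot * G.inv).cycles := by
      rw [mem_cycles]
      refine ⟨x, ?_⟩
      rw [eq_cyc_of_mem hC hx]
      have hpow : ∀ n : ℕ, ((G.rot * G.inv) ^ n) x = (f ^ n) x := by
        intro n
        induction n with
        | zero => rfl
        | succ n ih =>
          have hm : (f ^ n) x ∈ A := hmem _ (by
            rw [eq_cyc_of_mem hC hx, mem_cyc]
            exact ⟨n, by simp⟩)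
          rw [pow_succ', Equiv.Perm.mul_apply, ih, pow_succ', Equiv.Perm.mul_apply (f := f), hf,
            boundaryPerm_of_mem hm]
          rfl
      ext y
      rw [mem_cyc, mem_cyc]
      constructor
      · intro h
        obtain ⟨n, hn⟩ := h.exists_nat_pow
        exact ⟨n, by rw [zpow_natCast, ← hpow, hn]⟩
      · intro h
        obtain ⟨n, hn⟩ := h.exists_nat_pow
        exact ⟨n, by rw [zpow_natCast, hpow, hn]⟩
    obtain ⟨y, hy, hyA⟩ := hface C hCc
    exact hyA (hmem y hy)
  -- Both relations come from `compare_univ` by eliminating the isolated half-edges, whose number is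
  -- `#H - #A - d` and which contribute a third of that number of cycles.
  refine ⟨K.card, j, ?_, hkc, by omega, by omega⟩
  obtain ⟨a, ha⟩ := hne
  exact Finset.card_pos.2 ⟨f.cyc a, Finset.mem_filter.2
    ⟨cyc_mem_cycles _ _, a, self_mem_cyc _ _, ha⟩⟩

end IsCubic

end RibbonGraph

/-! ### Dimension of the space of foliations of a subgraph -/

namespace RibbonGraph

variable {H : Type*} [DecidableEq H] [Fintype H]

/-- The dimension of the cone of weights supported on `A`. -/
noncomputable def foliationDim (G : RibbonGraph H) (A : Finset H) : ℕ :=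
  Module.finrank ℝ (Submodule.span ℝ (G.weightCone A))

/-- The linear hull of the weights supported on a subgraph without univalent vertices. -/
def weightSpace (G : RibbonGraph H) (A : Finset H) : Submodule ℝ (H → ℝ) where
  carrier := {x | (∀ h, x (G.inv h) = x h) ∧ (∀ h, h ∉ A → x h = 0) ∧
    ∀ h, h ∉ A → x (G.rot h) = x (G.rot (G.rot h))}
  add_mem' := by
    rintro x y ⟨h1, h2, h3⟩ ⟨k1, k2, k3⟩
    refine ⟨fun h => ?_, fun h hh => ?_, fun h hh => ?_⟩
    · simp [h1, k1]
    · simp [h2 h hh, k2 h hh]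
    · simp [h3 h hh, k3 h hh]
  zero_mem' := ⟨fun _ => rfl, fun _ _ => rfl, fun _ _ => rfl⟩
  smul_mem' := by
    rintro c x ⟨h1, h2, h3⟩
    refine ⟨fun h => ?_, fun h hh => ?_, fun h hh => ?_⟩
    · simp [h1]
    · simp [h2 h hh]
    · simp [h3 h hh]

theorem mem_weightSpace {G : RibbonGraph H} {A : Finset H} {x : H → ℝ} :
    x ∈ G.weightSpace A ↔ (∀ h, x (G.inv h) = x h) ∧ (∀ h, h ∉ A → x h = 0) ∧
      ∀ h, h ∉ A → x (G.rot h) = x (G.rot (G.rot h)) := Iff.rfl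

namespace IsCubic

variable {G : RibbonGraph H} {A : Finset H}

/-- The weight of a half-edge outside `A` is zero, so two of the triangle inequalities at its vertex
are opposite to each other. -/
theorem weightCone_subset_weightSpace (hG : G.IsCubic) :
    G.weightCone A ⊆ G.weightSpace A := by
  intro x hx
  refine ⟨hx.1, hx.2.1, fun h hh => ?_⟩
  have h0 := hx.2.1 h hh
  have h1 := hx.2.2 (G.rot h)
  have h2 := hx.2.2 (G.rot (G.rot h))
  rw [hG.rot_rot_rot] at h1 h2
  linarith

theorem foliationDim_le_finrank (hG : G.IsCubic) :
    G.foliationDim A ≤ Module.finrank ℝ (G.weightSpace A) :=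
  Submodule.finrank_mono (Submodule.span_le.2 hG.weightCone_subset_weightSpace)

/-- The constant weight on `A` makes every triangle inequality strict except those forced to be
equalities at bivalent vertices. A large multiple absorbs any `y` in `weightSpace`: with `|y| ≤ M`,
the constant `3M` is enough, and `y` is then a difference of two elements of the cone. -/
theorem weightSpace_le_span (hG : G.IsCubic) (hA : G.InvClosed A)
    (huni : ∀ h ∈ A, G.rot h ∈ A ∨ G.rot (G.rot h) ∈ A) :
    G.weightSpace A ≤ Submodule.span ℝ (G.weightCone A) := by
  intro y hy
  obtain ⟨h1, h2, h3⟩ := mem_weightSpace.1 hy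
  obtain ⟨M, hM, hMy⟩ : ∃ M : ℝ, 0 < M ∧ ∀ h, |y h| ≤ M := by
    refine ⟨∑ h, |y h| + 1, by positivity, fun h => ?_⟩
    have := Finset.single_le_sum (f := fun h => |y h|) (fun i _ => abs_nonneg _) (Finset.mem_univ h)
    linarith
  let u : H → ℝ := fun h => if h ∈ A then 3 * M else 0
  have huinv : ∀ h, u (G.inv h) = u h := fun h => by simp [u, hA.inv_mem_iff]
  have hu : u ∈ G.weightCone A := by
    refine ⟨huinv, fun h hh => by simp [u, hh], fun h => ?_⟩
    by_cases hh : h ∈ A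
    · rcases huni h hh with h | h <;> simp only [u, hh, h, if_true] <;> split_ifs <;> linarith
    · simp only [u, hh, if_false]; split_ifs <;> linarith
  have huy : u + y ∈ G.weightCone A := by
    refine ⟨fun h => by simp [huinv, h1], fun h hh => by simp [u, hh, h2 h hh], fun h => ?_⟩
    simp only [Pi.add_apply]
    have b1 := abs_le.1 (hMy h)
    have b2 := abs_le.1 (hMy (G.rot h))
    have b3 := abs_le.1 (hMy (G.rot (G.rot h)))
    by_cases hh : h ∈ A
    · by_cases hr : G.rot h ∈ A
      · by_cases hrr : G.rot (G.rot h) ∈ A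
        · simp only [u, hh, hr, hrr, if_true]; linarith
        · have := h3 _ hrr
          rw [hG.rot_rot_rot] at this
          simp only [u, hh, hr, hrr, if_true, if_false, h2 _ hrr]; linarith
      · have hrr := (huni h hh).resolve_left hr
        have := h3 _ hr
        rw [hG.rot_rot_rot] at this
        simp only [u, hh, hr, hrr, if_true, if_false, h2 _ hr]; linarith
    · simp only [u, hh, if_false, h2 h hh]
      by_cases hr : G.rot h ∈ A <;> by_cases hrr : G.rot (G.rot h) ∈ A <;>
        simp only [hr, hrr, if_true, if_false] <;>
        first
        | linarith
        | (rw [h2 _ hr, h2 _ hrr]; simp)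
  have : y = (u + y) - u := by simp
  rw [this]
  exact Submodule.sub_mem _ (Submodule.subset_span huy) (Submodule.subset_span hu)

theorem finrank_le_foliationDim (hG : G.IsCubic) (hA : G.InvClosed A)
    (huni : ∀ h ∈ A, G.rot h ∈ A ∨ G.rot (G.rot h) ∈ A) :
    Module.finrank ℝ (G.weightSpace A) ≤ G.foliationDim A :=
  Submodule.finrank_mono (hG.weightSpace_le_span hA huni)

theorem one_le_foliationDim (hA : G.InvClosed A) (hne : A.Nonempty)
    (huni : ∀ h ∈ A, G.rot h ∈ A ∨ G.rot (G.rot h) ∈ A) : 1 ≤ G.foliationDim A := by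
  let u : H → ℝ := fun h => if h ∈ A then 1 else 0
  have hu : u ∈ G.weightCone A := by
    refine ⟨fun h => by simp [u, hA.inv_mem_iff], fun h hh => by simp [u, hh], fun h => ?_⟩
    by_cases hh : h ∈ A
    · rcases huni h hh with h | h <;> simp only [u, hh, h, if_true] <;> split_ifs <;> linarith
    · simp only [u, hh, if_false]; split_ifs <;> linarith
  obtain ⟨a, ha⟩ := hne
  rw [foliationDim, Nat.one_le_iff_ne_zero, Ne, Submodule.finrank_eq_zero]
  intro h0
  have : u ∈ Submodule.span ℝ (G.weightCone A) := Submodule.subset_span hu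
  rw [h0, Submodule.mem_bot] at this
  have := congrFun this a
  simp [u, ha] at this

/-- Removing the edge at a univalent vertex does not change the foliations. -/
theorem foliationDim_le_of_univalent (hG : G.IsCubic) {a : H}
    (h1 : G.rot a ∉ A) (h2 : G.rot (G.rot a) ∉ A) :
    G.foliationDim A ≤ G.foliationDim ((A.erase a).erase (G.inv a)) := by
  refine Submodule.finrank_mono (Submodule.span_mono ?_)
  intro x hx
  refine ⟨hx.1, fun h hh => ?_, hx.2.2⟩
  have h0 : x a = 0 := by
    have h3 := hx.2.2 a
    rw [hx.2.1 _ h1, hx.2.1 _ h2] at h3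
    have := hG.nonneg_of_mem_weightCone hx a
    linarith
  by_cases e1 : h = a
  · rw [e1, h0]
  by_cases e2 : h = G.inv a
  · rw [e2, hx.1, h0]
  exact hx.2.1 h fun hA => hh (by simp [e1, e2, hA])

/-- The weights on a disjoint union of subgraphs. -/
theorem foliationDim_le_add (hG : G.IsCubic) {B : Finset H} (hB : G.InvClosed B)
    (hadj : ∀ h ∈ A, G.rot h ∈ A → (h ∈ B ↔ G.rot h ∈ B)) :
    G.foliationDim A ≤ G.foliationDim B + G.foliationDim (A \ B) := by
  have hsub : ∀ x ∈ G.weightCone A, ∀ P : H → Prop, ∀ [DecidablePred P],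
      (∀ h, P (G.inv h) ↔ P h) → (∀ h ∈ A, G.rot h ∈ A → (P h ↔ P (G.rot h))) →
      ∀ C : Finset H, (∀ h, h ∉ C → h ∈ A → ¬ P h) →
      (fun h => if P h then x h else 0) ∈ G.weightCone C := by
    intro x hx P _ hPi hPr C hC
    have hnn := hG.nonneg_of_mem_weightCone hx
    refine ⟨fun h => by simp only [hPi, hx.1], fun h hh => ?_, fun h => ?_⟩
    · by_cases hA : h ∈ A
      · simp [hC h hh hA]
      · simp [hx.2.1 h hA]
    · by_cases hP : P h
      · simp only [hP, if_true]
        have t := hx.2.2 h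
        by_cases hA : h ∈ A
        · have e1 : ¬ P (G.rot h) → x (G.rot h) = 0 := fun hn => hx.2.1 _ fun hr =>
            hn ((hPr h hA hr).1 hP)
          have e2 : ¬ P (G.rot (G.rot h)) → x (G.rot (G.rot h)) = 0 := fun hn => hx.2.1 _ fun hr =>
            hn ((hPr _ hr (by rwa [hG.rot_rot_rot])).2 (by rwa [hG.rot_rot_rot]))
          split_ifs with c1 c2 c2
          · exact t
          · rw [e2 c2] at t; exact t
          · rw [e1 c1] at t; exact t
          · rw [e1 c1, e2 c2] at t; linarith
        · rw [hx.2.1 h hA]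
          have := hnn (G.rot h)
          have := hnn (G.rot (G.rot h))
          split_ifs <;> linarith
      · simp only [hP, if_false]
        have := hnn (G.rot h)
        have := hnn (G.rot (G.rot h))
        split_ifs <;> linarith
  have hle : Submodule.span ℝ (G.weightCone A) ≤
      Submodule.span ℝ (G.weightCone B) ⊔ Submodule.span ℝ (G.weightCone (A \ B)) := by
    rw [Submodule.span_le]
    intro x hx
    have m1 := hsub x hx (· ∈ B) (fun h => hB.inv_mem_iff) hadj B (fun h hh _ => hh)
    have m2 := hsub x hx (· ∉ B) (fun h => not_congr hB.inv_mem_iff)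
      (fun h h1 h2 => not_congr (hadj h h1 h2)) (A \ B) (fun h hh hA => by
        simpa [hA] using hh)
    have : x = (fun h => if h ∈ B then x h else 0) + fun h => if h ∉ B then x h else 0 := by
      ext h
      by_cases hh : h ∈ B <;> simp [hh]
    rw [this]
    exact Submodule.add_mem_sup (Submodule.subset_span m1) (Submodule.subset_span m2)
  exact (Submodule.finrank_mono hle).trans (Submodule.finrank_add_le_finrank_add_finrank _ _)

/-- A subgraph which is not a disjoint union of smaller subgraphs. -/
def _root_.RibbonGraph.Indecomposable (G : RibbonGraph H) (A : Finset H) : Prop :=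
  ∀ B ⊆ A, G.InvClosed B → (∀ h ∈ A, G.rot h ∈ A → (h ∈ B ↔ G.rot h ∈ B)) → B = ∅ ∨ B = A

/-- Without trivalent vertices, the weights at a vertex are equal and propagate. The zero set of a
weight is a union of components, so vanishing at one half-edge `a` forces vanishing everywhere. -/
theorem finrank_weightSpace_le_one (hG : G.IsCubic) (hA : G.InvClosed A) (hne : A.Nonempty)
    (hind : G.Indecomposable A) (hbi : ∀ h ∈ A, ¬ (G.rot h ∈ A ∧ G.rot (G.rot h) ∈ A)) :
    Module.finrank ℝ (G.weightSpace A) ≤ 1 := by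
  obtain ⟨a, ha⟩ := hne
  have hinj : Function.Injective
      ((LinearMap.proj (R := ℝ) (φ := fun _ : H => ℝ) a).comp (G.weightSpace A).subtype) := by
    rw [← LinearMap.ker_eq_bot, LinearMap.ker_eq_bot']
    rintro ⟨x, h1, h2, h3⟩ hx
    have hxa : x a = 0 := hx
    have hB := hind (A.filter fun h => x h = 0) (Finset.filter_subset _ _) (fun h hh => by
      rw [Finset.mem_filter] at hh ⊢
      exact ⟨hA _ hh.1, by rw [h1, hh.2]⟩) (fun h hh hr => by
      rw [Finset.mem_filter, Finset.mem_filter]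
      have hrr : G.rot (G.rot h) ∉ A := fun e => hbi h hh ⟨hr, e⟩
      have := h3 _ hrr
      rw [hG.rot_rot_rot] at this
      simp [hh, hr, this])
    have hB' : (A.filter fun h => x h = 0) = A := by
      refine hB.resolve_left fun h0 => ?_
      have : a ∈ A.filter fun h => x h = 0 := Finset.mem_filter.2 ⟨ha, hxa⟩
      rw [h0] at this
      simp at this
    apply Subtype.ext
    funext h
    by_cases hh : h ∈ A
    · rw [← hB', Finset.mem_filter] at hh
      exact hh.2
    · exact h2 h hh
  have := LinearMap.finrank_le_finrank_of_injective hinj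
  simpa using this

end IsCubic

/-! ### Independence of the equations at the bivalent vertices. -/

section EdgeWeights

variable {G : RibbonGraph H} {A : Finset H} {E' : Set G.Edge}

/-- The function on half-edges given by weights on the edges of `E'`. -/
noncomputable def spread (G : RibbonGraph H) (E' : Set G.Edge) : (E' → ℝ) →ₗ[ℝ] (H → ℝ) where
  toFun y h := by
    classical exact if hh : G.edge h ∈ E' then y ⟨G.edge h, hh⟩ else 0
  map_add' y z := by
    classical
    ext h
    by_cases hh : G.edge h ∈ E' <;> simp [hh]
  map_smul' c y := by
    classical
    ext h
    by_cases hh : G.edge h ∈ E' <;> simp [hh]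

theorem spread_of_mem (y : E' → ℝ) {h : H} (hh : G.edge h ∈ E') :
    G.spread E' y h = y ⟨G.edge h, hh⟩ := by
  classical
  simp [spread, hh]

theorem spread_of_notMem (y : E' → ℝ) {h : H} (hh : G.edge h ∉ E') : G.spread E' y h = 0 := by
  classical
  simp [spread, hh]

theorem spread_injective : Function.Injective (G.spread E') := by
  intro y z h
  funext ⟨e, he⟩
  obtain ⟨a, rfl⟩ := Quotient.exists_rep e
  have := congrFun h a
  rw [spread_of_mem y (h := a) he, spread_of_mem z (h := a) he] at this
  exact this

theorem exists_spread_eq {x : H → ℝ} (h1 : ∀ h, x (G.inv h) = x h)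
    (h2 : ∀ h, G.edge h ∉ E' → x h = 0) : ∃ y, G.spread E' y = x := by
  refine ⟨fun e => x (Quotient.out e.1), funext fun h => ?_⟩
  by_cases hh : G.edge h ∈ E'
  · rw [spread_of_mem _ hh]
    have : G.edge (Quotient.out (G.edge h)) = G.edge h := Quotient.out_eq _
    rcases edge_eq_edge_iff.1 this with e | e
    · simp only [← e]
    · simp only
      conv_rhs => rw [e]
      exact (h1 _).symm
  · rw [spread_of_notMem _ hh, h2 h hh]

theorem spread_inv (y : E' → ℝ) (h : H) : G.spread E' y (G.inv h) = G.spread E' y h := by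
  by_cases hh : G.edge h ∈ E'
  · rw [spread_of_mem _ hh, spread_of_mem _ (by rwa [edge_inv])]
    congr 2
    exact edge_inv G h
  · rw [spread_of_notMem _ hh, spread_of_notMem _ (by rwa [edge_inv])]

theorem two_mul_card_edgeSet (hA : ∀ h, h ∈ A ↔ G.edge h ∈ E') : 2 * Nat.card E' = A.card := by
  classical
  rw [Finset.card_eq_sum_card_fiberwise (f := G.edge) (t := E'.toFinset)]
  · rw [Finset.sum_const_nat (m := 2), mul_comm, Set.toFinset_card, Nat.card_eq_fintype_card]
    intro e he
    rw [← G.card_edge_fiber e, Nat.card_eq_fintype_card, Fintype.card_subtype]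
    congr 1
    ext h
    rw [Finset.mem_filter, Finset.mem_filter, hA]
    rw [Set.mem_toFinset] at he
    constructor
    · exact fun h => ⟨Finset.mem_univ _, h.2⟩
    · exact fun h => ⟨h.2 ▸ he, h.2⟩
  · intro h hh
    rw [Set.coe_toFinset]
    exact (hA h).1 hh

/-- The linear conditions at the bivalent vertices. -/
noncomputable def cornerMap (G : RibbonGraph H) (A : Finset H) (E' : Set G.Edge) :
    (E' → ℝ) →ₗ[ℝ] (G.corners A → ℝ) :=
  LinearMap.pi fun h => ((LinearMap.proj (R := ℝ) (φ := fun _ : H => ℝ) (G.rot h.1)) -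
    LinearMap.proj (R := ℝ) (φ := fun _ : H => ℝ) (G.rot (G.rot h.1))).comp (G.spread E')

theorem cornerMap_apply (y : E' → ℝ) (h : G.corners A) :
    G.cornerMap A E' y h = G.spread E' y (G.rot h.1) - G.spread E' y (G.rot (G.rot h.1)) := rfl

theorem map_ker_cornerMap (hG : G.IsCubic) (hA : ∀ h, h ∈ A ↔ G.edge h ∈ E')
    (huni : ∀ h ∈ A, G.rot h ∈ A ∨ G.rot (G.rot h) ∈ A) :
    (LinearMap.ker (G.cornerMap A E')).map (G.spread E') = G.weightSpace A := by
  ext x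
  rw [Submodule.mem_map]
  constructor
  · rintro ⟨y, hy, rfl⟩
    refine ⟨spread_inv y, fun h hh => spread_of_notMem y (by rwa [← hA]), fun h hh => ?_⟩
    by_cases hr : G.rot h ∈ A
    · have hrr := (huni _ hr).resolve_right (by rwa [hG.rot_rot_rot])
      have := congrFun (LinearMap.mem_ker.1 hy) ⟨h, mem_corners.2 ⟨hh, hr, hrr⟩⟩
      rw [cornerMap_apply] at this
      simp only [Pi.zero_apply] at this
      linarith
    · by_cases hrr : G.rot (G.rot h) ∈ A
      · have := huni _ hrr
        rw [hG.rot_rot_rot] at this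
        tauto
      · rw [spread_of_notMem y (by rwa [← hA]), spread_of_notMem y (by rwa [← hA])]
  · rintro ⟨h1, h2, h3⟩
    obtain ⟨y, rfl⟩ := exists_spread_eq (E' := E') h1 (fun h hh => h2 h (by rwa [hA]))
    refine ⟨y, ?_, rfl⟩
    rw [LinearMap.mem_ker]
    funext h
    rw [cornerMap_apply, h3 _ (mem_corners.1 h.2).1, sub_self]
    rfl

theorem finrank_weightSpace_eq_ker (hG : G.IsCubic) (hA : ∀ h, h ∈ A ↔ G.edge h ∈ E')
    (huni : ∀ h ∈ A, G.rot h ∈ A ∨ G.rot (G.rot h) ∈ A) :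
    Module.finrank ℝ (G.weightSpace A) = Module.finrank ℝ (LinearMap.ker (G.cornerMap A E')) := by
  rw [← map_ker_cornerMap hG hA huni]
  exact (LinearEquiv.finrank_eq
    (Submodule.equivMapOfInjective _ spread_injective (LinearMap.ker (G.cornerMap A E')))).symm

theorem finrank_range_add_finrank_weightSpace (hG : G.IsCubic) (hA : ∀ h, h ∈ A ↔ G.edge h ∈ E')
    (huni : ∀ h ∈ A, G.rot h ∈ A ∨ G.rot (G.rot h) ∈ A) :
    Module.finrank ℝ (LinearMap.range (G.cornerMap A E')) +
      Module.finrank ℝ (G.weightSpace A) = Nat.card E' := by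
  classical
  rw [finrank_weightSpace_eq_ker hG hA huni, LinearMap.finrank_range_add_finrank_ker,
    Module.finrank_fintype_fun_eq_card, Nat.card_eq_fintype_card]

/-- There is one equation per corner, and this inequality needs no independence. It supplies the
dimension bound for the extremal examples. -/
theorem card_le_finrank_weightSpace (hG : G.IsCubic) (hA : ∀ h, h ∈ A ↔ G.edge h ∈ E')
    (huni : ∀ h ∈ A, G.rot h ∈ A ∨ G.rot (G.rot h) ∈ A) :
    Nat.card E' ≤ Module.finrank ℝ (G.weightSpace A) + (G.corners A).card := by
  have h1 := finrank_range_add_finrank_weightSpace hG hA huni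
  have h2 := Submodule.finrank_le (LinearMap.range (G.cornerMap A E'))
  rw [Module.finrank_fintype_fun_eq_card, Fintype.card_coe] at h2
  omega

/-- A linear relation between the equations puts a coefficient on every corner. It has to propagate,
up to sign, along edges and through bivalent vertices, and it dies at a trivalent vertex.
Indecomposability spreads this vanishing to the whole subgraph. -/
theorem range_cornerMap_eq_top (hG : G.IsCubic) (hA : ∀ h, h ∈ A ↔ G.edge h ∈ E')
    (hind : G.Indecomposable A) (htri : ∃ h ∈ A, G.rot h ∈ A ∧ G.rot (G.rot h) ∈ A) :
    LinearMap.range (G.cornerMap A E') = ⊤ := by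
  classical
  by_contra hlt
  obtain ⟨f, hf, hle⟩ := Submodule.exists_le_ker_of_lt_top _ (lt_top_iff_ne_top.2 hlt)
  apply hf
  let c : H → ℝ := fun h => if hh : h ∈ G.corners A then f (Pi.single ⟨h, hh⟩ 1) else 0
  have hc0 : ∀ h, h ∉ G.corners A → c h = 0 := fun h hh => by simp [c, hh]
  have hAinv : G.InvClosed A := fun h hh => by rw [hA, edge_inv, ← hA]; exact hh
  have hfy : ∀ y : E' → ℝ, ∑ h : H, c h *
      (G.spread E' y (G.rot h) - G.spread E' y (G.rot (G.rot h))) = 0 := by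
    intro y
    have h1 : f (G.cornerMap A E' y) = 0 := hle ⟨y, rfl⟩
    rw [LinearMap.pi_apply_eq_sum_univ] at h1
    rw [← h1, ← Finset.sum_subset (Finset.subset_univ (G.corners A)) (fun h _ hh => by
      rw [hc0 h hh, zero_mul]), ← Finset.sum_coe_sort]
    refine Finset.sum_congr rfl fun h _ => ?_
    rw [cornerMap_apply, smul_eq_mul, mul_comm]
    congr 1
    simp only [c, h.2, dif_pos]
    congr 1
    ext j
    by_cases hj : j = h
    · subst hj; simp
    · simp [hj, Ne.symm hj]
  -- The total coefficient of `x a` in the relation: `a` occurs positively in the corner preceding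
  -- it and negatively in the corner following it.
  let s : H → ℝ := fun a => c (G.rot (G.rot a)) - c (G.rot a)
  have hsx : ∀ x : H → ℝ, (∀ h, x (G.inv h) = x h) → (∀ h, h ∉ A → x h = 0) →
      ∑ a, x a * s a = 0 := by
    intro x h1 h2
    obtain ⟨y, rfl⟩ := exists_spread_eq (E' := E') h1 (fun h hh => h2 h (by rwa [hA]))
    rw [← hfy y]
    simp only [s, mul_sub, Finset.sum_sub_distrib]
    congr 1
    · rw [← Equiv.sum_comp G.rot]
      refine Finset.sum_congr rfl fun h _ => ?_
      rw [hG.rot_rot_rot, mul_comm]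
    · rw [← Equiv.sum_comp G.rot, ← Equiv.sum_comp G.rot]
      refine Finset.sum_congr rfl fun h _ => ?_
      rw [hG.rot_rot_rot, mul_comm]
  -- Test the relation on the indicator function of a single edge.
  have hsinv : ∀ a ∈ A, s (G.inv a) = - s a := by
    intro a ha
    have := hsx (fun h => if h = a ∨ h = G.inv a then 1 else 0) (fun h => by
      have e1 : G.inv h = a ↔ h = G.inv a :=
        ⟨fun e => by rw [← e, G.inv_inv], fun e => by rw [e, G.inv_inv]⟩
      have e2 : G.inv h = G.inv a ↔ h = a := G.inv.injective.eq_iff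
      simp only [e1, e2, or_comm]) (fun h hh => by
      have : ¬ (h = a ∨ h = G.inv a) := by
        rintro (rfl | rfl)
        · exact hh ha
        · exact hh (hAinv _ ha)
      simp [this])
    simp only [ite_mul, one_mul, zero_mul] at this
    rw [← Finset.sum_filter] at this
    have hset : (Finset.univ.filter fun h => h = a ∨ h = G.inv a) = {a, G.inv a} := by
      ext; simp
    rw [hset, Finset.sum_pair (G.inv_ne a).symm] at this
    linarith
  -- The support of `s` is closed under `inv` and under adjacency, hence empty or all of `A`; a
  -- half-edge at a trivalent vertex excludes the latter.
  have hB : (A.filter fun a => s a ≠ 0) = ∅ := by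
    rcases hind (A.filter fun a => s a ≠ 0) (Finset.filter_subset _ _) (fun a ha => by
      rw [Finset.mem_filter] at ha ⊢
      exact ⟨hAinv _ ha.1, by rw [hsinv a ha.1]; exact neg_ne_zero.2 ha.2⟩) (fun a ha hr => by
      rw [Finset.mem_filter, Finset.mem_filter]
      have z1 : c a = 0 := hc0 _ fun e => (mem_corners.1 e).1 ha
      have z2 : c (G.rot a) = 0 := hc0 _ fun e => (mem_corners.1 e).1 hr
      simp only [s, hG.rot_rot_rot, ha, hr, z1, z2, true_and, zero_sub, sub_zero, neg_ne_zero])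
      with h | h
    · exact h
    · exfalso
      obtain ⟨a, ha, hr, hrr⟩ := htri
      have : a ∈ A.filter fun a => s a ≠ 0 := by rw [h]; exact ha
      rw [Finset.mem_filter] at this
      apply this.2
      simp only [s]
      rw [hc0 _ fun e => (mem_corners.1 e).1 hr, hc0 _ fun e => (mem_corners.1 e).1 hrr, sub_zero]
  apply LinearMap.pi_ext'
  intro h
  ext
  have hh := mem_corners.1 h.2
  have hz : s (G.rot h.1) = 0 := by
    by_contra hn
    have : G.rot h.1 ∈ A.filter fun a => s a ≠ 0 := Finset.mem_filter.2 ⟨hh.2.1, hn⟩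
    rw [hB] at this
    simp at this
  have hch : c h.1 = 0 := by
    simp only [s, hG.rot_rot_rot] at hz
    rw [hc0 _ fun e => (mem_corners.1 e).1 hh.2.2, sub_zero] at hz
    exact hz
  simp only [c, h.2, dif_pos] at hch
  simpa using hch

theorem finrank_weightSpace_add_card (hG : G.IsCubic) (hA : ∀ h, h ∈ A ↔ G.edge h ∈ E')
    (huni : ∀ h ∈ A, G.rot h ∈ A ∨ G.rot (G.rot h) ∈ A)
    (hind : G.Indecomposable A) (htri : ∃ h ∈ A, G.rot h ∈ A ∧ G.rot (G.rot h) ∈ A) :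
    Module.finrank ℝ (G.weightSpace A) + (G.corners A).card = Nat.card E' := by
  have h1 := finrank_range_add_finrank_weightSpace hG hA huni
  rw [range_cornerMap_eq_top hG hA hind htri, finrank_top, Module.finrank_fintype_fun_eq_card,
    Fintype.card_coe] at h1
  omega

end EdgeWeights

end RibbonGraph

/-! ### The lower bound -/

theorem sStar_nonneg_and_le_two (g n : ℕ) : 0 ≤ sStar g n ∧ sStar g n ≤ 2 := by
  unfold sStar
  split_ifs with h1 h2 h3 h4 h5
  · norm_num
  · have : (1 : ℝ) ≤ ((n / 2 : ℕ) : ℝ) - 2 := by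
      have : 3 ≤ n / 2 := by omega
      have : (3 : ℝ) ≤ ((n / 2 : ℕ) : ℝ) := by exact_mod_cast this
      linarith
    have h6 : 1 / (((n / 2 : ℕ) : ℝ) - 2) ≤ 1 := by
      rw [div_le_one (by linarith)]; exact this
    have h7 : 0 ≤ 1 / (((n / 2 : ℕ) : ℝ) - 2) := by positivity
    constructor <;> linarith
  · norm_num
  · norm_num
  · have : (2 : ℝ) ≤ g := by exact_mod_cast (show 2 ≤ g by omega)
    have h6 : 1 / (3 * (2 * (g : ℝ) - 3)) ≤ 1 := by
      rw [div_le_one (by linarith)]; linarith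
    have h7 : 0 ≤ 1 / (3 * (2 * (g : ℝ) - 3)) := div_nonneg zero_le_one (by linarith)
    constructor <;> linarith
  · have : (2 : ℝ) ≤ g := by exact_mod_cast (show 2 ≤ g by omega)
    have h6 : 1 / (3 * (2 * (g : ℝ) - 1)) ≤ 1 := by
      rw [div_le_one (by linarith)]; linarith
    have h7 : 0 ≤ 1 / (3 * (2 * (g : ℝ) - 1)) := div_nonneg zero_le_one (by linarith)
    constructor <;> linarith

/-- The bound for a stable connected subgraph with Euler characteristic `-χ`, `k` faces and `d`
bivalent vertices. -/
theorem sStar_mul_le {g n χ k j d : ℕ} (hχ : 1 ≤ χ) (hk : 1 ≤ k) (hkd : k ≤ d)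
    (heuler : (χ : ℤ) = 2 * g - 2 + k - 2 * j) (hle : 2 * χ + 4 ≤ 4 * g + n) :
    sStar g n * (3 * χ) ≤ 3 * χ + d := by
  have hkd' : (k : ℝ) ≤ d := by exact_mod_cast hkd
  have hχ' : (1 : ℝ) ≤ χ := by exact_mod_cast hχ
  unfold sStar
  split_ifs with h1 h2 h3 h4 h5
  · omega
  · have hm : χ ≤ n / 2 - 2 := by omega
    have hm' : (χ : ℝ) ≤ ((n / 2 : ℕ) : ℝ) - 2 := by
      have : χ + 2 ≤ n / 2 := by omega
      have : (χ : ℝ) + 2 ≤ ((n / 2 : ℕ) : ℝ) := by exact_mod_cast this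
      linarith
    have hk2 : (χ : ℝ) + 2 ≤ k := by
      have : χ + 2 ≤ k := by omega
      exact_mod_cast this
    have : 1 / (((n / 2 : ℕ) : ℝ) - 2) * χ ≤ 1 := by
      rw [one_div_mul_eq_div, div_le_one (by linarith)]
      exact hm'
    nlinarith
  · omega
  -- In genus `1`, `χ = k - 2j`.
  · have : (χ : ℝ) ≤ k := by exact_mod_cast (show χ ≤ k by omega)
    linarith
  · have hg : (2 : ℝ) ≤ g := by exact_mod_cast (show 2 ≤ g by omega)
    -- With one face, `χ ≤ 2g - 2`. In the extreme case `k = 2j` is even, so there are at least two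
    -- faces and two bivalent vertices.
    have key : (χ : ℝ) ≤ d * (2 * g - 3) := by
      rcases (show χ + 3 ≤ 2 * g ∨ (χ + 2 = 2 * g ∧ 2 ≤ k) by omega) with h | ⟨h, hk2⟩
      · have : (χ : ℝ) + 3 ≤ 2 * g := by exact_mod_cast h
        have hd : (1 : ℝ) ≤ d := by exact_mod_cast hk.trans hkd
        nlinarith
      · have : (χ : ℝ) + 2 = 2 * g := by exact_mod_cast h
        have hd : (2 : ℝ) ≤ d := by exact_mod_cast hk2.trans hkd
        nlinarith
    have : 1 / (3 * (2 * (g : ℝ) - 3)) * (3 * χ) ≤ d := by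
      rw [one_div_mul_eq_div, div_le_iff₀ (by linarith)]
      linarith
    linarith
  · have hg : (2 : ℝ) ≤ g := by exact_mod_cast (show 2 ≤ g by omega)
    -- Once `χ ≥ 2g`, the genus bound forces `d ≥ k ≥ χ + 2 - 2g`, and the product exceeds `χ`.
    have key : (χ : ℝ) ≤ d * (2 * g - 1) := by
      rcases (show χ + 1 ≤ 2 * g ∨ 2 * g ≤ χ by omega) with h | h
      · have : (χ : ℝ) + 1 ≤ 2 * g := by exact_mod_cast h
        have hd : (1 : ℝ) ≤ d := by exact_mod_cast hk.trans hkd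
        nlinarith
      · have h5 : (χ : ℝ) + 2 ≤ 2 * g + k := by exact_mod_cast (show χ + 2 ≤ 2 * g + k by omega)
        have h6 : (2 : ℝ) * g ≤ χ := by exact_mod_cast h
        nlinarith
    have : 1 / (3 * (2 * (g : ℝ) - 1)) * (3 * χ) ≤ d := by
      rw [one_div_mul_eq_div, div_le_iff₀ (by linarith)]
      linarith
    linarith

/-! ### Reduction to stable connected subgraphs, and the lower bound for `sHat`. -/

namespace RibbonGraph

variable {H : Type*} [DecidableEq H] [Fintype H]

namespace IsCubic

variable {G : RibbonGraph H}

/-- A single edge without univalent end is a loop whose half-edges are consecutive around the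
vertex; its inner side is then a face of `G` contained in `A`. -/
theorem four_le_card (hG : G.IsCubic) {A : Finset H} (hA : G.InvClosed A) (hne : A.Nonempty)
    (huni : ∀ h ∈ A, G.rot h ∈ A ∨ G.rot (G.rot h) ∈ A)
    (hface : ∀ C ∈ (G.rot * G.inv).cycles, ∃ x ∈ C, x ∉ A) : 4 ≤ A.card := by
  obtain ⟨a, ha⟩ := hne
  have hpair : ({a, G.inv a} : Finset H).card = 2 := Finset.card_pair (G.inv_ne a).symm
  have hsub : ({a, G.inv a} : Finset H) ⊆ A := by
    intro x hx
    simp only [Finset.mem_insert, Finset.mem_singleton] at hx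
    rcases hx with rfl | rfl
    · exact ha
    · exact hA _ ha
  have hfix : ∀ x ∈ A, (G.rot * G.inv) x ≠ x := by
    intro x hx e
    obtain ⟨y, hy, hyA⟩ := hface _ (Equiv.Perm.cyc_mem_cycles _ x)
    rw [Equiv.Perm.mem_cyc] at hy
    have : y = x := hy.mem_of_invariant (S := {x}) (by rintro z rfl; exact e) rfl
    exact hyA (this ▸ hx)
  by_cases hex : ∃ c ∈ A, c ∉ ({a, G.inv a} : Finset H)
  · obtain ⟨c, hc, hca⟩ := hex
    have hsub2 : insert c (insert (G.inv c) {a, G.inv a}) ⊆ A := by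
      intro x hx
      simp only [Finset.mem_insert] at hx
      rcases hx with rfl | rfl | hx
      · exact hc
      · exact hA _ hc
      · exact hsub (by simpa using hx)
    have hcl : G.InvClosed {a, G.inv a} := by
      intro x hx
      simp only [Finset.mem_insert, Finset.mem_singleton] at hx ⊢
      rcases hx with rfl | rfl
      · exact Or.inr rfl
      · exact Or.inl (G.inv_inv a)
    have := Finset.card_le_card hsub2
    rw [card_insert_edge hcl hca] at this
    omega
  · exfalso
    push Not at hex
    rcases huni a ha with h | h
    · have := hex _ h
      simp only [Finset.mem_insert, Finset.mem_singleton, hG.rot_ne, false_or] at this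
      refine hfix _ (hA _ ha) ?_
      rw [Equiv.Perm.mul_apply, G.inv_inv, this]
    · have := hex _ h
      simp only [Finset.mem_insert, Finset.mem_singleton, hG.rot_rot_ne, false_or] at this
      refine hfix _ ha ?_
      rw [Equiv.Perm.mul_apply, ← this, hG.rot_rot_rot]

theorem foliationDim_empty : G.foliationDim ∅ = 0 := by
  rw [foliationDim, Submodule.finrank_eq_zero, Submodule.span_eq_bot]
  intro x hx
  funext h
  exact hx.2.1 h (by simp)

/-- A lower bound for stable connected subgraphs without univalent vertices extends to all
subgraphs. -/
theorem mul_foliationDim_le (hG : G.IsCubic) {s : ℝ} (hs0 : 0 ≤ s) (hs2 : s ≤ 2) {A₀ : Finset H}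
    (hface : ∀ C ∈ (G.rot * G.inv).cycles, ∃ x ∈ C, x ∉ A₀)
    (hmain : ∀ A ⊆ A₀, G.InvClosed A → A.Nonempty →
      (∀ h ∈ A, G.rot h ∈ A ∨ G.rot (G.rot h) ∈ A) → G.Indecomposable A →
      (∃ h ∈ A, G.rot h ∈ A ∧ G.rot (G.rot h) ∈ A) →
      s * Module.finrank ℝ (G.weightSpace A) ≤ A.card / 2) {A : Finset H} (hAA₀ : A ⊆ A₀)
    (hA : G.InvClosed A) : s * G.foliationDim A ≤ A.card / 2 := by
  induction hn : A.card using Nat.strong_induction_on generalizing A with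
  | _ n ih =>
  subst hn
  have hfaceA : ∀ C ∈ (G.rot * G.inv).cycles, ∃ x ∈ C, x ∉ A := fun C hC => by
    obtain ⟨x, hx, hxA⟩ := hface C hC
    exact ⟨x, hx, fun h => hxA (hAA₀ h)⟩
  rcases A.eq_empty_or_nonempty with rfl | hne
  · simp [foliationDim_empty]
  by_cases huni : ∀ h ∈ A, G.rot h ∈ A ∨ G.rot (G.rot h) ∈ A
  · by_cases hind : G.Indecomposable A
    · by_cases htri : ∃ h ∈ A, G.rot h ∈ A ∧ G.rot (G.rot h) ∈ A
      · refine le_trans ?_ (hmain A hAA₀ hA hne huni hind htri)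
        exact mul_le_mul_of_nonneg_left (by exact_mod_cast hG.foliationDim_le_finrank) hs0
      -- A circle: dimension at most `1` and at least two edges, which is where `s ≤ 2` is needed.
      · have h1 : G.foliationDim A ≤ 1 := hG.foliationDim_le_finrank.trans
          (hG.finrank_weightSpace_le_one hA hne hind (by push Not at htri; simpa using htri))
        have h4 := hG.four_le_card hA hne huni hfaceA
        have h1' : (G.foliationDim A : ℝ) ≤ 1 := by exact_mod_cast h1
        have h4' : (4 : ℝ) ≤ A.card := by exact_mod_cast h4
        nlinarith
    · unfold Indecomposable at hind
      push Not at hind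
      obtain ⟨B, hBA, hB, hadj, hB0, hB1⟩ := hind
      have hBc : B.card < A.card := Finset.card_lt_card (hBA.ssubset_of_ne hB1)
      have hcard : (A \ B).card + B.card = A.card := Finset.card_sdiff_add_card_eq_card hBA
      have hBpos : 0 < B.card := Finset.card_pos.2 hB0
      have hdiff : G.InvClosed (A \ B) := by
        intro h hh
        rw [Finset.mem_sdiff] at hh ⊢
        exact ⟨hA _ hh.1, fun e => hh.2 (hB.inv_mem_iff.1 e)⟩
      have i1 := ih _ hBc (hBA.trans hAA₀) hB rfl
      have i2 := ih (A \ B).card (by omega) (Finset.sdiff_subset.trans hAA₀) hdiff rfl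
      have hle : (G.foliationDim A : ℝ) ≤ G.foliationDim B + G.foliationDim (A \ B) := by
        exact_mod_cast hG.foliationDim_le_add hB hadj
      have hcard' : ((A \ B).card : ℝ) + B.card = A.card := by exact_mod_cast hcard
      have := mul_le_mul_of_nonneg_left hle hs0
      linarith
  · push Not at huni
    obtain ⟨a, ha, h1, h2⟩ := huni
    have hle := hG.foliationDim_le_of_univalent (A := A) h1 h2
    have hsub : (A.erase a).erase (G.inv a) ⊆ A :=
      (Finset.erase_subset _ _).trans (Finset.erase_subset _ _)
    have hlt : ((A.erase a).erase (G.inv a)).card < A.card :=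
      (Finset.card_le_card (Finset.erase_subset _ _)).trans_lt (Finset.card_erase_lt_of_mem ha)
    have hinv : G.InvClosed ((A.erase a).erase (G.inv a)) := by
      intro h hh
      simp only [Finset.mem_erase] at hh ⊢
      refine ⟨fun e => hh.2.1 (G.inv.injective e), fun e => hh.1 ?_, hA _ hh.2.2⟩
      rw [← e, G.inv_inv]
    have i1 := ih _ hlt (hsub.trans hAA₀) hinv rfl
    have hle' : (G.foliationDim A : ℝ) ≤ G.foliationDim ((A.erase a).erase (G.inv a)) := by
      exact_mod_cast hle
    have hlt' : (((A.erase a).erase (G.inv a)).card : ℝ) ≤ A.card := by exact_mod_cast hlt.le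
    have := mul_le_mul_of_nonneg_left hle' hs0
    linarith

theorem sStar_mul_foliationDim_le (hG : G.IsCubic) (hconn : G.Connected) {g : ℕ}
    (hg : G.HasGenus g) {A : Finset H} (hA : G.InvClosed A)
    (hface : ∀ C ∈ (G.rot * G.inv).cycles, ∃ x ∈ C, x ∉ A) :
    sStar g (Nat.card G.Face) * G.foliationDim A ≤ A.card / 2 := by
  have hs := sStar_nonneg_and_le_two g (Nat.card G.Face)
  refine hG.mul_foliationDim_le hs.1 hs.2 hface ?_ subset_rfl hA
  intro B hBA hB hne huni hind htri
  have hfaceB : ∀ C ∈ (G.rot * G.inv).cycles, ∃ x ∈ C, x ∉ B := fun C hC => by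
    obtain ⟨x, hx, hxA⟩ := hface C hC
    exact ⟨x, hx, fun h => hxA (hBA h)⟩
  have hE : ∀ h, h ∈ B ↔ G.edge h ∈ G.edge '' (B : Set H) := by
    intro h
    constructor
    · intro hh; exact ⟨h, hh, rfl⟩
    · rintro ⟨b, hb, e⟩
      rcases edge_eq_edge_iff.1 e with rfl | rfl
      · exact hb
      · exact hB _ hb
  have hcard := two_mul_card_edgeSet hE
  have hw := finrank_weightSpace_add_card hG hE huni hind htri
  have hpos : 1 ≤ Module.finrank ℝ (G.weightSpace B) :=
    (one_le_foliationDim hB hne huni).trans hG.foliationDim_le_finrank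
  obtain ⟨k, j, hk1, hkd, heq, hle⟩ := hG.subgraph_constraints hconn hfaceB hB hne huni
  rw [hG.hasGenus_iff] at hg
  -- Substituting the genus relation, the rank is `6g - 6 + 3k - 6j`, a multiple of `3`.
  obtain ⟨χ, hχ⟩ : ∃ χ : ℕ, Module.finrank ℝ (G.weightSpace B) = 3 * χ :=
    ⟨Module.finrank ℝ (G.weightSpace B) / 3, by omega⟩
  have := sStar_mul_le (g := g) (n := Nat.card G.Face) (χ := χ) (k := k) (j := j)
    (d := (G.corners B).card) (by omega) hk1 hkd (by omega) (by omega)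
  rw [hχ]
  have h2 : (B.card : ℝ) = 2 * (3 * χ + (G.corners B).card) := by
    have : B.card = 2 * (3 * χ + (G.corners B).card) := by omega
    exact_mod_cast this
  rw [h2]
  push_cast
  linarith

end IsCubic

/-- The half-edges of a set of edges. -/
noncomputable def halfEdges (G : RibbonGraph H) (E' : Set G.Edge) : Finset H := by
  classical exact {h | G.edge h ∈ E'}

theorem mem_halfEdges {G : RibbonGraph H} {E' : Set G.Edge} {h : H} :
    h ∈ G.halfEdges E' ↔ G.edge h ∈ E' := by
  simp [halfEdges]

theorem invClosed_halfEdges (G : RibbonGraph H) (E' : Set G.Edge) :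
    G.InvClosed (G.halfEdges E') := by
  intro h hh
  rw [mem_halfEdges] at hh ⊢
  rwa [edge_inv]

theorem IsCubic.sHat_restrict {G : RibbonGraph H} (hG : G.IsCubic) (E' : Set G.Edge)
    [Fintype {h : H // G.edge h ∈ E'}] :
    (G.restrict E').sHat =
      (Nat.card E' : ℝ≥0∞) / (G.foliationDim (G.halfEdges E') : ℝ≥0∞) := by
  classical
  have h1 := (G.restrict E').two_mul_card_edge
  have h2 := two_mul_card_edgeSet (G := G) (E' := E') (fun h => mem_halfEdges)
  have h3 : Fintype.card {h : H // G.edge h ∈ E'} = (G.halfEdges E').card := by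
    rw [Fintype.card_subtype, halfEdges]
  have h4 : Nat.card (G.restrict E').Edge = Nat.card E' := by omega
  rw [sHat, h4, hG.polyhedralDim_MFBullet_restrict (A := G.halfEdges E')
    (fun h => mem_halfEdges)]
  rfl

theorem perimeter_eq_of_mem_closure_cell {G : RibbonGraph H} {n : ℕ} {lab : Fin n ≃ G.Face}
    {L : Fin n → ℝ} {l : G.Edge → ℝ} (hl : l ∈ closure (G.cell lab L)) (i : Fin n) :
    G.perimeter l (lab i) = L i := by
  have hcl : IsClosed {l : G.Edge → ℝ | G.perimeter l (lab i) = L i} := by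
    refine isClosed_eq ?_ continuous_const
    unfold perimeter
    fun_prop
  exact closure_minimal (fun l hl => hl.2 i) hcl hl

theorem ofReal_sStar_le_of_mem_sHatValues {g n : ℕ} {L : Fin n → ℝ} (hL : ∀ i, 0 < L i) {s : ℝ≥0∞}
    (hs : s ∈ sHatValues g n L) : ENNReal.ofReal (sStar g n) ≤ s := by
  classical
  obtain ⟨H, _, G, lab, hconn, htri, hgen, lam, hlam, E', hne, hE', rfl⟩ := hs
  have hG := htri.isCubic
  have hn : Nat.card G.Face = n := by
    rw [← Nat.card_congr lab, Nat.card_eq_fintype_card, Fintype.card_fin]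
  -- A face lying entirely in `E'` would have perimeter zero.
  have hface : ∀ C ∈ (G.rot * G.inv).cycles, ∃ x ∈ C, x ∉ G.halfEdges E' := by
    intro C hC
    by_contra! hcon
    obtain ⟨a, rfl⟩ := Equiv.Perm.mem_cycles.1 hC
    obtain ⟨i, hi⟩ := lab.surjective (G.face a)
    have h1 := perimeter_eq_of_mem_closure_cell hlam.1 i
    rw [hi, perimeter, Finset.sum_eq_zero] at h1
    · exact (hL i).ne h1
    · intro h hh
      rw [Finset.mem_filter] at hh
      have := hcon h (Equiv.Perm.mem_cyc.2 (face_eq_face_iff.1 hh.2.symm))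
      exact hE' (mem_halfEdges.1 this)
  have key := hG.sStar_mul_foliationDim_le hconn hgen (G.invClosed_halfEdges E') hface
  rw [hn] at key
  have h2 := two_mul_card_edgeSet (G := G) (E' := E') (fun h => mem_halfEdges)
  have h2' : ((G.halfEdges E').card : ℝ) / 2 = Nat.card E' := by
    rw [← h2]; push_cast; ring
  rw [h2'] at key
  have hEpos : Nat.card E' ≠ 0 := by
    have : Nonempty E' := hne.to_subtype
    exact Nat.card_pos.ne'
  rw [hG.sHat_restrict]
  rw [ENNReal.le_div_iff_mul_le (Or.inr (by exact_mod_cast hEpos)) (Or.inl (ENNReal.natCast_ne_top _))]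
  rw [← ENNReal.ofReal_natCast, ← ENNReal.ofReal_mul (sStar_nonneg_and_le_two g n).1,
    ← ENNReal.ofReal_natCast]
  exact ENNReal.ofReal_le_ofReal key

end RibbonGraph

/-! ### Trivalent ribbon graphs with legs -/

section Legged

open Equiv Equiv.Perm Function

/-- Connected trivalent ribbon graphs with legs: the fixed points of `inv` are the legs, and the
faces are labelled by natural numbers. -/
structure IsLegged {H : Type} (rot inv : Perm H) (lab : H → ℕ) : Prop where
  rot_rot_rot : ∀ h, rot (rot (rot h)) = h
  rot_ne : ∀ h, rot h ≠ h
  inv_inv : ∀ h, inv (inv h) = h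
  lab_eq_iff : ∀ x y, lab x = lab y ↔ (rot * inv).SameCycle x y
  conn : ∀ P : H → Prop, (∀ x, P (rot x) ↔ P x) → (∀ x, P (inv x) ↔ P x) → ∀ x y, P x ↔ P y

theorem Equiv.Perm.sameCycle_mul_swap_iff {α : Type*} [Fintype α] [DecidableEq α] {f : Perm α}
    {a b x y : α} (hab : ¬ f.SameCycle a b) :
    (f * swap a b).SameCycle x y ↔ f.SameCycle x y ∨
      ((f.SameCycle a x ∨ f.SameCycle b x) ∧ (f.SameCycle a y ∨ f.SameCycle b y)) := by
  have key : ∀ z, (f * swap a b).SameCycle a z ↔ f.SameCycle a z ∨ f.SameCycle b z := by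
    intro z
    rw [← mem_cyc, cyc_mul_swap hab, Finset.mem_union, mem_cyc, mem_cyc]
  by_cases hx : f.SameCycle a x ∨ f.SameCycle b x
  · have hax := (key x).2 hx
    have h1 : (f * swap a b).SameCycle x y ↔ (f * swap a b).SameCycle a y :=
      ⟨fun h => hax.trans h, fun h => hax.symm.trans h⟩
    rw [h1, key]
    refine ⟨fun h => Or.inr ⟨hx, h⟩, ?_⟩
    rintro (h | h)
    · exact hx.imp (fun e => e.trans h) (fun e => e.trans h)
    · exact h.2
  · rw [sameCycle_mul_swap_of_not (fun h => hx (Or.inl h.symm)) (fun h => hx (Or.inr h.symm))]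
    tauto

section SumPerm

variable {α β : Type*} [Fintype α] [Fintype β] (f : Perm α) (g : Perm β)

theorem sumCongr_pow_inl (n : ℕ) (x : α) :
    ((Perm.sumCongr f g : Perm (α ⊕ β)) ^ n) (Sum.inl x) = Sum.inl ((f ^ n) x) := by
  induction n with
  | zero => rfl
  | succ n ih => rw [pow_succ', Perm.mul_apply, ih, pow_succ', Perm.mul_apply]; rfl

theorem sumCongr_pow_inr (n : ℕ) (x : β) :
    ((Perm.sumCongr f g : Perm (α ⊕ β)) ^ n) (Sum.inr x) = Sum.inr ((g ^ n) x) := by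
  induction n with
  | zero => rfl
  | succ n ih => rw [pow_succ', Perm.mul_apply, ih, pow_succ', Perm.mul_apply]; rfl

theorem sameCycle_sumCongr_inl_inl {x y : α} :
    (Perm.sumCongr f g : Perm (α ⊕ β)).SameCycle (Sum.inl x) (Sum.inl y) ↔ f.SameCycle x y := by
  constructor
  · intro h
    obtain ⟨n, hn⟩ := h.exists_nat_pow
    rw [sumCongr_pow_inl] at hn
    exact ⟨n, by rw [zpow_natCast]; exact Sum.inl_injective hn⟩
  · intro h
    obtain ⟨n, hn⟩ := h.exists_nat_pow
    exact ⟨n, by rw [zpow_natCast, sumCongr_pow_inl, hn]⟩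

theorem sameCycle_sumCongr_inr_inr {x y : β} :
    (Perm.sumCongr f g : Perm (α ⊕ β)).SameCycle (Sum.inr x) (Sum.inr y) ↔ g.SameCycle x y := by
  constructor
  · intro h
    obtain ⟨n, hn⟩ := h.exists_nat_pow
    rw [sumCongr_pow_inr] at hn
    exact ⟨n, by rw [zpow_natCast]; exact Sum.inr_injective hn⟩
  · intro h
    obtain ⟨n, hn⟩ := h.exists_nat_pow
    exact ⟨n, by rw [zpow_natCast, sumCongr_pow_inr, hn]⟩

theorem not_sameCycle_sumCongr_inl_inr {x : α} {y : β} :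
    ¬ (Perm.sumCongr f g : Perm (α ⊕ β)).SameCycle (Sum.inl x) (Sum.inr y) := by
  intro h
  obtain ⟨n, hn⟩ := h.exists_nat_pow
  rw [sumCongr_pow_inl] at hn
  simp at hn

end SumPerm

variable {H K : Type} [DecidableEq H] [DecidableEq K]

/-- Gluing two legs. -/
def joinInv (inv : Perm H) (inv' : Perm K) (a : H) (b : K) : Perm (H ⊕ K) :=
  Perm.sumCongr inv inv' * Equiv.swap (Sum.inl a) (Sum.inr b)

section

variable {inv : Perm H} {inv' : Perm K} {a : H} {b : K}

theorem joinInv_inl_self (hb : inv' b = b) : joinInv inv inv' a b (Sum.inl a) = Sum.inr b := by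
  simp [joinInv, hb]

theorem joinInv_inr_self (ha : inv a = a) : joinInv inv inv' a b (Sum.inr b) = Sum.inl a := by
  simp [joinInv, ha]

theorem joinInv_inl {x : H} (hx : x ≠ a) :
    joinInv inv inv' a b (Sum.inl x) = Sum.inl (inv x) := by
  rw [joinInv, Perm.mul_apply, swap_apply_of_ne_of_ne (by simpa using hx) (by simp)]
  rfl

theorem joinInv_inr {y : K} (hy : y ≠ b) :
    joinInv inv inv' a b (Sum.inr y) = Sum.inr (inv' y) := by
  rw [joinInv, Perm.mul_apply, swap_apply_of_ne_of_ne (by simp) (by simpa using hy)]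
  rfl

end

variable [Fintype H] [Fintype K]

/-- Gluing multiplies the face permutation of the disjoint union by the transposition of the two
legs. These lie on different cycles, so exactly their two faces merge. The hypothesis `hdisj` says
that no other labels coincide. -/
theorem IsLegged.join {rot inv : Perm H} {lab : H → ℕ} {rot' inv' : Perm K} {lab' : K → ℕ}
    (hX : IsLegged rot inv lab) (hY : IsLegged rot' inv' lab') {a : H} {b : K}
    (ha : inv a = a) (hb : inv' b = b) (hab : lab a = lab' b)
    (hdisj : ∀ x y, lab x = lab' y → lab x = lab a) :
    IsLegged (Perm.sumCongr rot rot') (joinInv inv inv' a b) (Sum.elim lab lab') where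
  rot_rot_rot := by
    rintro (h | h)
    · simp [hX.rot_rot_rot]
    · simp [hY.rot_rot_rot]
  rot_ne := by
    rintro (h | h)
    · simp [hX.rot_ne]
    · simp [hY.rot_ne]
  inv_inv := by
    rintro (h | h)
    · by_cases e : h = a
      · subst e
        rw [joinInv_inl_self hb, joinInv_inr_self ha]
      · have : inv h ≠ a := fun e' => e (by rw [← hX.inv_inv h, e', ha])
        rw [joinInv_inl e, joinInv_inl this, hX.inv_inv]
    · by_cases e : h = b
      · subst e
        rw [joinInv_inr_self ha, joinInv_inl_self hb]
      · have : inv' h ≠ b := fun e' => e (by rw [← hY.inv_inv h, e', hb])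
        rw [joinInv_inr e, joinInv_inr this, hY.inv_inv]
  lab_eq_iff := by
    have hmul : (Perm.sumCongr rot rot' : Perm (H ⊕ K)) * joinInv inv inv' a b =
        (Perm.sumCongr (rot * inv) (rot' * inv') : Perm (H ⊕ K)) *
          Equiv.swap (Sum.inl a) (Sum.inr b) := by
      rw [joinInv, ← mul_assoc]
      congr 1
      ext z
      rcases z with z | z <;> rfl
    intro x y
    rw [hmul, sameCycle_mul_swap_iff (not_sameCycle_sumCongr_inl_inr _ _)]
    have hn : ∀ x y, ¬ (Perm.sumCongr (rot * inv) (rot' * inv') : Perm (H ⊕ K)).SameCycle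
        (Sum.inr y) (Sum.inl x) := fun x y h => not_sameCycle_sumCongr_inl_inr _ _ h.symm
    rcases x with x | x <;> rcases y with y | y <;>
      simp only [sameCycle_sumCongr_inl_inl, sameCycle_sumCongr_inr_inr,
        not_sameCycle_sumCongr_inl_inr, hn, Sum.elim_inl, Sum.elim_inr, ← hX.lab_eq_iff,
        ← hY.lab_eq_iff, false_or, or_false]
    · refine ⟨fun h => Or.inl h, ?_⟩
      rintro (h | ⟨h1, h2⟩)
      · exact h
      · rw [← h1, h2]
    · refine ⟨fun h => ?_, fun ⟨h1, h2⟩ => by rw [← h1, hab, h2]⟩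
      have := hdisj x y h
      exact ⟨this.symm, by rw [← hab, ← this, h]⟩
    · refine ⟨fun h => ?_, fun ⟨h1, h2⟩ => by rw [← h1, ← hab, h2]⟩
      have := hdisj y x h.symm
      exact ⟨by rw [← hab, ← this, h], this.symm⟩
    · refine ⟨fun h => Or.inl h, ?_⟩
      rintro (h | ⟨h1, h2⟩)
      · exact h
      · rw [← h1, h2]
  conn := by
    intro P hr hi
    have h1 : ∀ x y, P (Sum.inl x) ↔ P (Sum.inl y) :=
      hX.conn (fun x => P (Sum.inl x)) (fun x => hr (Sum.inl x)) fun x => by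
        by_cases e : x = a
        · rw [e, ha]
        · rw [← hi (Sum.inl x), joinInv_inl e]
    have h2 : ∀ x y, P (Sum.inr x) ↔ P (Sum.inr y) :=
      hY.conn (fun x => P (Sum.inr x)) (fun x => hr (Sum.inr x)) fun x => by
        by_cases e : x = b
        · rw [e, hb]
        · rw [← hi (Sum.inr x), joinInv_inr e]
    have h3 : P (Sum.inl a) ↔ P (Sum.inr b) := by
      rw [← hi (Sum.inl a), joinInv_inl_self hb]
    rintro (x | x) (y | y)
    · exact h1 x y
    · rw [h1 x a, h3]; exact h2 b y
    · rw [h1 y a, h3]; exact h2 x b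
    · exact h2 x y

theorem joinInv_eq_self_iff {inv : Perm H} {inv' : Perm K} {a : H} {b : K} (ha : inv a = a)
    (hb : inv' b = b) (hleg : ∀ x, inv x = x → x = a) {z : H ⊕ K}
    (hz : joinInv inv inv' a b z = z) : ∃ y, z = Sum.inr y ∧ inv' y = y ∧ y ≠ b := by
  rcases z with x | y
  · by_cases e : x = a
    · subst e
      rw [joinInv_inl_self hb] at hz
      simp at hz
    · rw [joinInv_inl e] at hz
      exact absurd (hleg x (Sum.inl_injective hz)) e
  · by_cases e : y = b
    · subst e
      rw [joinInv_inr_self ha] at hz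
      simp at hz
    · rw [joinInv_inr e] at hz
      exact ⟨y, rfl, Sum.inr_injective hz, e⟩

/-- Criterion for an explicit graph on few half-edges. -/
theorem IsLegged.of_fin {n : ℕ} {ι : Type} {rot inv : Perm (Fin (n + 1))} {c : Fin (n + 1) → ι}
    (h1 : ∀ h, rot (rot (rot h)) = h) (h2 : ∀ h, rot h ≠ h) (h3 : ∀ h, inv (inv h) = h)
    (h4 : ∀ h, c (rot (inv h)) = c h)
    (h5 : ∀ x y, c x = c y → ∃ k : Fin (n + 1), (fun z => rot (inv z))^[k] x = y)
    (h6 : ∀ y, y = 0 ∨ ∃ x < y, y = rot x ∨ y = rot (rot x) ∨ y = inv x ∨ y = rot (inv x) ∨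
      y = rot (rot (inv x)))
    {lab : ι → ℕ} (hlab : Injective lab) : IsLegged rot inv (fun h => lab (c h)) where
  rot_rot_rot := h1
  rot_ne := h2
  inv_inv := h3
  lab_eq_iff x y := by
    rw [hlab.eq_iff]
    constructor
    · intro h
      obtain ⟨k, hk⟩ := h5 x y h
      refine ⟨k, ?_⟩
      rw [zpow_natCast, ← Perm.iterate_eq_pow]
      exact hk
    · intro h
      exact (h.mem_of_invariant (S := {z | c x = c z})
        (fun z hz => Eq.trans hz (h4 z).symm) rfl)
  -- By `h6`, every half-edge other than `0` is reached in at most three moves from one of smaller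
  -- index.
  conn P hr hi := by
    have key : ∀ y, P y ↔ P 0 := by
      intro y
      induction y using WellFoundedLT.induction with
      | ind y ih =>
      rcases h6 y with rfl | ⟨x, hx, h | h | h | h | h⟩
      · rfl
      · rw [h, hr]; exact ih x hx
      · rw [h, hr, hr]; exact ih x hx
      · rw [h, hi]; exact ih x hx
      · rw [h, hr, hi]; exact ih x hx
      · rw [h, hr, hr, hi]; exact ih x hx
    intro x y
    rw [key x, key y]

/-- The length of the face with a given label. -/
def labelLength {H : Type} [Fintype H] (lab : H → ℕ) (m : H → ℝ) (i : ℕ) : ℝ :=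
  ∑ h, if lab h = i then m h else 0

theorem labelLength_sum (lab : H → ℕ) (lab' : K → ℕ) (m : H → ℝ) (m' : K → ℝ) (i : ℕ) :
    labelLength (Sum.elim lab lab') (Sum.elim m m') i =
      labelLength lab m i + labelLength lab' m' i := by
  rw [labelLength, labelLength, labelLength, Fintype.sum_sum_type]
  rfl

theorem labelLength_eq_zero {lab : H → ℕ} {i : ℕ} (h : ∀ x, lab x ≠ i) (m : H → ℝ) :
    labelLength lab m i = 0 := by
  simp [labelLength, h]

theorem labelLength_update {lab : H → ℕ} {i : ℕ} {a : H} (m : H → ℝ) (r : ℝ) (h : lab a = i) :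
    labelLength lab (Function.update m a r) i = labelLength lab m i - m a + r := by
  unfold labelLength
  rw [← Finset.add_sum_erase _ _ (Finset.mem_univ a), ← Finset.add_sum_erase _ (fun h =>
    if lab h = i then m h else 0) (Finset.mem_univ a)]
  have : ∑ x ∈ Finset.univ.erase a, (if lab x = i then Function.update m a r x else 0) =
      ∑ x ∈ Finset.univ.erase a, (if lab x = i then m x else 0) := by
    refine Finset.sum_congr rfl fun x hx => ?_
    rw [Function.update_of_ne (Finset.ne_of_mem_erase hx)]
  rw [this]
  simp only [h, if_true, Function.update_self]
  ring

theorem labelLength_update_of_ne {lab : H → ℕ} {i : ℕ} {a : H} (m : H → ℝ) (r : ℝ)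
    (h : lab a ≠ i) : labelLength lab (Function.update m a r) i = labelLength lab m i := by
  unfold labelLength
  refine Finset.sum_congr rfl fun x _ => ?_
  by_cases e : x = a
  · subst e; simp [h]
  · rw [Function.update_of_ne e]

/-- Gluing metrics which agree on the glued legs. -/
theorem sumElim_joinInv {inv : Perm H} {inv' : Perm K} {a : H} {b : K} (ha : inv a = a)
    (hb : inv' b = b) {m : H → ℝ} {m' : K → ℝ} (hm : ∀ h, m (inv h) = m h)
    (hm' : ∀ h, m' (inv' h) = m' h) (hab : m a = m' b) (z : H ⊕ K) :
    Sum.elim m m' (joinInv inv inv' a b z) = Sum.elim m m' z := by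
  rcases z with x | y
  · by_cases e : x = a
    · subst e; rw [joinInv_inl_self hb]; exact hab.symm
    · rw [joinInv_inl e]; exact hm x
  · by_cases e : y = b
    · subst e; rw [joinInv_inr_self ha]; exact hab
    · rw [joinInv_inr e]; exact hm' y

/-- The half-edges outside `A` at bivalent vertices, in terms of the rotation only. -/
def cornerSet {H : Type} [Fintype H] [DecidableEq H] (rot : Perm H) (A : Finset H) : Finset H :=
  {h | h ∉ A ∧ rot h ∈ A ∧ rot (rot h) ∈ A}

theorem mem_cornerSet {rot : Perm H} {A : Finset H} {h : H} :
    h ∈ cornerSet rot A ↔ h ∉ A ∧ rot h ∈ A ∧ rot (rot h) ∈ A := by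
  simp [cornerSet]

theorem cornerSet_disjSum (rot : Perm H) (rot' : Perm K) (A : Finset H) (B : Finset K) :
    cornerSet (Perm.sumCongr rot rot') (A.disjSum B) =
      (cornerSet rot A).disjSum (cornerSet rot' B) := by
  ext (x | x) <;> simp [mem_cornerSet]

/-- Deleting a half-edge at a trivalent vertex makes this vertex bivalent, with corner `a`; no other
vertex is affected. -/
theorem cornerSet_erase {rot : Perm H} {A : Finset H} {a : H}
    (h3 : ∀ h, rot (rot (rot h)) = h) (h1 : ∀ h, rot h ≠ h) (h0 : a ∈ A) (ha : rot a ∈ A)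
    (ha' : rot (rot a) ∈ A) : cornerSet rot (A.erase a) = insert a (cornerSet rot A) := by
  have h2 : ∀ h, rot (rot h) ≠ h := fun h e => h1 h (by have := h3 h; rwa [e] at this)
  ext x
  simp only [mem_cornerSet, Finset.mem_erase, Finset.mem_insert]
  constructor
  · rintro ⟨e0, ⟨e1, e1'⟩, e2, e2'⟩
    by_cases hx : x = a
    · exact Or.inl hx
    · exact Or.inr ⟨fun h => e0 ⟨hx, h⟩, e1', e2'⟩
  · rintro (rfl | ⟨e0, e1, e2⟩)
    · exact ⟨fun h => h.1 rfl, ⟨h1 _, ha⟩, h2 _, ha'⟩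
    · refine ⟨fun h => e0 h.2, ⟨fun e => e0 ?_, e1⟩, fun e => e0 ?_, e2⟩
      · rw [← h3 x, e]; exact ha'
      · rw [← h3 x, e]; exact ha

end Legged

/-! ### Building blocks and the families glued from them. -/

section Families

open Equiv Equiv.Perm Function

/-- The rotation of one trivalent vertex. -/
def rot3 : Perm (Fin 3) := ⟨![1, 2, 0], ![2, 0, 1], by decide, by decide⟩

/-- The rotation of two trivalent vertices. -/
def rot6 : Perm (Fin 6) := ⟨![1, 2, 0, 4, 5, 3], ![2, 0, 1, 5, 3, 4], by decide, by decide⟩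

/-- The rotation of three trivalent vertices. -/
def rot9 : Perm (Fin 9) :=
  ⟨![1, 2, 0, 4, 5, 3, 7, 8, 6], ![2, 0, 1, 5, 3, 4, 8, 6, 7], by decide, by decide⟩

/-- The rotation of four trivalent vertices. -/
def rot12 : Perm (Fin 12) :=
  ⟨![1, 2, 0, 4, 5, 3, 7, 8, 6, 10, 11, 9], ![2, 0, 1, 5, 3, 4, 8, 6, 7, 11, 9, 10],
    by decide, by decide⟩

/-- A vertex with a loop and a leg. -/
def invLoop : Perm (Fin 3) := ⟨![0, 2, 1], ![0, 2, 1], by decide, by decide⟩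

/-- A circle with one leg on each side. -/
def invCircle : Perm (Fin 6) := ⟨![0, 4, 5, 3, 1, 2], ![0, 4, 5, 3, 1, 2], by decide, by decide⟩

/-- The theta graph on a torus with one face. -/
def invTheta : Perm (Fin 6) := ⟨![3, 4, 5, 0, 1, 2], ![3, 4, 5, 0, 1, 2], by decide, by decide⟩

/-- The theta graph on a torus, with a leg. -/
def invTorus : Perm (Fin 9) :=
  ⟨![6, 4, 5, 7, 1, 2, 0, 3, 8], ![6, 4, 5, 7, 1, 2, 0, 3, 8], by decide, by decide⟩

/-- The theta graph on a torus attached to a vertex with two legs. -/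
def invTorusBlock : Perm (Fin 12) :=
  ⟨![6, 4, 5, 7, 1, 2, 0, 3, 11, 9, 10, 8], ![6, 4, 5, 7, 1, 2, 0, 3, 11, 9, 10, 8],
    by decide, by decide⟩

/-- A circle with a leg outside, and a loop attached inside. -/
def invDisc : Perm (Fin 9) :=
  ⟨![3, 2, 1, 0, 7, 8, 6, 4, 5], ![3, 2, 1, 0, 7, 8, 6, 4, 5], by decide, by decide⟩

/-- A circle with a leg outside, attached inside to a vertex with a leg and a pendant loop. -/
def invAnnulus : Perm (Fin 12) :=
  ⟨![6, 1, 3, 2, 5, 4, 0, 10, 11, 9, 7, 8], ![6, 1, 3, 2, 5, 4, 0, 10, 11, 9, 7, 8],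
    by decide, by decide⟩

theorem injective_add_fin (s : ℕ) {k : ℕ} : Injective fun i : Fin k => s + (i : ℕ) :=
  fun _ _ h => Fin.ext (Nat.add_left_cancel h)

theorem isLegged_theta : IsLegged rot6 invTheta fun _ => 0 :=
  IsLegged.of_fin (c := fun _ => ()) (by decide) (by decide) (by decide) (by decide) (by decide)
    (by decide) (lab := fun _ => 0) (injective_of_subsingleton _)

theorem isLegged_torus : IsLegged rot9 invTorus fun _ => 0 :=
  IsLegged.of_fin (c := fun _ => ()) (by decide) (by decide) (by decide) (by decide) (by decide)
    (by decide) (lab := fun _ => 0) (injective_of_subsingleton _)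

theorem isLegged_torusBlock : IsLegged rot12 invTorusBlock fun _ => 0 :=
  IsLegged.of_fin (c := fun _ => ()) (by decide) (by decide) (by decide) (by decide) (by decide)
    (by decide) (lab := fun _ => 0) (injective_of_subsingleton _)

theorem isLegged_loop (s : ℕ) :
    IsLegged rot3 invLoop fun h => s + ((![0, 0, 1] : Fin 3 → Fin 2) h : ℕ) :=
  IsLegged.of_fin (by decide) (by decide) (by decide) (by decide) (by decide)
    (by decide) (lab := fun i : Fin 2 => s + (i : ℕ)) (injective_add_fin s)

theorem isLegged_circle (s : ℕ) :
    IsLegged rot6 invCircle fun h => s + ((![0, 0, 1, 1, 1, 0] : Fin 6 → Fin 2) h : ℕ) :=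
  IsLegged.of_fin (by decide) (by decide) (by decide) (by decide) (by decide)
    (by decide) (lab := fun i : Fin 2 => s + (i : ℕ)) (injective_add_fin s)

theorem isLegged_disc (s : ℕ) :
    IsLegged rot9 invDisc fun h => s + ((![0, 0, 1, 0, 0, 2, 2, 2, 0] : Fin 9 → Fin 3) h : ℕ) :=
  IsLegged.of_fin (by decide) (by decide) (by decide) (by decide) (by decide)
    (by decide) (lab := fun i : Fin 3 => s + (i : ℕ)) (injective_add_fin s)

theorem isLegged_annulus (s : ℕ) :
    IsLegged rot12 invAnnulus
      fun h => s + ((![0, 0, 0, 0, 0, 1, 0, 0, 2, 2, 2, 0] : Fin 12 → Fin 3) h : ℕ) :=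
  IsLegged.of_fin (by decide) (by decide) (by decide) (by decide) (by decide)
    (by decide) (lab := fun i : Fin 3 => s + (i : ℕ)) (injective_add_fin s)

/-- One-faced graphs of any positive genus, with one leg. -/
theorem exists_torus (g : ℕ) : ∃ (H : Type) (_ : Fintype H) (_ : DecidableEq H)
    (rot inv : Perm H) (a : H), IsLegged rot inv (fun _ => 0) ∧ inv a = a ∧
      (∀ x, inv x = x → x = a) ∧ Fintype.card H = 12 * g + 9 := by
  induction g with
  | zero => exact ⟨Fin 9, inferInstance, inferInstance, rot9, invTorus, 8, isLegged_torus,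
      by decide, by decide, rfl⟩
  | succ g ih =>
    obtain ⟨H, _, _, rot, inv, a, hX, ha, hleg, hcard⟩ := ih
    -- The block has the legs `9` and `10`. The first is glued to the previous graph, the second
    -- becomes the new leg, and one handle is added.
    refine ⟨H ⊕ Fin 12, inferInstance, inferInstance, Perm.sumCongr rot rot12,
      joinInv inv invTorusBlock a 9, Sum.inr 10, ?_, ?_, ?_, ?_⟩
    · have := hX.join isLegged_torusBlock (a := a) (b := 9) ha (by decide) rfl (fun _ _ _ => rfl)
      convert this using 1
      ext (x | x) <;> rfl
    · rw [joinInv_inr (by decide)]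
      rfl
    · intro z hz
      obtain ⟨y, rfl, hy, hyb⟩ := joinInv_eq_self_iff ha (by decide) hleg hz
      congr 1
      clear hz
      revert y
      decide
    · rw [Fintype.card_sum, hcard, Fintype.card_fin]
      ring

/-- Nested circles: a planar graph with one leg realising given decreasing perimeters. -/
theorem exists_chain (r : ℕ) : ∀ s : ℕ, ∃ (H : Type) (_ : Fintype H) (_ : DecidableEq H)
    (rot inv : Perm H) (lab : H → ℕ) (a : H), IsLegged rot inv lab ∧ inv a = a ∧
      (∀ x, inv x = x → x = a) ∧ lab a = s ∧ (∀ x, s ≤ lab x ∧ lab x < s + (r + 2)) ∧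
      Fintype.card H = 6 * r + 3 ∧
      ∀ p : ℕ → ℝ, (∀ i, s ≤ i → i < s + (r + 2) → 0 < p i) →
        (∀ i, s ≤ i → i + 1 < s + (r + 2) → p (i + 1) < p i) →
        ∃ m : H → ℝ, (∀ x, 0 < m x) ∧ (∀ x, m (inv x) = m x) ∧
          (∀ i, s < i → i < s + (r + 2) → labelLength lab m i = p i) ∧
          labelLength lab m s + m a = p s := by
  induction r with
  | zero =>
    intro s
    refine ⟨Fin 3, inferInstance, inferInstance, rot3, invLoop, _, 0, isLegged_loop s, by decide,
      by decide, rfl, ?_, rfl, ?_⟩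
    · intro x
      fin_cases x <;> simp
    · intro p hp hanti
      have h0 := hanti s le_rfl (by omega)
      have h1 := hp (s + 1) (by omega) (by omega)
      -- The loop has length `p (s + 1)`. The leg has both sides on face `s` once glued, hence the
      -- extra term `m a` in the statement and the factor `1/2` here.
      refine ⟨![(p s - p (s + 1)) / 2, p (s + 1), p (s + 1)], ?_, ?_, ?_, ?_⟩
      · intro x
        fin_cases x
        · simpa using h0
        · exact h1
        · exact h1
      · intro x
        fin_cases x <;> rfl
      · intro i hi hi'
        obtain rfl : i = s + 1 := by omega
        simp [labelLength, Fin.sum_univ_succ]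
      · simp [labelLength, Fin.sum_univ_succ]
        ring
  | succ r ih =>
    intro s
    obtain ⟨H, _, _, rot, inv, lab, a, hX, ha, hleg, hlab, hrange, hcard, hm⟩ := ih (s + 1)
    refine ⟨H ⊕ Fin 6, inferInstance, inferInstance, Perm.sumCongr rot rot6,
      joinInv inv invCircle a 3, _, Sum.inr 0,
      hX.join (isLegged_circle s) (a := a) (b := 3) ha (by decide) ?_ ?_, ?_, ?_, ?_, ?_, ?_, ?_⟩
    · rw [hlab]; rfl
    · intro x y h
      have h1 := (hrange x).1
      have h2 : ((![0, 0, 1, 1, 1, 0] : Fin 6 → Fin 2) y : ℕ) < 2 := Fin.is_lt _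
      omega
    · rw [joinInv_inr (by decide)]
      rfl
    · intro z hz
      obtain ⟨y, rfl, hy, hyb⟩ := joinInv_eq_self_iff ha (by decide) hleg hz
      congr 1
      clear hz
      revert y
      decide
    · rfl
    · rintro (x | x)
      · have := hrange x
        simp only [Sum.elim_inl]
        omega
      · have h2 : ((![0, 0, 1, 1, 1, 0] : Fin 6 → Fin 2) x : ℕ) < 2 := Fin.is_lt _
        simp only [Sum.elim_inr]
        omega
    · rw [Fintype.card_sum, hcard, Fintype.card_fin]
      ring
    · intro p hp hanti
      have p1 := hp (s + 1) (by omega) (by omega)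
      have p2 := hp (s + 2) (by omega) (by omega)
      have a0 := hanti s le_rfl (by omega)
      have a1 := hanti (s + 1) (by omega) (by omega)
      -- The inner graph receives the midpoint of `p (s + 1)` and `p (s + 2)`, which still exceeds
      -- `p (s + 2)`.
      obtain ⟨m, hpos, hinv, hlen, hout⟩ := hm
        (Function.update p (s + 1) ((p (s + 1) + p (s + 2)) / 2)) (fun i hi hi' => by
          rcases hi.eq_or_lt with rfl | hi
          · rw [Function.update_self]; linarith
          · rw [Function.update_of_ne (by omega)]; exact hp i (by omega) (by omega))
        (fun i hi hi' => by
          rw [Function.update_of_ne (by omega) _ (f := p)]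
          rcases hi.eq_or_lt with rfl | hi
          · rw [Function.update_self]; linarith
          · rw [Function.update_of_ne (by omega)]; exact hanti i (by omega) (by omega))
      rw [Function.update_self] at hout
      -- The two edges of the new circle supply the missing half of the gap on face `s + 1`.
      set q : ℝ := (p (s + 1) - p (s + 2)) / 4 with hq
      have hq0 : 0 < q := by rw [hq]; linarith
      refine ⟨Sum.elim m ![(p s - 2 * q) / 2, q, q, m a, q, q], ?_, ?_, ?_, ?_⟩
      · rintro (x | x)
        · exact hpos x
        · fin_cases x
          · change 0 < (p s - 2 * q) / 2
            rw [hq]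
            linarith
          · exact hq0
          · exact hq0
          · exact hpos a
          · exact hq0
          · exact hq0
      · refine sumElim_joinInv ha (by decide) hinv ?_ rfl
        intro x
        fin_cases x <;> rfl
      · intro i hi hi'
        rw [labelLength_sum]
        by_cases e : i = s + 1
        · subst e
          have : labelLength (fun h => s + ((![0, 0, 1, 1, 1, 0] : Fin 6 → Fin 2) h : ℕ))
              ![(p s - 2 * q) / 2, q, q, m a, q, q] (s + 1) = 2 * q + m a := by
            simp [labelLength, Fin.sum_univ_succ]
            ring
          rw [this]
          linarith
        · rw [hlen i (by omega) (by omega), Function.update_of_ne e,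
            labelLength_eq_zero (lab := fun h => s + ((![0, 0, 1, 1, 1, 0] : Fin 6 → Fin 2) h : ℕ)),
            add_zero]
          intro x
          have h2 : ((![0, 0, 1, 1, 1, 0] : Fin 6 → Fin 2) x : ℕ) < 2 := Fin.is_lt _
          omega
      · rw [labelLength_sum, labelLength_eq_zero (lab := lab), zero_add]
        · simp [labelLength, Fin.sum_univ_succ]
          ring
        · intro x
          have := (hrange x).1
          omega

/-- Planar graphs with a subgraph `A` all of whose boundary components, except the outer one, are
attached to a pendant loop. -/
theorem exists_skeleton (j : ℕ) : ∃ (H : Type) (_ : Fintype H) (_ : DecidableEq H)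
    (rot inv : Perm H) (lab : H → ℕ) (a : H) (A : Finset H), IsLegged rot inv lab ∧ inv a = a ∧
      (∀ x, inv x = x → x = a) ∧ lab a = 2 * (j + 1) ∧ (∀ x, lab x ≤ 2 * (j + 1)) ∧
      Fintype.card H = 12 * j + 9 ∧ (∀ h ∈ A, inv h ∈ A) ∧
      (∀ h ∈ A, rot h ∈ A ∨ rot (rot h) ∈ A) ∧ (a ∈ A ∧ rot a ∈ A ∧ rot (rot a) ∈ A) ∧
      A.card = 8 * j + 5 ∧ (cornerSet rot A).card = j + 1 ∧
      ∀ (p : ℕ → ℝ) (t : ℝ), 0 ≤ t → (∀ i, i < 2 * (j + 1) → 0 < p i) →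
        (∀ i, i ≤ j → 8 * t < p (2 * i) - p (2 * i + 1)) →
        ∃ m : H → ℝ, (∀ x ∈ A, m x = t) ∧ (∀ x, x ∉ A → 0 < m x) ∧ (∀ x, m (inv x) = m x) ∧
          (∀ i, i < 2 * (j + 1) → labelLength lab m i = p i) ∧
          labelLength lab m (2 * (j + 1)) = 3 * t := by
  induction j with
  | zero =>
    -- The subgraph is the circle `4-7`, `5-8` with its outer leg `6`; the edge `0-3` and the loop
    -- `1-2` lie inside.
    refine ⟨Fin 9, inferInstance, inferInstance, rot9, invDisc, _, 6, {4, 5, 6, 7, 8},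
      isLegged_disc 0, by decide, by decide, rfl, ?_, rfl, by decide, by decide, by decide, rfl,
      by decide, ?_⟩
    · decide
    · intro p t ht hp hgap
      have h1 := hp 1 (by omega)
      have h2 := hgap 0 le_rfl
      simp only [mul_zero, zero_add] at h2
      refine ⟨![(p 0 - p 1 - 2 * t) / 2, p 1, p 1, (p 0 - p 1 - 2 * t) / 2, t, t, t, t, t],
        ?_, ?_, ?_, ?_, ?_⟩
      · intro x hx
        fin_cases x <;> first | rfl | exact absurd hx (by decide)
      · have hb : 0 < (p 0 - p 1 - 2 * t) / 2 := by linarith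
        intro x hx
        fin_cases x <;> first | exact hb | exact h1 | exact absurd (by decide) hx
      · intro x
        fin_cases x <;> rfl
      · intro i hi
        have : i = 0 ∨ i = 1 := by omega
        rcases this with rfl | rfl
        · simp [labelLength, Fin.sum_univ_succ]
          ring
        · simp [labelLength, Fin.sum_univ_succ]
      · simp [labelLength, Fin.sum_univ_succ]
        ring
  | succ j ih =>
    obtain ⟨H, _, _, rot, inv, lab, a, A, hX, ha, hleg, hlab, hrange, hcard, hAinv, hAuni, haA,
      hAcard, hAcor, hm⟩ := ih
    have hc3 : ∀ y, ((![0, 0, 0, 0, 0, 1, 0, 0, 2, 2, 2, 0] : Fin 12 → Fin 3) y : ℕ) < 3 :=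
      fun y => Fin.is_lt _
    -- A new circle `7-10`, `8-11` surrounds the previous graph, joined to its leg by `0-6` and `1`.
    -- The bridge `2-3` with the loop `4-5` stays outside the subgraph and takes up the faces `s`
    -- and `s + 1`, where `s = 2 * (j + 1)`.
    refine ⟨H ⊕ Fin 12, inferInstance, inferInstance, Perm.sumCongr rot rot12,
      joinInv inv invAnnulus a 1, _, Sum.inr 9, A.disjSum {0, 1, 6, 7, 8, 9, 10, 11},
      hX.join (isLegged_annulus (2 * (j + 1))) (a := a) (b := 1) ha (by decide) ?_ ?_,
      ?_, ?_, ?_, ?_, ?_, ?_, ?_, ?_, ?_, ?_, ?_⟩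
    · rw [hlab]; rfl
    · intro x y h
      have h1 := hrange x
      have h2 := hc3 y
      omega
    · rw [joinInv_inr (by decide)]
      rfl
    · intro z hz
      obtain ⟨y, rfl, hy, hyb⟩ := joinInv_eq_self_iff ha (by decide) hleg hz
      congr 1
      clear hz
      revert y
      decide
    · rfl
    · rintro (x | x)
      · have := hrange x
        simp only [Sum.elim_inl]
        omega
      · have h2 := hc3 x
        simp only [Sum.elim_inr]
        omega
    · rw [Fintype.card_sum, hcard, Fintype.card_fin]
      ring
    · rintro (x | x) hx
      · rw [Finset.inl_mem_disjSum] at hx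
        by_cases e : x = a
        · subst e
          rw [joinInv_inl_self (by decide), Finset.inr_mem_disjSum]
          decide
        · rw [joinInv_inl e, Finset.inl_mem_disjSum]
          exact hAinv x hx
      · rw [Finset.inr_mem_disjSum] at hx
        by_cases e : x = 1
        · subst e
          rw [joinInv_inr_self ha, Finset.inl_mem_disjSum]
          exact haA.1
        · rw [joinInv_inr e, Finset.inr_mem_disjSum]
          clear e
          revert x
          decide
    · rintro (x | x) hx
      · rw [Finset.inl_mem_disjSum] at hx
        simpa using hAuni x hx
      · rw [Finset.inr_mem_disjSum] at hx
        simp only [Perm.sumCongr_apply, Sum.map_inr, Finset.inr_mem_disjSum]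
        revert x
        decide
    · simp only [Perm.sumCongr_apply, Sum.map_inr, Finset.inr_mem_disjSum]
      decide
    · rw [Finset.card_disjSum, hAcard]
      simp only [Finset.card_insert_eq_ite]
      simp
      ring
    · rw [cornerSet_disjSum, Finset.card_disjSum, hAcor]
      congr 1
    · intro p t ht hp hgap
      obtain ⟨m, hmA, hmpos, hinv, hlen, hout⟩ := hm p t ht (fun i hi => hp i (by omega))
        (fun i hi => hgap i (by omega))
      have g1 := hgap (j + 1) le_rfl
      have p1 := hp (2 * (j + 1) + 1) (by omega)
      set s := 2 * (j + 1) with hs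
      -- Face `s` meets eight half-edges of length `t`, three from the previous graph and five from
      -- the annulus; the bridge, with two sides, makes up the remaining difference.
      set b : ℝ := (p s - p (s + 1) - 8 * t) / 2 with hb
      have hb0 : 0 < b := by rw [hb]; linarith
      refine ⟨Sum.elim m ![t, t, b, b, p (s + 1), p (s + 1), t, t, t, t, t, t], ?_, ?_, ?_, ?_, ?_⟩
      · rintro (x | x) hx
        · exact hmA x (by simpa using hx)
        · rw [Finset.inr_mem_disjSum] at hx
          fin_cases x <;> first | rfl | exact absurd hx (by decide)
      · rintro (x | x) hx
        · exact hmpos x (by simpa using hx)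
        · rw [Finset.inr_mem_disjSum] at hx
          fin_cases x <;> first | exact hb0 | exact p1 | exact absurd (by decide) hx
      · refine sumElim_joinInv ha (by decide) hinv ?_ (hmA a haA.1)
        intro x
        fin_cases x <;> rfl
      · intro i hi
        rw [labelLength_sum]
        by_cases e : i < s
        · rw [hlen i e, labelLength_eq_zero (lab := fun h => s +
            ((![0, 0, 0, 0, 0, 1, 0, 0, 2, 2, 2, 0] : Fin 12 → Fin 3) h : ℕ)), add_zero]
          intro x
          omega
        · have : i = s ∨ i = s + 1 := by omega
          rcases this with rfl | rfl
          · rw [hout]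
            simp [labelLength, Fin.sum_univ_succ]
            rw [hb]
            ring
          · rw [labelLength_eq_zero (lab := lab), zero_add]
            · simp [labelLength, Fin.sum_univ_succ]
            · intro x
              have := hrange x
              omega
      · rw [labelLength_sum, labelLength_eq_zero (lab := lab), zero_add]
        · rw [show 2 * (j + 1 + 1) = s + 2 by omega]
          simp [labelLength, Fin.sum_univ_succ]
          ring
        · intro x
          have := hrange x
          omega

end Families

/-! ### Attaining the bound -/

namespace RibbonGraph

variable {H : Type} [Fintype H]

theorem exists_edge_function (G : RibbonGraph H) {m : H → ℝ} (hm : ∀ h, m (G.inv h) = m h) :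
    ∃ l : G.Edge → ℝ, ∀ h, l (G.edge h) = m h := by
  refine ⟨fun e => m (Quotient.out e), fun h => ?_⟩
  have : G.edge (Quotient.out (G.edge h)) = G.edge h := Quotient.out_eq _
  rcases edge_eq_edge_iff.1 this with e | e
  · simp only [← e]
  · conv_rhs => rw [e]
    exact (hm _).symm

theorem nonneg_of_mem_closure_cell {G : RibbonGraph H} {n : ℕ} {lab : Fin n ≃ G.Face}
    {L : Fin n → ℝ} {l : G.Edge → ℝ} (hl : l ∈ closure (G.cell lab L)) (e : G.Edge) : 0 ≤ l e :=
  closure_minimal (t := {l : G.Edge → ℝ | 0 ≤ l e}) (fun _ hl => (hl.1 e).le)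
    (isClosed_le continuous_const (continuous_apply e)) hl

/-- Every edge lies on some face, whose perimeter bounds its length. -/
theorem isCompact_closure_cell (G : RibbonGraph H) {n : ℕ} (lab : Fin n ≃ G.Face)
    (L : Fin n → ℝ) : IsCompact (closure (G.cell lab L)) := by
  classical
  refine IsCompact.of_isClosed_subset
    (isCompact_Icc (a := (0 : G.Edge → ℝ)) (b := fun _ => ∑ i, |L i|)) isClosed_closure ?_
  intro l hl
  refine ⟨fun e => nonneg_of_mem_closure_cell hl e, fun e => ?_⟩
  obtain ⟨h, rfl⟩ := Quotient.exists_rep e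
  change l (G.edge h) ≤ _
  obtain ⟨i, hi⟩ := lab.surjective (G.face h)
  have h1 := perimeter_eq_of_mem_closure_cell hl i
  calc l (G.edge h) ≤ G.perimeter l (lab i) := by
        rw [perimeter]
        exact Finset.single_le_sum (f := fun h => l (G.edge h))
          (fun h _ => nonneg_of_mem_closure_cell hl _) (by simp [hi])
    _ ≤ |L i| := by rw [h1]; exact le_abs_self _
    _ ≤ ∑ i, |L i| := Finset.single_le_sum (f := fun i => |L i|) (fun i _ => abs_nonneg _)
        (Finset.mem_univ i)

/-- A face of the closed cell contains a vertex. -/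
theorem exists_cellVertex {G : RibbonGraph H} {n : ℕ} {lab : Fin n ≃ G.Face}
    {L : Fin n → ℝ} {E' : Set G.Edge} {l₀ l₁ : G.Edge → ℝ} (h₁ : l₁ ∈ G.cell lab L)
    (h₀ : ∀ e, 0 ≤ l₀ e) (hper : ∀ i, G.perimeter l₀ (lab i) = L i) (hE : ∀ e ∈ E', l₀ e = 0) :
    ∃ lam ∈ G.cellVertices lab L, E' ⊆ {e | lam e = 0} := by
  classical
  have hmem : l₀ ∈ closure (G.cell lab L) := by
    -- Moving slightly from `l₀` towards the interior point `l₁` makes all lengths positive and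
    -- keeps the perimeters.
    have hlim : Filter.Tendsto (fun t : ℝ => (1 - t) • l₀ + t • l₁) (𝓝[>] 0) (𝓝 l₀) := by
      have : Filter.Tendsto (fun t : ℝ => (1 - t) • l₀ + t • l₁) (𝓝 0)
          (𝓝 ((1 - 0 : ℝ) • l₀ + (0 : ℝ) • l₁)) := by
        apply Continuous.tendsto
        fun_prop
      simp only [sub_zero, one_smul, zero_smul, add_zero] at this
      exact this.mono_left nhdsWithin_le_nhds
    refine mem_closure_of_tendsto hlim ?_
    filter_upwards [Ioo_mem_nhdsGT (show (0 : ℝ) < 1 by norm_num)] with t ht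
    refine ⟨fun e => ?_, fun i => ?_⟩
    · have h2 := mul_nonneg (sub_nonneg.2 ht.2.le) (h₀ e)
      have h3 := mul_pos ht.1 (h₁.1 e)
      simp only [Pi.add_apply, Pi.smul_apply, smul_eq_mul]
      linarith
    · have h2 := hper i
      have h3 := h₁.2 i
      simp only [perimeter, Pi.add_apply, Pi.smul_apply, smul_eq_mul, Finset.sum_add_distrib,
        ← Finset.mul_sum] at h2 h3 ⊢
      rw [h2, h3]
      ring
  set F : Set (G.Edge → ℝ) := {l | l ∈ closure (G.cell lab L) ∧ ∀ e ∈ E', l e = 0} with hF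
  have hFc : IsCompact F := by
    refine (isCompact_closure_cell G lab L).of_isClosed_subset ?_ fun l hl => hl.1
    refine isClosed_closure.inter ?_
    have : {l : G.Edge → ℝ | ∀ e ∈ E', l e = 0} = ⋂ e ∈ E', {l | l e = 0} := by
      ext
      simp
    change IsClosed {l : G.Edge → ℝ | ∀ e ∈ E', l e = 0}
    rw [this]
    exact isClosed_iInter fun e => isClosed_iInter fun _ =>
      isClosed_eq (continuous_apply e) continuous_const
  obtain ⟨lam, hlam⟩ := hFc.extremePoints_nonempty ⟨l₀, hmem, hE⟩
  rw [mem_extremePoints] at hlam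
  refine ⟨lam, mem_extremePoints.2 ⟨hlam.1.1, fun x hx y hy hxy => ?_⟩, hlam.1.2⟩
  -- An extreme point of `F` is extreme in the whole closure: lengths are non-negative, so a segment
  -- through a point where `e` vanishes has `e` vanishing at both ends.
  have key : ∀ e ∈ E', x e = 0 ∧ y e = 0 := by
    intro e he
    obtain ⟨a, b, ha, hb, -, rfl⟩ := hxy
    have h2 := hlam.1.2 e he
    simp only [Pi.add_apply, Pi.smul_apply, smul_eq_mul] at h2
    have hxe := mul_nonneg ha.le (nonneg_of_mem_closure_cell hx e)
    have hye := mul_nonneg hb.le (nonneg_of_mem_closure_cell hy e)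
    have z1 : a * x e = 0 := by linarith
    have z2 : b * y e = 0 := by linarith
    exact ⟨(mul_eq_zero.1 z1).resolve_left ha.ne', (mul_eq_zero.1 z2).resolve_left hb.ne'⟩
  exact hlam.2 x ⟨hx, fun e he => (key e he).1⟩ y ⟨hy, fun e he => (key e he).2⟩ hxy

theorem mem_sHatValues_of_comp_perm {g n : ℕ} {L : Fin n → ℝ} {σ : Equiv.Perm (Fin n)} {s : ℝ≥0∞}
    (hs : s ∈ sHatValues g n (L ∘ σ)) : s ∈ sHatValues g n L := by
  obtain ⟨H, _, G, lab, hconn, htri, hgen, lam, hlam, E', hne, hE', rfl⟩ := hs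
  refine ⟨H, inferInstance, G, σ.symm.trans lab, hconn, htri, hgen, lam, ?_, E', hne, hE', rfl⟩
  have : G.cell (σ.symm.trans lab) L = G.cell lab (L ∘ σ) := by
    ext l
    refine and_congr_right fun _ => ?_
    constructor
    · intro h i
      simpa using h (σ i)
    · intro h i
      simpa using h (σ.symm i)
  rw [cellVertices, this]
  exact hlam

end RibbonGraph

open RibbonGraph in
/-- A closed graph with a subgraph `A` that can be contracted gives a value of `ŝ`. -/
theorem IsLegged.exists_mem_sHatValues_le {H : Type} [Fintype H] [DecidableEq H]
    {rot inv : Equiv.Perm H} {lab : H → ℕ} (hX : IsLegged rot inv lab) (hne : ∀ h, inv h ≠ h)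
    {g n : ℕ} {L : Fin n → ℝ} (hL : ∀ i, 0 < L i) (p : ℕ → ℝ) (hp : ∀ i : Fin n, p i = L i)
    (hlab : ∀ x, lab x < n) (hcard : Fintype.card H + 12 = 12 * g + 6 * n) {A : Finset H}
    (hA : ∀ h ∈ A, inv h ∈ A) (hA0 : A.Nonempty) (huni : ∀ h ∈ A, rot h ∈ A ∨ rot (rot h) ∈ A)
    {t₁ : ℝ} (ht₁ : 0 < t₁)
    (hm : ∀ t, 0 ≤ t → t ≤ t₁ → ∃ m : H → ℝ, (∀ x ∈ A, m x = t) ∧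
      (∀ x, x ∉ A → 0 ≤ m x ∧ (0 < t → 0 < m x)) ∧ (∀ x, m (inv x) = m x) ∧
      ∀ i, i < n → labelLength lab m i = p i)
    {d : ℕ} (hd : d = 1 ∨ 2 * d + 2 * (cornerSet rot A).card ≤ A.card)
    (hs : (A.card : ℝ) ≤ 2 * (sStar g n * d)) :
    ∃ s ∈ sHatValues g n L, s ≤ ENNReal.ofReal (sStar g n) := by
  classical
  -- `m₀` contracts `A` and gives a point of the closure; `m₁` has all lengths positive, so the cell
  -- is not empty.
  obtain ⟨m₀, hm₀A, hm₀, hm₀inv, hm₀len⟩ := hm 0 le_rfl ht₁.le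
  obtain ⟨m₁, hm₁A, hm₁, hm₁inv, hm₁len⟩ := hm t₁ ht₁.le le_rfl
  let G : RibbonGraph H := ⟨inv, rot, hX.inv_inv, hne⟩
  have hG : G.IsCubic := ⟨hX.rot_rot_rot, hX.rot_ne⟩
  have hface : ∀ x y, G.face x = G.face y ↔ lab x = lab y := fun x y => by
    rw [face_eq_face_iff, hX.lab_eq_iff]
  have hex : ∀ i : Fin n, ∃ h, lab h = i := by
    intro i
    by_contra! hcon
    have := hm₁len i i.2
    rw [labelLength_eq_zero hcon, hp] at this
    exact (hL i).ne this
  choose r hr using hex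
  let e : Fin n ≃ G.Face := Equiv.ofBijective (fun i => G.face (r i)) ⟨fun i j hij => by
    have := (hface _ _).1 hij
    rw [hr, hr] at this
    exact Fin.ext this, fun f => by
    obtain ⟨h, rfl⟩ := Quotient.exists_rep f
    exact ⟨⟨lab h, hlab h⟩, (hface _ _).2 (hr _)⟩⟩
  have hper : ∀ (l : G.Edge → ℝ) (m : H → ℝ), (∀ h, l (G.edge h) = m h) → ∀ i : Fin n,
      G.perimeter l (e i) = labelLength lab m i := by
    intro l m hlm i
    rw [perimeter, Finset.sum_filter, labelLength]
    refine Finset.sum_congr rfl fun h _ => ?_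
    have : G.face h = e i ↔ lab h = i := by
      change G.face h = G.face (r i) ↔ _
      rw [hface, hr]
    simp only [this, hlm]
  obtain ⟨l₀, hl₀⟩ := G.exists_edge_function hm₀inv
  obtain ⟨l₁, hl₁⟩ := G.exists_edge_function hm₁inv
  have hAcl : G.InvClosed A := hA
  have hmemA : ∀ h, G.edge h ∈ G.edge '' (A : Set H) ↔ h ∈ A := by
    intro h
    constructor
    · rintro ⟨b, hb, e⟩
      rcases edge_eq_edge_iff.1 e with rfl | rfl
      · exact hb
      · exact hA _ hb
    · intro hh; exact ⟨h, hh, rfl⟩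
  have hconn : G.Connected := by
    refine ⟨⟨hA0.choose⟩, fun h k => ?_⟩
    have hri := Subgroup.subset_closure (show rot ∈ ({G.inv, G.rot} : Set _) from Or.inr rfl)
    have hii := Subgroup.subset_closure (show inv ∈ ({G.inv, G.rot} : Set _) from Or.inl rfl)
    have key : ∀ q ∈ Subgroup.closure ({G.inv, G.rot} : Set (Equiv.Perm H)), ∀ x,
        (∃ p ∈ Subgroup.closure ({G.inv, G.rot} : Set (Equiv.Perm H)), p h = q x) ↔
        ∃ p ∈ Subgroup.closure ({G.inv, G.rot} : Set (Equiv.Perm H)), p h = x := by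
      intro q hq x
      constructor
      · rintro ⟨p, hp, e⟩
        exact ⟨q⁻¹ * p, mul_mem (inv_mem hq) hp, by rw [Equiv.Perm.mul_apply, e]; simp⟩
      · rintro ⟨p, hp, rfl⟩
        exact ⟨q * p, mul_mem hq hp, rfl⟩
    exact (hX.conn (fun x => ∃ p ∈ Subgroup.closure ({G.inv, G.rot} : Set (Equiv.Perm H)), p h = x)
      (key rot hri) (key inv hii) h k).1 ⟨1, one_mem _, rfl⟩
  have hcardF : Nat.card G.Face = n := by
    rw [← Nat.card_congr e, Nat.card_eq_fintype_card, Fintype.card_fin]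
  have hgen : G.HasGenus g := by
    rw [hG.hasGenus_iff, hcardF]
    exact_mod_cast hcard
  obtain ⟨lam, hlam, hlamE⟩ := exists_cellVertex (G := G) (lab := e) (L := L)
    (E' := G.edge '' (A : Set H)) (l₀ := l₀) (l₁ := l₁)
    ⟨fun ed => by
      obtain ⟨h, rfl⟩ := Quotient.exists_rep ed
      refine lt_of_lt_of_eq ?_ (hl₁ h).symm
      by_cases hh : h ∈ A
      · rw [hm₁A h hh]; exact ht₁
      · exact (hm₁ h hh).2 ht₁,
      fun i => by rw [hper l₁ m₁ hl₁, hm₁len i i.2, hp]⟩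
    (fun ed => by
      obtain ⟨h, rfl⟩ := Quotient.exists_rep ed
      refine le_of_le_of_eq ?_ (hl₀ h).symm
      by_cases hh : h ∈ A
      · rw [hm₀A h hh]
      · exact (hm₀ h hh).1)
    (fun i => by rw [hper l₀ m₀ hl₀, hm₀len i i.2, hp])
    (by
      rintro _ ⟨h, hh, rfl⟩
      rw [hl₀, hm₀A h hh])
  refine ⟨_, ⟨H, inferInstance, G, e, hconn, hG.trivalent, hgen, lam, hlam, G.edge '' (A : Set H),
    ⟨_, hA0.choose, hA0.choose_spec, rfl⟩, hlamE, rfl⟩, ?_⟩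
  have hhalf : G.halfEdges (G.edge '' (A : Set H)) = A := by
    ext h
    rw [mem_halfEdges, hmemA]
  have hcardE := two_mul_card_edgeSet (G := G) (fun h => (hmemA h).symm)
  rw [hG.sHat_restrict, hhalf]
  have hD1 := IsCubic.one_le_foliationDim (G := G) hAcl hA0 huni
  have hD2 := card_le_finrank_weightSpace hG (fun h => (hmemA h).symm) huni
  have hD3 := hG.finrank_le_foliationDim hAcl huni
  have hcor : (G.corners A).card = (cornerSet rot A).card := rfl
  -- Either `d = 1`, by non-triviality of the cone, or `d` is at most the number of edges minus the
  -- number of corners.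
  have hdD : d ≤ G.foliationDim A := by omega
  have hs0 := (sStar_nonneg_and_le_two g n).1
  refine ENNReal.div_le_of_le_mul ?_
  rw [← ENNReal.ofReal_natCast, ← ENNReal.ofReal_natCast, ← ENNReal.ofReal_mul hs0]
  refine ENNReal.ofReal_le_ofReal ?_
  have h2 : (A.card : ℝ) = 2 * Nat.card (G.edge '' (A : Set H)) := by exact_mod_cast hcardE.symm
  have h3 : sStar g n * d ≤ sStar g n * G.foliationDim A :=
    mul_le_mul_of_nonneg_left (by exact_mod_cast hdD) hs0
  linarith

section Attained

open Equiv Equiv.Perm Function RibbonGraph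

theorem exists_pos_forall_le {f : ℕ → ℝ} (k : ℕ) (hf : ∀ i, i < k → 0 < f i) :
    ∃ δ : ℝ, 0 < δ ∧ ∀ i, i < k → δ ≤ f i := by
  induction k with
  | zero => exact ⟨1, one_pos, by simp⟩
  | succ k ih =>
    obtain ⟨δ, hδ, h⟩ := ih fun i hi => hf i (by omega)
    refine ⟨min δ (f k), lt_min hδ (hf k (by omega)), fun i hi => ?_⟩
    rcases (Nat.lt_succ_iff_lt_or_eq.1 hi) with h' | rfl
    · exact (min_le_left _ _).trans (h i h')
    · exact min_le_right _ _

variable {H K : Type} [Fintype H] [Fintype K] [DecidableEq H] [DecidableEq K]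

/-- The bound is attained on the graph obtained by gluing two legs, the contracted subgraph being
one side, without its leg. -/
theorem IsLegged.exists_mem_sHatValues_le_of_join {rot inv : Perm H} {lab : H → ℕ}
    {rot' inv' : Perm K} {lab' : K → ℕ} (hX : IsLegged rot inv lab)
    (hY : IsLegged rot' inv' lab') {a : H} {b : K} (ha : inv a = a) (hb : inv' b = b)
    (hab : lab a = lab' b) (hdisj : ∀ x y, lab x = lab' y → lab x = lab a)
    (hleg : ∀ x, inv x = x → x = a) (hleg' : ∀ y, inv' y = y → y = b)
    {g n : ℕ} {L : Fin n → ℝ} (hL : ∀ i, 0 < L i) (p : ℕ → ℝ) (hp : ∀ i : Fin n, p i = L i)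
    (hlab : ∀ x, lab x < n) (hlab' : ∀ y, lab' y < n)
    (hcard : Fintype.card H + Fintype.card K + 12 = 12 * g + 6 * n) {A : Finset H}
    (hA : ∀ h ∈ A, inv h ∈ A) (huni : ∀ h ∈ A, rot h ∈ A ∨ rot (rot h) ∈ A)
    (haA : a ∈ A ∧ rot a ∈ A ∧ rot (rot a) ∈ A) {t₁ : ℝ} (ht₁ : 0 < t₁)
    (hm : ∀ t, 0 ≤ t → t ≤ t₁ → ∃ (m : H → ℝ) (m' : K → ℝ), (∀ x ∈ A, m x = t) ∧
      (∀ x, x ∉ A → 0 < m x) ∧ (∀ x, m (inv x) = m x) ∧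
      (∀ y, 0 ≤ m' y ∧ (0 < t → 0 < m' y)) ∧ (∀ y, m' (inv' y) = m' y) ∧
      ∀ i, i < n → labelLength lab m i + labelLength lab' m' i +
        (if lab a = i then m' b - t else 0) = p i)
    {d : ℕ} (hd : d = 1 ∨ 2 * d + 2 * (cornerSet rot A).card + 3 ≤ A.card)
    (hs : (A.card : ℝ) - 1 ≤ 2 * (sStar g n * d)) :
    ∃ s ∈ sHatValues g n L, s ≤ ENNReal.ofReal (sStar g n) := by
  have h2 : ∀ h, rot (rot h) ≠ h := fun h e => hX.rot_ne h (by
    have := hX.rot_rot_rot h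
    rwa [e] at this)
  have hcA : ((A.erase a).disjSum (∅ : Finset K)).card + 1 = A.card := by
    rw [Finset.card_disjSum, Finset.card_empty, add_zero, Finset.card_erase_add_one haA.1]
  have hcor : (cornerSet (Perm.sumCongr rot rot') ((A.erase a).disjSum (∅ : Finset K))).card =
      (cornerSet rot A).card + 1 := by
    rw [cornerSet_disjSum, Finset.card_disjSum, cornerSet_erase hX.rot_rot_rot hX.rot_ne haA.1
      haA.2.1 haA.2.2, Finset.card_insert_of_notMem (by simp [mem_cornerSet, haA.1])]
    simp [cornerSet]
  have hinv : ∀ x, inv x = a → x = a := fun x e => by rw [← hX.inv_inv x, e, ha]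
  refine (hX.join hY ha hb hab hdisj).exists_mem_sHatValues_le (g := g) (d := d) ?_ hL p hp ?_ ?_
    (A := (A.erase a).disjSum ∅) ?_ ?_ ?_ ht₁ ?_ ?_ ?_
  · intro z hz
    obtain ⟨y, -, hy, hyb⟩ := joinInv_eq_self_iff ha hb hleg hz
    exact hyb (hleg' y hy)
  · rintro (x | y)
    · exact hlab x
    · exact hlab' y
  · rw [Fintype.card_sum, hcard]
  · rintro (x | y) hx
    · rw [Finset.inl_mem_disjSum, Finset.mem_erase] at hx
      rw [joinInv_inl hx.1, Finset.inl_mem_disjSum, Finset.mem_erase]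
      exact ⟨fun e => hx.1 (hinv x e), hA x hx.2⟩
    · simp at hx
  · exact ⟨Sum.inl (rot a), by simp [haA.2.1, hX.rot_ne]⟩
  · rintro (x | y) hx
    · rw [Finset.inl_mem_disjSum, Finset.mem_erase] at hx
      simp only [Perm.sumCongr_apply, Sum.map_inl, Finset.inl_mem_disjSum, Finset.mem_erase]
      by_cases e : rot x = a
      · rw [e]
        exact Or.inr ⟨hX.rot_ne a, haA.2.1⟩
      · rcases huni x hx.2 with h | h
        · exact Or.inl ⟨e, h⟩
        · by_cases e' : rot (rot x) = a
          · refine Or.inl ⟨e, ?_⟩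
            have := hX.rot_rot_rot (rot x)
            rw [e'] at this
            exact this ▸ haA.2.2
          · exact Or.inr ⟨e', h⟩
    · simp at hx
  · intro t ht ht'
    obtain ⟨m, m', hmA, hm0, hminv, hm0', hminv', hlen⟩ := hm t ht ht'
    -- The glued edge is not contracted: the leg `a`, of length `t` in `m`, takes the length
    -- prescribed on the other side.
    refine ⟨Sum.elim (update m a (m' b)) m', ?_, ?_, ?_, ?_⟩
    · rintro (x | y) hx
      · rw [Finset.inl_mem_disjSum, Finset.mem_erase] at hx
        simpa [hx.1] using hmA x hx.2
      · simp at hx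
    · rintro (x | y) hx
      · rw [Finset.inl_mem_disjSum, Finset.mem_erase] at hx
        by_cases e : x = a
        · subst e
          simpa using hm0' b
        · have : x ∉ A := fun h => hx ⟨e, h⟩
          simpa [e] using ⟨(hm0 x this).le, fun _ => hm0 x this⟩
      · exact hm0' y
    · refine sumElim_joinInv ha hb (fun x => ?_) hminv' (update_self _ _ _)
      by_cases e : x = a
      · rw [e, ha]
      · rw [update_of_ne e, update_of_ne fun e' => e (hinv x e'), hminv]
    · intro i hi
      rw [labelLength_sum, ← hlen i hi]
      by_cases e : lab a = i
      · rw [labelLength_update _ _ e, hmA a haA.1, if_pos e]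
        ring
      · rw [labelLength_update_of_ne _ _ e, if_neg e, add_zero]
  · rw [hcor]
    omega
  · refine le_trans (le_of_eq ?_) hs
    rw [← hcA]
    push_cast
    ring

theorem cornerSet_univ (rot : Perm H) : cornerSet rot Finset.univ = ∅ := by
  ext
  simp [mem_cornerSet]

theorem labelLength_const (t : ℝ) :
    labelLength (fun _ : H => 0) (fun _ => t) 0 = Fintype.card H * t := by
  simp [labelLength]

variable {g n : ℕ} {L : Fin n → ℝ} {p : ℕ → ℝ}

/-- A one-faced subgraph of genus `g` with a single bivalent vertex has `6g - 2` edges and dimension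
at least `6g - 3`. The rest is a chain of circles carrying the `n` faces. The subgraph has `12g - 4`
sides, all on face `0`, whose perimeter is corrected accordingly. -/
theorem exists_mem_sHatValues_le_of_pos_genus (hL : ∀ i, 0 < L i) (hp : ∀ i : Fin n, p i = L i)
    (hp0 : ∀ i, i < n → 0 < p i) (hanti : ∀ i, i + 1 < n → p (i + 1) < p i) (hg : 0 < g)
    (hn : 2 ≤ n) : ∃ s ∈ sHatValues g n L, s ≤ ENNReal.ofReal (sStar g n) := by
  obtain ⟨H, _, _, rot, inv, a, hX, ha, hleg, hcard⟩ := exists_torus (g - 1)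
  obtain ⟨K, _, _, rot', inv', lab', b, hY, hb, hleg', hlabb, hrange, hcard', hchain⟩ :=
    exists_chain (n - 2) 0
  have hg0 : (0 : ℝ) < g := by exact_mod_cast hg
  have hcH : Fintype.card H = 12 * g - 3 := by omega
  have hcH' : (Fintype.card H : ℝ) = 12 * g - 3 := by
    rw [hcH, Nat.cast_sub (by omega)]
    push_cast
    ring
  have h1 := hanti 0 (by omega)
  have hp1 := hp0 1 (by omega)
  refine hX.exists_mem_sHatValues_le_of_join hY ha hb hlabb.symm (fun _ _ _ => rfl) hleg hleg' hL
    p hp (fun _ => by omega) (fun y => by have := hrange y; omega) (by omega) (A := Finset.univ)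
    (by simp) (by simp) (by simp) (t₁ := (p 0 - p 1) / (12 * g)) (by
      apply div_pos <;> linarith) ?_ (d := 6 * g - 3) (Or.inr ?_) ?_
  · intro t ht ht'
    rw [le_div_iff₀ (by positivity)] at ht'
    have hsmall : (12 * g - 4) * t < p 0 - p 1 := by
      rcases ht.eq_or_lt with rfl | ht
      · linarith
      · nlinarith
    obtain ⟨m', hpos, hinv', hlen, hout⟩ := hchain
      (update p 0 (p 0 - (12 * g - 4) * t)) (fun i _ hi => by
        rcases Nat.eq_zero_or_pos i with rfl | h
        · rw [update_self]; linarith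
        · rw [update_of_ne (by omega)]; exact hp0 i (by omega)) (fun i _ hi => by
        rw [update_of_ne (by omega) _ (f := p)]
        rcases Nat.eq_zero_or_pos i with rfl | h
        · rw [update_self]; simpa using by linarith
        · rw [update_of_ne (by omega)]; exact hanti i (by omega))
    refine ⟨fun _ => t, m', fun _ _ => rfl, fun x hx => absurd (Finset.mem_univ x) hx,
      fun _ => rfl, fun y => ⟨(hpos y).le, fun _ => hpos y⟩, hinv', fun i hi => ?_⟩
    rcases Nat.eq_zero_or_pos i with rfl | h
    · rw [update_self] at hout
      rw [labelLength_const, hcH', if_pos rfl]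
      linarith
    · rw [labelLength_eq_zero (fun _ => by omega), if_neg (by omega), hlen i h (by omega),
        update_of_ne (by omega)]
      ring
  · rw [cornerSet_univ, Finset.card_univ, hcH, Finset.card_empty]
    omega
  · rw [Finset.card_univ, hcH', Nat.cast_sub (by omega), sStar, if_neg (by omega)]
    push_cast
    split_ifs with e e' e'
    · omega
    · subst e
      norm_num
    · omega
    · have : (2 * (g : ℝ) - 1) ≠ 0 := by
        have : (1 : ℝ) ≤ g := by exact_mod_cast hg
        intro h
        linarith
      rw [show 6 * (g : ℝ) - 3 = 3 * (2 * g - 1) by ring, add_mul, one_div,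
        inv_mul_cancel₀ (by simpa using this)]
      linarith

/-- With a single face, one handle has to stay outside. The subgraph has genus `g - 1`, `6g - 8`
edges and dimension at least `6g - 9`. In the limit `t = 0` the connecting edge alone carries the
perimeter, half on each side. -/
theorem exists_mem_sHatValues_le_of_one_face {L : Fin 1 → ℝ} (hL : ∀ i, 0 < L i)
    (hp : ∀ i : Fin 1, p i = L i) (hp0 : 0 < p 0) (hg : 2 ≤ g) :
    ∃ s ∈ sHatValues g 1 L, s ≤ ENNReal.ofReal (sStar g 1) := by
  obtain ⟨H, _, _, rot, inv, a, hX, ha, hleg, hcard⟩ := exists_torus (g - 2)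
  obtain ⟨K, _, _, rot', inv', b, hY, hb, hleg', hcard'⟩ := exists_torus 0
  have hg0 : (2 : ℝ) ≤ g := by exact_mod_cast hg
  have hcH : Fintype.card H = 12 * g - 15 := by omega
  have hcH' : (Fintype.card H : ℝ) = 12 * g - 15 := by
    rw [hcH, Nat.cast_sub (by omega)]
    push_cast
    ring
  refine hX.exists_mem_sHatValues_le_of_join hY ha hb rfl (fun _ _ _ => rfl) hleg hleg' hL
    p hp (fun _ => by omega) (fun _ => by omega) (by omega) (A := Finset.univ)
    (by simp) (by simp) (by simp) (t₁ := p 0 / (12 * g)) (by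
      apply div_pos <;> linarith) ?_ (d := 6 * g - 9) (Or.inr ?_) ?_
  · intro t ht ht'
    rw [le_div_iff₀ (by positivity)] at ht'
    have hsmall : (12 * g - 8) * t < p 0 := by
      rcases ht.eq_or_lt with rfl | ht
      · linarith
      · nlinarith
    have hβ : 0 < (p 0 - (12 * g - 8) * t) / 2 := by linarith
    refine ⟨fun _ => t, update (fun _ => t) b ((p 0 - (12 * g - 8) * t) / 2), fun _ _ => rfl,
      fun x hx => absurd (Finset.mem_univ x) hx, fun _ => rfl, fun y => ?_, fun y => ?_,
      fun i hi => ?_⟩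
    · by_cases e : y = b
      · subst e
        rw [update_self]
        exact ⟨hβ.le, fun _ => hβ⟩
      · rw [update_of_ne e]
        exact ⟨ht, id⟩
    · by_cases e : y = b
      · rw [e, hb]
      · rw [update_of_ne e, update_of_ne fun e' => e (by rw [← hY.inv_inv y, e', hb])]
    · obtain rfl : i = 0 := by omega
      rw [labelLength_update _ _ rfl, labelLength_const, labelLength_const, hcH', hcard',
        if_pos rfl, update_self]
      push_cast
      ring
  · rw [cornerSet_univ, Finset.card_univ, hcH, Finset.card_empty]
    omega
  · rw [Finset.card_univ, hcH', Nat.cast_sub (by omega), sStar, if_neg (by omega),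
      if_neg (by omega), if_pos rfl]
    push_cast
    have : (2 * (g : ℝ) - 3) ≠ 0 := by
      intro h
      linarith
    rw [show 6 * (g : ℝ) - 9 = 3 * (2 * g - 3) by ring, add_mul, one_div,
      inv_mul_cancel₀ (by simpa using this)]
    linarith

/-- Two of the three edges of the theta graph form a circle, of ratio at most `2`; the third edge
carries the perimeter. -/
theorem exists_mem_sHatValues_le_of_torus {L : Fin 1 → ℝ} (hL : ∀ i, 0 < L i)
    (hp : ∀ i : Fin 1, p i = L i) (hp0 : 0 < p 0) :
    ∃ s ∈ sHatValues 1 1 L, s ≤ ENNReal.ofReal (sStar 1 1) := by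
  refine isLegged_theta.exists_mem_sHatValues_le (by decide) hL p hp (fun _ => by omega) rfl
    (A := {0, 1, 3, 4}) (by decide) ⟨0, by decide⟩ (by decide) (t₁ := p 0 / 8) (by linarith) ?_
    (d := 1) (Or.inl rfl) ?_
  · intro t ht ht'
    have hβ : 0 < (p 0 - 4 * t) / 2 := by linarith
    refine ⟨![t, t, (p 0 - 4 * t) / 2, t, t, (p 0 - 4 * t) / 2], ?_, ?_, ?_, ?_⟩
    · intro x hx
      fin_cases x <;> first | rfl | exact absurd hx (by decide)
    · intro x hx
      fin_cases x <;> first | exact ⟨hβ.le, fun _ => hβ⟩ | exact absurd (by decide) hx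
    · intro x
      fin_cases x <;> rfl
    · intro i hi
      obtain rfl : i = 0 := by omega
      simp [labelLength, Fin.sum_univ_succ]
      ring
  · rw [show ({0, 1, 3, 4} : Finset (Fin 6)).card = 4 from rfl]
    norm_num [sStar]

/-- With `j = ⌊n/2⌋ - 2`, the tower of circles without its leg has `4j + 2` edges and `j + 2`
bivalent vertices, hence dimension at least `3j`; for `j = 0` it is a circle with two edges. Each
boundary component encloses two faces of the graph, except the outer one, which also takes the extra
face when `n` is odd. -/
theorem exists_mem_sHatValues_le_of_planar (hL : ∀ i, 0 < L i) (hp : ∀ i : Fin n, p i = L i)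
    (hp0 : ∀ i, i < n → 0 < p i) (hanti : ∀ i, i + 1 < n → p (i + 1) < p i) (hn : 4 ≤ n) :
    ∃ s ∈ sHatValues 0 n L, s ≤ ENNReal.ofReal (sStar 0 n) := by
  obtain ⟨j, hj⟩ : ∃ j, n / 2 = j + 2 := ⟨n / 2 - 2, by omega⟩
  obtain ⟨r, hr⟩ : ∃ r, n = 2 * (j + 2) + r := ⟨n % 2, by omega⟩
  obtain ⟨H, _, _, rot, inv, lab, a, A, hX, ha, hleg, hlaba, hlab, hcard, hA, huni, haA, hAcard,
    hAcor, hskel⟩ := exists_skeleton j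
  obtain ⟨K, _, _, rot', inv', lab', b, hY, hb, hleg', hlabb, hrange, hcard', hchain⟩ :=
    exists_chain r (2 * (j + 1))
  obtain ⟨δ, hδ, hgap⟩ := exists_pos_forall_le (f := fun i => p i - p (i + 1)) (n - 1)
    fun i hi => sub_pos.2 (hanti i (by omega))
  refine hX.exists_mem_sHatValues_le_of_join hY ha hb (hlaba.trans hlabb.symm) (fun x y h => ?_)
    hleg hleg' hL p hp (fun x => by have := hlab x; omega) (fun y => by have := hrange y; omega)
    (by omega) hA huni haA (t₁ := δ / 16) (by linarith) ?_ (d := if j = 0 then 1 else 3 * j) ?_ ?_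
  · have h1 := hlab x
    have h2 := hrange y
    omega
  · intro t ht ht'
    obtain ⟨m, hmA, hmpos, hinv, hlen, hout⟩ := hskel p t ht (fun i hi => hp0 i (by omega))
      fun i hi => by
        have := hgap (2 * i) (by omega)
        linarith
    set s := 2 * (j + 1) with hs
    have gs := hgap s (by omega)
    have ps := hp0 (s + 1) (by omega)
    obtain ⟨m', hpos, hinv', hlen', hout'⟩ := hchain (update p s (p s - 2 * t)) (fun i hi hi' => by
        rcases hi.eq_or_lt with rfl | h
        · rw [update_self]; linarith
        · rw [update_of_ne (by omega)]; exact hp0 i (by omega)) (fun i hi hi' => by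
        rw [update_of_ne (by omega) _ (f := p)]
        rcases hi.eq_or_lt with rfl | h
        · rw [update_self]; linarith
        · rw [update_of_ne (by omega)]; exact hanti i (by omega))
    rw [update_self] at hout'
    refine ⟨m, m', hmA, hmpos, hinv, fun y => ⟨(hpos y).le, fun _ => hpos y⟩, hinv',
      fun i hi => ?_⟩
    rcases lt_trichotomy i s with h | rfl | h
    · rw [hlen i h, if_neg (by omega), labelLength_eq_zero fun y => by have := hrange y; omega]
      ring
    · rw [hout, if_pos hlaba]
      linarith
    · rw [labelLength_eq_zero fun x => by have := hlab x; omega, if_neg (by omega),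
        hlen' i h (by omega), update_of_ne (by omega)]
      ring
  · split_ifs
    · exact Or.inl rfl
    · exact Or.inr (by omega)
  · rw [hAcard, sStar, if_pos rfl]
    split_ifs with h1 h2 h2
    · subst h2
      norm_num
    · omega
    · omega
    · have : (j : ℝ) ≠ 0 := by exact_mod_cast h2
      rw [hj]
      push_cast
      rw [add_sub_cancel_right]
      field_simp
      ring_nf
      exact le_rfl

theorem exists_mem_sHatValues_le (hn : 0 < n) (hstable : 2 < 2 * g + n) (h03 : (g, n) ≠ (0, 3))
    (hL : ∀ i, 0 < L i) (hp : ∀ i : Fin n, p i = L i)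
    (hanti : ∀ i, i + 1 < n → p (i + 1) < p i) :
    ∃ s ∈ sHatValues g n L, s ≤ ENNReal.ofReal (sStar g n) := by
  have hp0 : ∀ i, i < n → 0 < p i := fun i hi => by
    rw [hp ⟨i, hi⟩]
    exact hL _
  rcases Nat.eq_zero_or_pos g with rfl | hg
  · have : n ≠ 3 := fun e => h03 (by rw [e])
    exact exists_mem_sHatValues_le_of_planar hL hp hp0 hanti (by omega)
  by_cases h2 : 2 ≤ n
  · exact exists_mem_sHatValues_le_of_pos_genus hL hp hp0 hanti hg h2
  obtain rfl : n = 1 := by omega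
  by_cases h : g = 1
  · subst h
    exact exists_mem_sHatValues_le_of_torus hL hp (hp0 0 hn)
  · exact exists_mem_sHatValues_le_of_one_face hL hp (hp0 0 hn) (by omega)

theorem NonResonant.injective (h : NonResonant L) : Injective L := by
  intro i j hij
  by_contra hne
  refine h (fun k => if k = i then 1 else if k = j then -1 else 0) (fun e => ?_) ?_
  · have := congrFun e i
    simp at this
  · have : ∀ k, ((if k = i then 1 else if k = j then -1 else 0 : SignType) : ℝ) * L k =
        (if k = i then L k else 0) - if k = j then L k else 0 := by
      intro k
      by_cases h1 : k = i
      · subst h1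
        simp [hne]
      · by_cases h2 : k = j <;> simp [h1, h2, Ne.symm hne]
    simp only [this, Finset.sum_sub_distrib, Finset.sum_ite_eq', Finset.mem_univ, if_true, hij,
      sub_self]

theorem exists_strictAnti_comp (h : Injective L) : ∃ σ : Perm (Fin n), StrictAnti (L ∘ σ) := by
  refine ⟨Fin.revPerm.trans (Tuple.sort L), fun i j hij => ?_⟩
  exact ((Tuple.monotone_sort L).strictMono_of_injective (h.comp (Tuple.sort L).injective))
    (Fin.rev_lt_rev.2 hij)

end Attained

theorem proposition3p7 (g n : ℕ) (hn : 0 < n) (hstable : 2 < 2 * g + n) (h03 : (g, n) ≠ (0, 3))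
    (L : Fin n → ℝ) (hL : ∀ i, 0 < L i) (hres : NonResonant L) :
    IsLeast (RibbonGraph.sHatValues g n L) (ENNReal.ofReal (sStar g n)) := by
  -- The set of values does not depend on the labelling, so the perimeters may be sorted in
  -- decreasing order, as the nested examples require.
  obtain ⟨σ, hσ⟩ := exists_strictAnti_comp hres.injective
  obtain ⟨s, hs, hle⟩ := exists_mem_sHatValues_le (L := L ∘ σ)
    (p := fun i => if h : i < n then L (σ ⟨i, h⟩) else 0) hn hstable h03 (fun i => hL _)
    (fun i => by simp) (fun i hi => by
      rw [dif_pos hi, dif_pos (by omega : i < n)]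
      exact hσ (by simp [Fin.lt_def]))
  have hs' := RibbonGraph.mem_sHatValues_of_comp_perm hs
  have heq := le_antisymm hle (RibbonGraph.ofReal_sStar_le_of_mem_sHatValues hL hs')
  exact ⟨heq ▸ hs', fun _ h => RibbonGraph.ofReal_sStar_le_of_mem_sHatValues hL h⟩
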